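/- **Setting.** Let $(s_t)_{t\ge 0}$ be a time-homogeneous Markov chain on $\{1,\dots,K\}$ with transition matrix $P=(p_{i,j})$ and arbitrary initial law. The system output at time $t\ge 1$ for the input $x_t\in\mathbb{R}^n$ is $y_t=A_{s_t}x_t+b_{s_t}+w_t\in\mathbb{R}^m$, where every $A_k\in\mathbb{R}^{m\times n}$ has full column rank, $b_k\in\mathbb{R}^m$, and, conditionally on the state sequence, the noise vectors $w_1,w_2,\dots$ are independent with $w_t\sim f_{s_t}$; each $f_k$ is a probability law on $\mathbb{R}^m$ with zero mean and finite fourth moment. Fix a target $y^*\in\mathbb{R}^m$, and let $$x_i^*=\Bigl(\sum_j p_{i,j}A_j^{\mathsf T}A_j\Bigr)^{-1}\sum_j p_{i,j}A_j^{\mathsf T}(y^*-b_j),$$ the minimizer over $x\in\mathbb{R}^n$ of the quadratic stage cost $\mathbb{E}(\|y^*-y_t\|_2^2\mid s_{t-1}=i,\,x_t=x)$. Let $\Pi\subset\mathbb{R}^n$ be a convex compact set containing $x_1^*,\dots,x_K^*$, and let $(\cdot)_\Pi$ be the Euclidean projection onto $\Pi$. **MSPSA policy.** For each state $i$ fix constants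 $\gamma_i>0$, $\gamma_i'>0$, non-negative integers $N_i,N_i'$, and an initial estimate $\hat x_{i,1}\in\Pi$, and put $a_{i,k}=\gamma_i/(N_i+k)$ and $c_{i,k}=\gamma_i'/(N_i'+k)^{1/4}$. Let $\Delta_{i,k}=(\Delta_{i,k,1},\dots,\Delta_{i,k,n})$ be random vectors whose coordinates are all i.i.d. (over $i,k,l$), independent of the state and noise processes, with a law that is symmetric around zero and satisfies $|\Delta_{i,k,l}|\le\xi_1$ almost surely and $\mathbb{E}(1/\Delta_{i,k,l}^2)\le\xi_2$ for some constants $\xi_1,\xi_2>0$. Start with $t_i=0$ and $e_i=0$ for all $i$. At time $t=1,2,\dots$, let $i=s_{t-1}$. * If $e_i=0$: increase $t_i$ by $1$, apply $x_t=\hat x_{i,t_i}+c_{i,t_i}\Delta_{i,t_i}$, record $d^+_{i,t_i}=\|y_t-y^*\|_2^2$, and set $e_i=1$. * If $e_i=1$: apply $x_t=\hat x_{i,t_i}-c_{i,t_i}\Delta_{i,t_i}$, record $d^-_{i,t_i}=\|y_t-y^*\|_2^2$, set $e_i=0$, and update $$\hat x_{i,t_i+1}=\Bigl(\hat x_{i,t_i}-a_{i,t_i}\,\frac{d^+_{i,t_i}-d^-_{i,t_i}}{c_{i,t_i}}\,\bar\Delta_{i,t_i}\Bigr)_\Pi,\qquad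 \bar\Delta_{i,k}=(1/\Delta_{i,k,1},\dots,1/\Delta_{i,k,n}).$$ **Theorem.** For every choice of the constants $\gamma_i>0$, the inputs $x_T$ of the MSPSA policy satisfy $$\Pr\Bigl(\lim_{T\to\infty}\|x_T-x^*_{s_{T-1}}\|_2^2=0\Bigr)=1,$$ and $\mathbb{E}\bigl(\|x_T-x^*_{s_{T-1}}\|_2^2\bigr)$ is finite for every $T\ge 1$ with $$\lim_{T\to\infty}\mathbb{E}\bigl(\|x_T-x^*_{s_{T-1}}\|_2^2\bigr)=0.$$ -/

import Mathlib

open MeasureTheory ProbabilityTheory Filter Topology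

noncomputable section

/-- Parameters of a Markov jump affine system with states `Fin K`, inputs in `ℝⁿ`, outputs in `ℝᵐ`:
`y_t = A_{s_t} x_t + b_{s_t} + w_t`, where `s` is a Markov chain with transition matrix `P` and the
noise `w_t` has law `f_{s_t}`. -/
structure JumpAffineSystem (K m n : ℕ) where
  A : Fin K → Matrix (Fin m) (Fin n) ℝ
  b : Fin K → EuclideanSpace ℝ (Fin m)
  P : Matrix (Fin K) (Fin K) ℝ
  f : Fin K → Measure (EuclideanSpace ℝ (Fin m))

namespace JumpAffineSystem

variable {K m n : ℕ}

/-- Full column rank, stochastic transition matrix, and noise laws that are probability measures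
with zero mean and finite fourth moment. -/
structure IsAdmissible (S : JumpAffineSystem K m n) : Prop where
  rank_eq : ∀ j, (S.A j).rank = n
  stochastic : S.P ∈ Matrix.rowStochastic ℝ (Fin K)
  isProb : ∀ j, IsProbabilityMeasure (S.f j)
  mean_zero : ∀ j, ∫ w, w ∂(S.f j) = 0
  fourth_moment : ∀ j, MemLp (fun w : EuclideanSpace ℝ (Fin m) => w) 4 (S.f j)

/-- The output `A_j x + b_j + w` in state `j` for input `x` and noise `w`. -/
def output (S : JumpAffineSystem K m n) (j : Fin K) (x : EuclideanSpace ℝ (Fin n))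
    (w : EuclideanSpace ℝ (Fin m)) : EuclideanSpace ℝ (Fin m) :=
  (S.A j).toEuclideanLin x + S.b j + w

/-- The quadratic stage cost `E(‖y* - y_t‖² | s_{t-1} = i, x_t = x)`. -/
def stageCost (S : JumpAffineSystem K m n) (ystar : EuclideanSpace ℝ (Fin m)) (i : Fin K)
    (x : EuclideanSpace ℝ (Fin n)) : ℝ :=
  ∑ j, S.P i j * ∫ w, ‖ystar - S.output j x w‖ ^ 2 ∂(S.f j)

/-- The optimal input `x*_i = (∑ⱼ p_{ij} AⱼᵀAⱼ)⁻¹ (∑ⱼ p_{ij} Aⱼᵀ(y* - bⱼ))` when the previous state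
is `i`; it is the unique minimizer of `stageCost`, see
`IsAdmissible.stageCost_optInput_lt`. -/
def optInput (S : JumpAffineSystem K m n) (ystar : EuclideanSpace ℝ (Fin m)) (i : Fin K) :
    EuclideanSpace ℝ (Fin n) :=
  WithLp.toLp 2 ((∑ j, S.P i j • ((S.A j).transpose * S.A j))⁻¹.mulVec
    (∑ j, S.P i j • (S.A j).transpose.mulVec (ystar - S.b j).ofLp))

/-- Full column rank makes `x ↦ A_j x` injective. -/
lemma IsAdmissible.mulVec_eq_zero {S : JumpAffineSystem K m n} (hS : S.IsAdmissible) (j : Fin K)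
    {v : Fin n → ℝ} (hv : (S.A j).mulVec v = 0) : v = 0 := by
  have h := hS.rank_eq j
  rw [Matrix.rank] at h
  have h2 := LinearMap.finrank_range_add_finrank_ker (S.A j).mulVecLin
  rw [h] at h2
  simp only [Module.finrank_fin_fun, Nat.add_eq_left] at h2
  have h3 := Submodule.finrank_eq_zero.mp h2
  have : v ∈ LinearMap.ker (S.A j).mulVecLin := by simpa using hv
  rw [h3] at this
  simpa using this

lemma IsAdmissible.normal_equation {S : JumpAffineSystem K m n} (hS : S.IsAdmissible)
    (ystar : EuclideanSpace ℝ (Fin m)) (i : Fin K) :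
    (∑ j, S.P i j • ((S.A j).transpose * S.A j)).mulVec (S.optInput ystar i).ofLp =
      ∑ j, S.P i j • (S.A j).transpose.mulVec (ystar - S.b j).ofLp := by
  set G := ∑ j, S.P i j • ((S.A j).transpose * S.A j) with hG
  have hp := Matrix.mem_rowStochastic_iff_sum.mp hS.stochastic
  have hinj : Function.Injective G.mulVec := by
    intro u u' huu
    have h0 : G.mulVec (u - u') = 0 := by rw [Matrix.mulVec_sub, huu, sub_self]
    have h1 : ∑ j, S.P i j * ((S.A j).mulVec (u - u') ⬝ᵥ (S.A j).mulVec (u - u')) = 0 := by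
      have : (u - u') ⬝ᵥ G.mulVec (u - u') = 0 := by rw [h0, dotProduct_zero]
      rw [hG, Matrix.sum_mulVec, dotProduct_sum] at this
      rw [← this]
      refine Finset.sum_congr rfl fun j _ => ?_
      rw [Matrix.smul_mulVec, dotProduct_smul, ← Matrix.mulVec_mulVec, smul_eq_mul,
        Matrix.dotProduct_mulVec (u - u'), Matrix.vecMul_transpose]
    have hnn : ∀ j ∈ Finset.univ,
        0 ≤ S.P i j * ((S.A j).mulVec (u - u') ⬝ᵥ (S.A j).mulVec (u - u')) :=
      fun j _ => mul_nonneg (hp.1 i j) (Finset.sum_nonneg fun l _ => mul_self_nonneg _)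
    have h2 := (Finset.sum_eq_zero_iff_of_nonneg hnn).mp h1
    obtain ⟨j, hj⟩ : ∃ j, S.P i j ≠ 0 := by
      by_contra! hne
      have := hp.2 i
      simp [hne] at this
    have h3 := (mul_eq_zero.mp (h2 j (Finset.mem_univ j))).resolve_left hj
    exact sub_eq_zero.mp (hS.mulVec_eq_zero j (dotProduct_self_eq_zero.mp h3))
  have hu : IsUnit G := Matrix.mulVec_injective_iff_isUnit.mp hinj
  have hdet : IsUnit G.det := (Matrix.isUnit_iff_isUnit_det G).mp hu
  simp only [optInput]
  rw [Matrix.mulVec_mulVec, ← hG, Matrix.mul_nonsing_inv _ hdet, Matrix.one_mulVec]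

lemma IsAdmissible.stageCost_eq {S : JumpAffineSystem K m n} (hS : S.IsAdmissible)
    (ystar : EuclideanSpace ℝ (Fin m)) (i : Fin K) (x : EuclideanSpace ℝ (Fin n)) :
    S.stageCost ystar i x = ∑ j, S.P i j *
      (‖ystar - (S.A j).toEuclideanLin x - S.b j‖ ^ 2 + ∫ w, ‖w‖ ^ 2 ∂(S.f j)) := by
  unfold stageCost
  refine Finset.sum_congr rfl fun j _ => ?_
  congr 1
  have := hS.isProb j
  have hL2 : MemLp (fun w : EuclideanSpace ℝ (Fin m) => w) 2 (S.f j) :=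
    (hS.fourth_moment j).mono_exponent (by norm_num)
  have hi1 : Integrable (fun w : EuclideanSpace ℝ (Fin m) => w) (S.f j) :=
    hL2.integrable (by norm_num)
  have hi2 : Integrable (fun w : EuclideanSpace ℝ (Fin m) => ‖w‖ ^ 2) (S.f j) :=
    (memLp_two_iff_integrable_sq_norm hL2.1).mp hL2
  set u := ystar - (S.A j).toEuclideanLin x - S.b j with hu
  have hexp : ∀ w, ‖ystar - S.output j x w‖ ^ 2 = ‖u‖ ^ 2 - 2 * inner ℝ u w + ‖w‖ ^ 2 := by
    intro w
    have : ystar - S.output j x w = u - w := by simp only [output, hu]; abel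
    rw [this, norm_sub_sq_real]
  simp_rw [hexp]
  have hi3 : Integrable (fun w : EuclideanSpace ℝ (Fin m) => 2 * inner ℝ u w) (S.f j) :=
    (hi1.const_inner u).const_mul 2
  have hz : ∫ w, inner ℝ u w ∂(S.f j) = 0 := by
    rw [integral_inner hi1, hS.mean_zero j, inner_zero_right]
  have hi4 : Integrable (fun w : EuclideanSpace ℝ (Fin m) => ‖u‖ ^ 2 - 2 * inner ℝ u w) (S.f j) :=
    (integrable_const _).sub hi3
  rw [integral_add hi4 hi2, integral_sub (integrable_const _) hi3, integral_const_mul, hz]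
  simp

/-- `optInput` is the unique minimizer of the stage cost. -/
theorem IsAdmissible.stageCost_optInput_lt {S : JumpAffineSystem K m n} (hS : S.IsAdmissible)
    (ystar : EuclideanSpace ℝ (Fin m)) (i : Fin K) {x : EuclideanSpace ℝ (Fin n)}
    (hx : x ≠ S.optInput ystar i) :
    S.stageCost ystar i (S.optInput ystar i) < S.stageCost ystar i x := by
  rw [hS.stageCost_eq, hS.stageCost_eq]
  have hp := Matrix.mem_rowStochastic_iff_sum.mp hS.stochastic
  have hnorm := hS.normal_equation ystar i
  set o := S.optInput ystar i with ho
  set h := x - o with hh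
  have hxo : x = o + h := by rw [hh]; abel
  have hne : h ≠ 0 := sub_ne_zero.mpr hx
  have hcross : ∑ j, S.P i j *
      inner ℝ (ystar - (S.A j).toEuclideanLin o - S.b j) ((S.A j).toEuclideanLin h) = 0 := by
    have key : ∀ j, inner ℝ (ystar - (S.A j).toEuclideanLin o - S.b j)
        ((S.A j).toEuclideanLin h) =
        h.ofLp ⬝ᵥ (S.A j).transpose.mulVec (ystar - S.b j).ofLp -
          h.ofLp ⬝ᵥ ((S.A j).transpose * S.A j).mulVec o.ofLp := by
      intro j
      rw [← Matrix.mulVec_mulVec, ← dotProduct_sub, ← Matrix.mulVec_sub, Matrix.dotProduct_mulVec,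
        Matrix.vecMul_transpose, EuclideanSpace.inner_eq_star_dotProduct]
      simp only [star_trivial, Matrix.ofLp_toLpLin, Matrix.toLin'_apply, WithLp.ofLp_sub]
      congr 1
      abel
    simp_rw [key, mul_sub]
    rw [Finset.sum_sub_distrib]
    have e1 : ∑ j, S.P i j * (h.ofLp ⬝ᵥ (S.A j).transpose.mulVec (ystar - S.b j).ofLp) =
        h.ofLp ⬝ᵥ ∑ j, S.P i j • (S.A j).transpose.mulVec (ystar - S.b j).ofLp := by
      rw [dotProduct_sum]
      simp [dotProduct_smul]
    have e2 : ∑ j, S.P i j * (h.ofLp ⬝ᵥ ((S.A j).transpose * S.A j).mulVec o.ofLp) =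
        h.ofLp ⬝ᵥ (∑ j, S.P i j • ((S.A j).transpose * S.A j)).mulVec o.ofLp := by
      rw [Matrix.sum_mulVec, dotProduct_sum]
      simp [dotProduct_smul, Matrix.smul_mulVec]
    rw [e1, e2, hnorm, sub_self]
  obtain ⟨j₀, hj₀⟩ : ∃ j, S.P i j ≠ 0 := by
    by_contra! hall
    have := hp.2 i
    simp [hall] at this
  have hL : ∀ j, 0 < ‖(S.A j).toEuclideanLin h‖ ^ 2 := by
    intro j
    have : (S.A j).toEuclideanLin h ≠ 0 := by
      intro h0
      apply hne
      have h1 : (S.A j).mulVec h.ofLp = 0 := by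
        have := congrArg WithLp.ofLp h0
        simpa [Matrix.ofLp_toLpLin, Matrix.toLin'_apply] using this
      have h2 := hS.mulVec_eq_zero j h1
      ext l
      simp [h2]
    positivity
  have hpos : 0 < ∑ j, S.P i j * ‖(S.A j).toEuclideanLin h‖ ^ 2 :=
    Finset.sum_pos' (fun j _ => mul_nonneg (hp.1 i j) (hL j).le)
      ⟨j₀, Finset.mem_univ _, mul_pos (lt_of_le_of_ne (hp.1 i j₀) hj₀.symm) (hL j₀)⟩
  have hsum : ∑ j, S.P i j *
      (‖ystar - (S.A j).toEuclideanLin x - S.b j‖ ^ 2 + ∫ w, ‖w‖ ^ 2 ∂(S.f j)) =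
      ∑ j, S.P i j *
        (‖ystar - (S.A j).toEuclideanLin o - S.b j‖ ^ 2 + ∫ w, ‖w‖ ^ 2 ∂(S.f j)) -
      2 * ∑ j, S.P i j *
        inner ℝ (ystar - (S.A j).toEuclideanLin o - S.b j) ((S.A j).toEuclideanLin h) +
      ∑ j, S.P i j * ‖(S.A j).toEuclideanLin h‖ ^ 2 := by
    rw [Finset.mul_sum, ← Finset.sum_sub_distrib, ← Finset.sum_add_distrib]
    refine Finset.sum_congr rfl fun j _ => ?_
    have : ystar - (S.A j).toEuclideanLin x - S.b j =
        (ystar - (S.A j).toEuclideanLin o - S.b j) - (S.A j).toEuclideanLin h := by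
      rw [hxo, map_add]; abel
    rw [this, norm_sub_sq_real]
    ring
  rw [hsum, hcross]
  linarith

/-- `s`, `w` are the state and noise processes of the system `S` on the probability space `(Ω, μ)`:
`s` is a (time-homogeneous) Markov chain with transition matrix `P` and an arbitrary initial law,
and, conditionally on the states, the noise vectors `w_1, w_2, …` are independent with
`w_t` distributed according to `f_{s_t}`. -/
structure IsRealization (S : JumpAffineSystem K m n) {Ω : Type*} [MeasurableSpace Ω] (μ : Measure Ω)
    (s : ℕ → Ω → Fin K) (w : ℕ → Ω → EuclideanSpace ℝ (Fin m)) : Prop where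
  measurable_state : ∀ t, Measurable (s t)
  measurable_noise : ∀ t, Measurable (w t)
  markov : ∀ (T : ℕ) (a : ℕ → Fin K),
    μ {ω | ∀ t ≤ T + 1, s t ω = a t} =
      μ {ω | ∀ t ≤ T, s t ω = a t} * ENNReal.ofReal (S.P (a T) (a (T + 1)))
  noise : ∀ (T : ℕ) (a : ℕ → Fin K) (B : ℕ → Set (EuclideanSpace ℝ (Fin m))),
    (∀ t, MeasurableSet (B t)) →
    μ {ω | (∀ t ≤ T, s t ω = a t) ∧ ∀ t ∈ Finset.Icc 1 T, w t ω ∈ B t} =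
      μ {ω | ∀ t ≤ T, s t ω = a t} * ∏ t ∈ Finset.Icc 1 T, S.f (a t) (B t)

end JumpAffineSystem

open Classical in
/-- Euclidean projection onto `C`: a point of `C` nearest to `x` (it exists and is unique when `C`
is nonempty, compact and convex; junk value `x` if there is no nearest point). -/
def euclideanProj {n : ℕ} (C : Set (EuclideanSpace ℝ (Fin n))) (x : EuclideanSpace ℝ (Fin n)) :
    EuclideanSpace ℝ (Fin n) :=
  if h : ∃ p ∈ C, ∀ q ∈ C, ‖x - p‖ ≤ ‖x - q‖ then h.choose else x

/-- The projection onto a nonempty compact set is a nearest point. -/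
lemma euclideanProj_spec {n : ℕ} {C : Set (EuclideanSpace ℝ (Fin n))} (hC : IsCompact C)
    (hne : C.Nonempty) (x : EuclideanSpace ℝ (Fin n)) :
    euclideanProj C x ∈ C ∧ ∀ q ∈ C, ‖x - euclideanProj C x‖ ≤ ‖x - q‖ := by
  have h : ∃ p ∈ C, ∀ q ∈ C, ‖x - p‖ ≤ ‖x - q‖ := by
    obtain ⟨p, hp, hmin⟩ := hC.exists_isMinOn hne
      (f := fun p => ‖x - p‖) (by fun_prop)
    exact ⟨p, hp, fun q hq => hmin hq⟩
  rw [euclideanProj, dif_pos h]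
  exact h.choose_spec

/-- Tuning parameters of the policy: gains `γ, γ'`, offsets `N, N'` and initial estimates. -/
structure MSPSAParams (K n : ℕ) where
  γ : Fin K → ℝ
  γ' : Fin K → ℝ
  N : Fin K → ℕ
  N' : Fin K → ℕ
  xinit : Fin K → EuclideanSpace ℝ (Fin n)

/-- What the policy stores for each state `i`: the current estimate of the optimal input, the
counter `t_i`, the flag `e_i` (true when the estimate has been observed once), and the last `d⁺`. -/
structure MSPSAMemory (K n : ℕ) where
  est : Fin K → EuclideanSpace ℝ (Fin n)
  cnt : Fin K → ℕ
  flag : Fin K → Bool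
  dplus : Fin K → ℝ

namespace MSPSAParams

variable {K m n : ℕ}

/-- Step size `a_k = γ_i / (N_i + k)`. -/
def stepSize (par : MSPSAParams K n) (i : Fin K) (k : ℕ) : ℝ := par.γ i / (par.N i + k)

/-- Perturbation gain `c_k = γ'_i / (N'_i + k)^(1/4)`. -/
def pertGain (par : MSPSAParams K n) (i : Fin K) (k : ℕ) : ℝ :=
  par.γ' i / ((par.N' i : ℝ) + k) ^ (1 / 4 : ℝ)

/-- Initial memory; a state's entry is not read or changed before the state first occurs. -/
def initMemory (par : MSPSAParams K n) : MSPSAMemory K n where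
  est := par.xinit
  cnt := fun _ => 0
  flag := fun _ => false
  dplus := fun _ => 0

/-- The input chosen with memory `M` after observing state `i`; `δ i k` is the `k`-th perturbation
vector for state `i`. -/
def inputOf (par : MSPSAParams K n) (δ : Fin K → ℕ → EuclideanSpace ℝ (Fin n))
    (M : MSPSAMemory K n) (i : Fin K) : EuclideanSpace ℝ (Fin n) :=
  if M.flag i then M.est i - par.pertGain i (M.cnt i) • δ i (M.cnt i)
  else M.est i + par.pertGain i (M.cnt i + 1) • δ i (M.cnt i + 1)

/-- The update of the memory when state `i` was observed, `inputOf` was applied, and the resulting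
output is `y`. -/
def step (par : MSPSAParams K n) (C : Set (EuclideanSpace ℝ (Fin n)))
    (ystar : EuclideanSpace ℝ (Fin m)) (δ : Fin K → ℕ → EuclideanSpace ℝ (Fin n))
    (M : MSPSAMemory K n) (i : Fin K) (y : EuclideanSpace ℝ (Fin m)) : MSPSAMemory K n :=
  if M.flag i then
    { M with
      est := Function.update M.est i (euclideanProj C (M.est i -
        (par.stepSize i (M.cnt i) *
          ((M.dplus i - ‖y - ystar‖ ^ 2) / par.pertGain i (M.cnt i))) •
            WithLp.toLp 2 (fun l => 1 / δ i (M.cnt i) l)))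
      flag := Function.update M.flag i false }
  else
    { M with
      cnt := Function.update M.cnt i (M.cnt i + 1)
      dplus := Function.update M.dplus i (‖y - ystar‖ ^ 2)
      flag := Function.update M.flag i true }

/-- The memory after `t` stages, when the states are `s 0, s 1, …`, the noises are `w 1, w 2, …`,
the perturbations are `δ`, and the policy is run on the system `S`. -/
def memory (par : MSPSAParams K n) (S : JumpAffineSystem K m n)
    (C : Set (EuclideanSpace ℝ (Fin n))) (ystar : EuclideanSpace ℝ (Fin m))
    (s : ℕ → Fin K) (w : ℕ → EuclideanSpace ℝ (Fin m))
    (δ : Fin K → ℕ → EuclideanSpace ℝ (Fin n)) : ℕ → MSPSAMemory K n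
  | 0 => par.initMemory
  | t + 1 =>
    let M := memory par S C ystar s w δ t
    par.step C ystar δ M (s t) (S.output (s (t + 1)) (par.inputOf δ M (s t)) (w (t + 1)))

/-- The input `x_{t+1}` of the policy, chosen after observing `s 0, …, s t`. -/
def nextInput (par : MSPSAParams K n) (S : JumpAffineSystem K m n)
    (C : Set (EuclideanSpace ℝ (Fin n))) (ystar : EuclideanSpace ℝ (Fin m))
    (s : ℕ → Fin K) (w : ℕ → EuclideanSpace ℝ (Fin m))
    (δ : Fin K → ℕ → EuclideanSpace ℝ (Fin n)) (t : ℕ) : EuclideanSpace ℝ (Fin n) :=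
  par.inputOf δ (par.memory S C ystar s w δ t) (s t)

end MSPSAParams

/-- Law of a perturbation coordinate: symmetric around zero, bounded by `ξ₁`, and with
`E(1/Δ²) ≤ ξ₂` (where `1/0 = ∞`). -/
structure IsPerturbationLaw (ν : Measure ℝ) (ξ₁ ξ₂ : ℝ) : Prop where
  isProb : IsProbabilityMeasure ν
  symm : ν.map (fun x => -x) = ν
  bounded : ∀ᵐ x ∂ν, |x| ≤ ξ₁
  inv_sq : ∫⁻ x, (ENNReal.ofReal (x ^ 2))⁻¹ ∂ν ≤ ENNReal.ofReal ξ₂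

/-- The perturbation coordinates `Δ_{i,k,l}` are i.i.d. with law `ν`, and independent of the state
and noise processes. -/
structure ArePerturbations {K m n : ℕ} {Ω : Type*} [MeasurableSpace Ω] (μ : Measure Ω)
    (ν : Measure ℝ) (s : ℕ → Ω → Fin K) (w : ℕ → Ω → EuclideanSpace ℝ (Fin m))
    (Δ : Fin K → ℕ → Ω → EuclideanSpace ℝ (Fin n)) : Prop where
  measurable : ∀ i k, Measurable (Δ i k)
  law : ∀ i k l, μ.map (fun ω => Δ i k ω l) = ν
  indep : iIndepFun (fun (q : Fin K × ℕ × Fin n) ω => Δ q.1 q.2.1 ω q.2.2) μ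
  indep_system : IndepFun (fun ω (q : Fin K × ℕ) => Δ q.1 q.2 ω)
    (fun ω (t : ℕ) => (s t ω, w t ω)) μ

end

/-! Fix a state `i` and follow the squared distance `V` of its estimate to `x_i^*`. An input never
influences the state chain, so the entry of `i` evolves by itself and moves only at the second visit
of each pair of visits. Projection onto a convex set containing `x_i^*` does not increase `V`, so an
update with `z = x - x_i^*` gives `V' ≤ V - 2 (a/c)(d⁺ - d⁻)⟨z, Δ⁻¹⟩ + (a/c)² ‖Δ⁻¹‖² (d⁺ - d⁻)²`.

Write each observed loss as the stage cost at the applied input plus an observation error. The stage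
cost is quadratic, so its central difference is exactly `4c⟨Δ, Hz⟩` with `H = ∑ⱼ p_{ij} AⱼᵀAⱼ`, and
there is no bias from finite differences. Symmetry and independence of the coordinates of `Δ` give
`E⟨z, Δ⁻¹⟩⟨Δ, Hz⟩ = ⟨z, Hz⟩`, which dominates a positive multiple of `‖z‖²`. Hence `V` has drift at
most `-8 c₀ a_k V` for some `c₀ > 0`, up to three perturbations: the observation errors
(`noiseIncr`), the deviation of the random direction from its mean (`directionIncr`), and the
squared step (`stepSq`, dominated by `squareIncr`). The inequality is `sq_dist_succ_le`.

Since `∑ (a_k/c_k)² < ∞`, the three perturbation series converge almost surely; since `∑ a_k = ∞`,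
the drift then forces `V → 0` (`tendsto_zero_of_perturbed_descent`). Only these two properties of
the gains matter, so every `γ_i > 0` is allowed.

The two signed series are martingales for different filtrations. For the observation errors the
history contains the past states and noises and all perturbations, even future ones: these are
independent of the system, so the next state and noise still have conditional law `stepLaw i`
(`restrict_history_inter_step`). For the directions the whole state and noise path is frozen.
Counters and flags are then deterministic, and the estimate depends only on perturbations of
completed updates, of which the next one is independent; Fubini returns to the random path. The
squared steps have finite expected sum, by the fourth moments of the noise and the bound on
`E(1/Δ²)`.

The two observations of a pair may be far apart in time. The error of the first is booked when it
occurs and carried in `pendingNoise` until the update; this correction tends to zero.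

No recurrence is assumed: a state visited finitely often is eventually never the current one. At a
state visited infinitely often `c_k → 0`, so inputs converge together with estimates. Inputs are
almost surely uniformly bounded, so convergence in mean follows by dominated convergence. -/

noncomputable section

/-! ### Euclidean projection onto a compact convex set -/

section Projection

variable {n : ℕ} {C : Set (EuclideanSpace ℝ (Fin n))}

lemma inner_sub_euclideanProj_le_zero (hC : IsCompact C) (hconv : Convex ℝ C) (hne : C.Nonempty)
    (x : EuclideanSpace ℝ (Fin n)) {q : EuclideanSpace ℝ (Fin n)} (hq : q ∈ C) :
    inner ℝ (x - euclideanProj C x) (q - euclideanProj C x) ≤ 0 := by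
  obtain ⟨h1, h2⟩ := euclideanProj_spec hC hne x
  refine (norm_eq_iInf_iff_real_inner_le_zero hconv h1).mp ?_ q hq
  have : Nonempty C := ⟨⟨_, h1⟩⟩
  refine le_antisymm (le_ciInf fun w => h2 w w.2) ?_
  exact ciInf_le (f := fun w : C => ‖x - w‖) ⟨0, by rintro _ ⟨w, rfl⟩; positivity⟩ ⟨_, h1⟩

/-- Adding the variational inequalities at the two projections gives firm nonexpansiveness, `‖p -
q‖² ≤ ⟨x - y, p - q⟩`; Cauchy–Schwarz does the rest. -/
lemma norm_euclideanProj_sub_le (hC : IsCompact C) (hconv : Convex ℝ C) (hne : C.Nonempty)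
    (x y : EuclideanSpace ℝ (Fin n)) :
    ‖euclideanProj C x - euclideanProj C y‖ ≤ ‖x - y‖ := by
  set p := euclideanProj C x with hp
  set q := euclideanProj C y with hq
  have h1 := inner_sub_euclideanProj_le_zero hC hconv hne x (euclideanProj_spec hC hne y).1
  have h2 := inner_sub_euclideanProj_le_zero hC hconv hne y (euclideanProj_spec hC hne x).1
  rw [← hp, ← hq] at h1 h2
  have h3 : ‖p - q‖ ^ 2 ≤ inner ℝ (x - y) (p - q) := by
    have e : x - y = (p - q) + (x - p) - (y - q) := by abel
    have e2 : q - p = -(p - q) := by abel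
    rw [e2, inner_neg_right] at h1
    rw [e, inner_sub_left, inner_add_left, real_inner_self_eq_norm_sq]
    linarith
  have h4 := real_inner_le_norm (x - y) (p - q)
  by_contra! h
  nlinarith [norm_nonneg (p - q), norm_nonneg (x - y)]

lemma continuous_euclideanProj (hC : IsCompact C) (hconv : Convex ℝ C) (hne : C.Nonempty) :
    Continuous (euclideanProj C) :=
  (LipschitzWith.of_dist_le_mul (K := 1) fun x y => by
    simpa [dist_eq_norm] using norm_euclideanProj_sub_le hC hconv hne x y).continuous

lemma euclideanProj_of_mem (hC : IsCompact C) {x : EuclideanSpace ℝ (Fin n)} (hx : x ∈ C) :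
    euclideanProj C x = x := by
  have := (euclideanProj_spec hC ⟨x, hx⟩ x).2 x hx
  rw [sub_self, norm_zero, norm_le_zero_iff, sub_eq_zero] at this
  exact this.symm

lemma norm_euclideanProj_sub_le_of_mem (hC : IsCompact C) (hconv : Convex ℝ C)
    (x : EuclideanSpace ℝ (Fin n)) {q : EuclideanSpace ℝ (Fin n)} (hq : q ∈ C) :
    ‖euclideanProj C x - q‖ ≤ ‖x - q‖ := by
  have := norm_euclideanProj_sub_le hC hconv ⟨q, hq⟩ x q
  rwa [euclideanProj_of_mem hC hq] at this

end Projection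

/-! ### Random variables with a fixed conditional law -/

section ConditionalLaw

variable {Ω β γ : Type*} {m m0 : MeasurableSpace Ω} [MeasurableSpace β] [MeasurableSpace γ]
  {ρ : Measure Ω} {κ : Measure β} {Y : Ω → β} {U : Ω → γ}

/-- If `Y` has law `κ` independently of the sub-σ-algebra `m`, then the joint law of `Y` and an
`m`-measurable variable is a product. -/
lemma map_prodMk_eq_prod_of_indep [IsFiniteMeasure ρ] [IsProbabilityMeasure κ] (hm : m ≤ m0)
    (hY : Measurable Y)
    (hind : ∀ E, MeasurableSet[m] E → ∀ B, MeasurableSet B → ρ (E ∩ Y ⁻¹' B) = ρ E * κ B)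
    (hU : Measurable[m] U) :
    ρ.map (fun ω => (U ω, Y ω)) = (ρ.map U).prod κ := by
  have hU' : Measurable U := hU.mono hm le_rfl
  refine (Measure.prod_eq fun A B hA hB => ?_).symm
  rw [Measure.map_apply (hU'.prodMk hY) (hA.prod hB), Measure.map_apply hU' hA,
    ← hind _ (hU hA) B hB]
  rfl

lemma lintegral_comp_prodMk_of_indep [IsFiniteMeasure ρ] [IsProbabilityMeasure κ] (hm : m ≤ m0)
    (hY : Measurable Y)
    (hind : ∀ E, MeasurableSet[m] E → ∀ B, MeasurableSet B → ρ (E ∩ Y ⁻¹' B) = ρ E * κ B)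
    (hU : Measurable[m] U) {f : γ × β → ENNReal} (hf : Measurable f) :
    ∫⁻ ω, f (U ω, Y ω) ∂ρ = ∫⁻ ω, ∫⁻ y, f (U ω, y) ∂κ ∂ρ := by
  have hU' : Measurable U := hU.mono hm le_rfl
  rw [← lintegral_map (f := f) (g := fun ω => (U ω, Y ω)) hf (hU'.prodMk hY),
    map_prodMk_eq_prod_of_indep hm hY hind hU, lintegral_prod _ hf.aemeasurable,
    lintegral_map hf.lintegral_prod_right' hU']

/-- The form in which a conditional mean zero enters the martingale criterion. The measure `ρ` is
only assumed finite because it is also applied to the restriction of `μ` to the event that the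
current state is `i`. -/
lemma setIntegral_comp_prodMk_eq_zero_of_indep [IsFiniteMeasure ρ] [IsProbabilityMeasure κ]
    (hm : m ≤ m0) (hY : Measurable Y)
    (hind : ∀ E, MeasurableSet[m] E → ∀ B, MeasurableSet B → ρ (E ∩ Y ⁻¹' B) = ρ E * κ B)
    (hU : Measurable[m] U) {φ : γ × β → ℝ} (hφ : Measurable φ)
    (hint : Integrable (fun ω => φ (U ω, Y ω)) ρ) (hzero : ∀ u, ∫ y, φ (u, y) ∂κ = 0)
    {E : Set Ω} (hE : MeasurableSet[m] E) :
    ∫ ω in E, φ (U ω, Y ω) ∂ρ = 0 := by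
  -- The indicator of `E` is carried as one more `m`-measurable coordinate, so the set integral
  -- becomes an integral against the product law.
  have hV : Measurable[m] (fun ω => (E.indicator (fun _ => (1 : ℝ)) ω, U ω)) :=
    (Measurable.indicator (measurable_const) hE).prodMk hU
  have hV' : Measurable (fun ω => (E.indicator (fun _ => (1 : ℝ)) ω, U ω)) := hV.mono hm le_rfl
  have hg : Measurable (fun p : (ℝ × γ) × β => p.1.1 * φ (p.1.2, p.2)) := by fun_prop
  have key : ∀ ω, E.indicator (fun ω => φ (U ω, Y ω)) ω =
      (fun p : (ℝ × γ) × β => p.1.1 * φ (p.1.2, p.2))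
        ((E.indicator (fun _ => (1 : ℝ)) ω, U ω), Y ω) := by
    intro ω
    by_cases h : ω ∈ E <;> simp [h]
  have hint' : Integrable (fun p : (ℝ × γ) × β => p.1.1 * φ (p.1.2, p.2))
      (ρ.map (fun ω => ((E.indicator (fun _ => (1 : ℝ)) ω, U ω), Y ω))) := by
    rw [integrable_map_measure hg.aestronglyMeasurable (hV'.prodMk hY).aemeasurable]
    exact (hint.indicator (hm _ hE)).congr (ae_of_all _ key)
  rw [← integral_indicator (hm _ hE), integral_congr_ae (ae_of_all _ key),
    ← integral_map (f := fun p : (ℝ × γ) × β => p.1.1 * φ (p.1.2, p.2))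
      (hV'.prodMk hY).aemeasurable hg.aestronglyMeasurable]
  rw [map_prodMk_eq_prod_of_indep hm hY hind hV] at hint' ⊢
  rw [integral_prod _ hint']
  simp [integral_const_mul, hzero]

end ConditionalLaw

/-! ### Square-summable martingale differences -/

section RandomSeries

variable {Ω : Type*} {m0 : MeasurableSpace Ω} {μ : Measure Ω} [IsProbabilityMeasure μ]
  {ℱ : Filtration ℕ m0} {ξ : ℕ → Ω → ℝ}

/-- A series of martingale differences with summable second moments converges almost surely. -/
theorem ae_exists_tendsto_sum_of_martingale_differences
    (hadapt : ∀ n, Measurable[ℱ (n + 1)] (ξ n))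
    (hmean : ∀ n, Integrable (ξ n) μ → ∀ A, MeasurableSet[ℱ n] A → ∫ ω in A, ξ n ω ∂μ = 0)
    (hsum : ∑' n, ∫⁻ ω, ENNReal.ofReal (ξ n ω ^ 2) ∂μ ≠ ⊤) :
    ∀ᵐ ω ∂μ, ∃ l, Tendsto (fun n => ∑ k ∈ Finset.range n, ξ k ω) atTop (𝓝 l) := by
  have hmeas : ∀ n, Measurable (ξ n) := fun n => (hadapt n).mono (ℱ.le _) le_rfl
  have hsq : ∀ n, Integrable (fun ω => ξ n ω ^ 2) μ := by
    intro n
    refine ⟨((hmeas n).pow_const 2).aestronglyMeasurable, ?_⟩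
    rw [hasFiniteIntegral_iff_ofReal (ae_of_all _ fun ω => sq_nonneg _)]
    exact (ENNReal.ne_top_of_tsum_ne_top hsum n).lt_top
  have hL2 : ∀ n, MemLp (ξ n) 2 μ := fun n =>
    (memLp_two_iff_integrable_sq (hmeas n).aestronglyMeasurable).mpr (hsq n)
  -- Integrability follows from the second moments, which is why `hmean` may take it as a premise.
  have hint : ∀ n, Integrable (ξ n) μ := fun n => (hL2 n).integrable (by norm_num)
  set S : ℕ → Ω → ℝ := fun n ω => ∑ k ∈ Finset.range n, ξ k ω with hS
  have hSad : ∀ n, Measurable[ℱ n] (S n) := fun n =>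
    Finset.measurable_sum _ fun k hk =>
      (hadapt k).mono (ℱ.mono (Finset.mem_range.mp hk)) le_rfl
  have hSL2 : ∀ n, MemLp (S n) 2 μ := fun n => memLp_finsetSum _ fun k _ => hL2 k
  have hSint : ∀ n, Integrable (S n) μ := fun n => (hSL2 n).integrable (by norm_num)
  have hstep : ∀ n ω, S (n + 1) ω = S n ω + ξ n ω := fun n ω => Finset.sum_range_succ _ _
  have hmart : Martingale S ℱ μ := by
    refine martingale_of_setIntegral_eq_succ (fun n => (hSad n).stronglyMeasurable) hSint ?_
    intro n A hA
    simp_rw [hstep]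
    rw [integral_add (hSint n).integrableOn (hint n).integrableOn, hmean n (hint n) A hA, add_zero]
  have hcond : ∀ n, μ[ξ n | ℱ n] =ᵐ[μ] 0 := by
    intro n
    refine (ae_eq_condExp_of_forall_setIntegral_eq (ℱ.le n) (hint n) (fun A _ _ =>
      (integrable_zero _ _ _).integrableOn) (fun A hA _ => ?_)
      aestronglyMeasurable_zero).symm
    rw [hmean n (hint n) A hA]
    simp
  -- The increment is orthogonal to the past: pull `S n` out of the conditional expectation given `ℱ
  -- n`.
  have hcross : ∀ n, ∫ ω, S n ω * ξ n ω ∂μ = 0 := by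
    intro n
    have hi : Integrable (S n * ξ n) μ := (hSL2 n).integrable_mul (hL2 n)
    have h1 := condExp_mul_of_aestronglyMeasurable_left (m := ℱ n)
      (hSad n).stronglyMeasurable.aestronglyMeasurable hi (hint n)
    have h2 : ∫ ω, (μ[S n * ξ n | ℱ n]) ω ∂μ = ∫ ω, (S n * ξ n) ω ∂μ := integral_condExp (ℱ.le n)
    have h3 : ∫ ω, (S n * ξ n) ω ∂μ = 0 := by
      rw [← h2, integral_congr_ae h1]
      refine (integral_congr_ae (g := fun _ => (0 : ℝ)) ?_).trans (by simp)
      filter_upwards [hcond n] with ω hω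
      simp [hω]
    exact h3
  have hsecond : ∀ n, ∫ ω, S n ω ^ 2 ∂μ = ∑ k ∈ Finset.range n, ∫ ω, ξ k ω ^ 2 ∂μ := by
    intro n
    induction n with
    | zero => simp [hS]
    | succ n ih =>
      have e : ∀ ω, S (n + 1) ω ^ 2 = S n ω ^ 2 + 2 * (S n ω * ξ n ω) + ξ n ω ^ 2 := by
        intro ω
        rw [hstep]
        ring
      have i1 : Integrable (fun ω => S n ω ^ 2) μ := (hSL2 n).integrable_sq
      have i2 : Integrable (fun ω => 2 * (S n ω * ξ n ω)) μ :=
        ((hSL2 n).integrable_mul (hL2 n)).const_mul 2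
      have i3 : Integrable (fun ω => S n ω ^ 2 + 2 * (S n ω * ξ n ω)) μ := i1.add i2
      simp_rw [e]
      rw [integral_add i3 (hsq n), integral_add i1 i2, integral_const_mul, hcross n, ih,
        Finset.sum_range_succ]
      ring
  set R : ℝ := (∑' n, ∫⁻ ω, ENNReal.ofReal (ξ n ω ^ 2) ∂μ).toReal with hR
  have hbound : ∀ n, ∫ ω, S n ω ^ 2 ∂μ ≤ R := by
    intro n
    rw [hsecond n]
    have : ∀ k, ∫ ω, ξ k ω ^ 2 ∂μ = (∫⁻ ω, ENNReal.ofReal (ξ k ω ^ 2) ∂μ).toReal := fun k =>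
      integral_eq_lintegral_of_nonneg_ae (ae_of_all _ fun ω => sq_nonneg _)
        ((hmeas k).pow_const 2).aestronglyMeasurable
    simp_rw [this]
    rw [← ENNReal.toReal_sum fun k _ => ENNReal.ne_top_of_tsum_ne_top hsum k]
    exact ENNReal.toReal_mono hsum (ENNReal.sum_le_tsum _)
  -- Orthogonality bounds the second moments by `R`, and `|x| ≤ 1 + x²` turns this into the bound in
  -- `L¹` needed for Doob's convergence theorem.
  refine hmart.submartingale.exists_ae_tendsto_of_bdd (R := Real.toNNReal (1 + R)) fun n => ?_
  rw [eLpNorm_one_eq_lintegral_enorm]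
  calc ∫⁻ ω, ‖S n ω‖ₑ ∂μ ≤ ∫⁻ ω, ENNReal.ofReal (1 + S n ω ^ 2) ∂μ := by
        refine lintegral_mono fun ω => ?_
        rw [← ofReal_norm]
        refine ENNReal.ofReal_le_ofReal ?_
        rw [Real.norm_eq_abs, ← sq_abs]
        nlinarith [sq_nonneg (|S n ω| - 1), abs_nonneg (S n ω)]
    _ = ENNReal.ofReal (∫ ω, (1 + S n ω ^ 2) ∂μ) :=
        (ofReal_integral_eq_lintegral_ofReal ((integrable_const _).add (hSL2 n).integrable_sq)
          (ae_of_all _ fun ω => add_nonneg zero_le_one (sq_nonneg _))).symm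
    _ ≤ ENNReal.ofReal (1 + R) := by
        refine ENNReal.ofReal_le_ofReal ?_
        rw [integral_add (integrable_const _) (hSL2 n).integrable_sq]
        simpa using hbound n

end RandomSeries

/-! ### A deterministic descent lemma -/

/-- A nonnegative sequence that satisfies a perturbed descent inequality with divergent gains and
convergent perturbations tends to zero. -/
theorem tendsto_zero_of_perturbed_descent {V p κ u : ℕ → ℝ} {l : ℝ} (hV : ∀ t, 0 ≤ V t)
    (hκ : ∀ t, 0 ≤ κ t) (hp : Tendsto p atTop (𝓝 0))
    (hdesc : ∀ t, V (t + 1) - p (t + 1) ≤ V t - p t - κ t * V t + u t)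
    (hu : Tendsto (fun T => ∑ t ∈ Finset.range T, u t) atTop (𝓝 l))
    (hdiv : Tendsto (fun T => ∑ t ∈ Finset.range T, κ t) atTop atTop) :
    Tendsto V atTop (𝓝 0) := by
  -- Removing the correction `p` and the accumulated perturbations leaves a nonincreasing sequence.
  -- It is bounded below since `V ≥ 0` and both removed parts converge, so `V` itself has a limit.
  set W : ℕ → ℝ := fun t => V t - p t - ∑ τ ∈ Finset.range t, u τ with hW
  have hWstep : ∀ t, W (t + 1) ≤ W t - κ t * V t := by
    intro t
    simp only [hW, Finset.sum_range_succ]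
    linarith [hdesc t]
  have hanti : Antitone W := antitone_nat_of_succ_le fun t => by
    linarith [hWstep t, mul_nonneg (hκ t) (hV t)]
  have hlow : Tendsto (fun t => - p t - ∑ τ ∈ Finset.range t, u τ) atTop (𝓝 (- 0 - l)) :=
    hp.neg.sub hu
  obtain ⟨b, hb⟩ := hlow.bddBelow_range
  have hWb : ∀ t, b ≤ W t := fun t => by
    have := hb ⟨t, rfl⟩
    simp only [hW]
    simp only at this
    linarith [hV t]
  have hWlim : Tendsto W atTop (𝓝 (⨅ t, W t)) :=
    tendsto_atTop_ciInf hanti ⟨b, by rintro _ ⟨t, rfl⟩; exact hWb t⟩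
  have hVlim : Tendsto V atTop (𝓝 ((⨅ t, W t) + 0 + l)) :=
    ((hWlim.add hp).add hu).congr fun t => by simp only [hW]; ring
  set v := (⨅ t, W t) + 0 + l with hv
  have hv0 : 0 ≤ v := ge_of_tendsto' hVlim hV
  have hsum : ∀ T, ∑ t ∈ Finset.range T, κ t * V t ≤ W 0 - b := by
    intro T
    have : ∑ t ∈ Finset.range T, κ t * V t ≤ W 0 - W T := by
      induction T with
      | zero => simp
      | succ T ih => rw [Finset.sum_range_succ]; linarith [hWstep T]
    linarith [hWb T]
  rcases hv0.eq_or_lt with h | h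
  · rwa [← h] at hVlim
  -- If the limit `v` were positive, then `V > v/2` from `T₀` on, and the bound `W 0 - b` on `∑ κ V`
  -- would bound `∑ κ`. The index `T` is taken so large that the gains after `T₀` exceed this bound.
  exfalso
  obtain ⟨T₀, hT₀⟩ := eventually_atTop.mp (hVlim.eventually (lt_mem_nhds (half_lt_self h)))
  obtain ⟨T, hT, hT'⟩ := ((hdiv.eventually_gt_atTop
    (∑ t ∈ Finset.range T₀, κ t + (W 0 - b) / (v / 2))).and (eventually_ge_atTop T₀)).exists
  have h1 : (∑ t ∈ Finset.range T, κ t - ∑ t ∈ Finset.range T₀, κ t) * (v / 2) ≤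
      ∑ t ∈ Finset.range T, κ t * V t := by
    rw [← Finset.sum_Ico_eq_sub _ hT', Finset.sum_mul]
    calc ∑ t ∈ Finset.Ico T₀ T, κ t * (v / 2) ≤ ∑ t ∈ Finset.Ico T₀ T, κ t * V t :=
          Finset.sum_le_sum fun t ht =>
            mul_le_mul_of_nonneg_left (hT₀ t (Finset.mem_Ico.mp ht).1).le (hκ t)
      _ ≤ _ := by
          rw [Finset.range_eq_Ico]
          exact Finset.sum_le_sum_of_subset_of_nonneg
            (Finset.Ico_subset_Ico_left (Nat.zero_le _)) fun t _ _ => mul_nonneg (hκ t) (hV t)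
  have h2 : (W 0 - b) / (v / 2) * (v / 2) = W 0 - b := div_mul_cancel₀ _ (by positivity)
  nlinarith [hsum T]

/-! ### The stage cost as a strongly convex quadratic -/

namespace JumpAffineSystem

variable {K m n : ℕ}

/-- Half the Hessian of the stage cost in state `i`: the operator `∑ⱼ p_{ij} AⱼᵀAⱼ`. -/
def curvature (S : JumpAffineSystem K m n) (i : Fin K) :
    EuclideanSpace ℝ (Fin n) →ₗ[ℝ] EuclideanSpace ℝ (Fin n) :=
  (∑ j, S.P i j • ((S.A j).transpose * S.A j)).toEuclideanLin

lemma inner_curvature (S : JumpAffineSystem K m n) (i : Fin K) (h z : EuclideanSpace ℝ (Fin n)) :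
    inner ℝ h (S.curvature i z) =
      ∑ j, S.P i j * inner ℝ ((S.A j).toEuclideanLin h) ((S.A j).toEuclideanLin z) := by
  simp only [curvature, EuclideanSpace.inner_eq_star_dotProduct, star_trivial,
    Matrix.ofLp_toLpLin, Matrix.toLin'_apply]
  rw [Matrix.sum_mulVec, sum_dotProduct]
  refine Finset.sum_congr rfl fun j _ => ?_
  rw [Matrix.smul_mulVec, smul_dotProduct, ← Matrix.mulVec_mulVec, smul_eq_mul, dotProduct_comm,
    Matrix.dotProduct_mulVec, Matrix.vecMul_transpose, dotProduct_comm]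

variable {S : JumpAffineSystem K m n}

/-- First-order optimality: the normal equations tested against `h`. It kills the linear term of the
stage cost around the optimal input. -/
lemma IsAdmissible.sum_inner_residual_optInput (hS : S.IsAdmissible)
    (ystar : EuclideanSpace ℝ (Fin m)) (i : Fin K) (h : EuclideanSpace ℝ (Fin n)) :
    ∑ j, S.P i j * inner ℝ (ystar - (S.A j).toEuclideanLin (S.optInput ystar i) - S.b j)
      ((S.A j).toEuclideanLin h) = 0 := by
  have hnorm := hS.normal_equation ystar i
  have key : ∀ j, inner ℝ (ystar - (S.A j).toEuclideanLin (S.optInput ystar i) - S.b j)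
      ((S.A j).toEuclideanLin h) =
      h.ofLp ⬝ᵥ (S.A j).transpose.mulVec (ystar - S.b j).ofLp -
        h.ofLp ⬝ᵥ ((S.A j).transpose * S.A j).mulVec (S.optInput ystar i).ofLp := by
    intro j
    rw [← Matrix.mulVec_mulVec, ← dotProduct_sub, ← Matrix.mulVec_sub, Matrix.dotProduct_mulVec,
      Matrix.vecMul_transpose, EuclideanSpace.inner_eq_star_dotProduct]
    simp only [star_trivial, Matrix.ofLp_toLpLin, Matrix.toLin'_apply, WithLp.ofLp_sub]
    congr 1
    abel
  have e := congrArg (fun v => h.ofLp ⬝ᵥ v) hnorm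
  simp only [Matrix.sum_mulVec, dotProduct_sum, Matrix.smul_mulVec, dotProduct_smul,
    smul_eq_mul] at e
  simp_rw [key, mul_sub]
  rw [Finset.sum_sub_distrib, e, sub_self]

/-- Central differences of the stage cost are exact. -/
lemma IsAdmissible.stageCost_add_sub_stageCost_sub (hS : S.IsAdmissible)
    (ystar : EuclideanSpace ℝ (Fin m)) (i : Fin K) (x h : EuclideanSpace ℝ (Fin n)) :
    S.stageCost ystar i (x + h) - S.stageCost ystar i (x - h) =
      4 * inner ℝ h (S.curvature i (x - S.optInput ystar i)) := by
  rw [hS.stageCost_eq, hS.stageCost_eq, inner_curvature, ← Finset.sum_sub_distrib]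
  have h0 := hS.sum_inner_residual_optInput ystar i h
  -- The identity fails for a single `j`; subtracting four times the vanishing first-order sum makes
  -- it hold term by term.
  rw [Finset.mul_sum, ← sub_zero (∑ j, 4 * _), ← mul_zero (4 : ℝ), ← h0, Finset.mul_sum,
    ← Finset.sum_sub_distrib]
  refine Finset.sum_congr rfl fun j _ => ?_
  set o := S.optInput ystar i
  have e1 : ystar - (S.A j).toEuclideanLin (x + h) - S.b j =
      (ystar - (S.A j).toEuclideanLin o - S.b j - (S.A j).toEuclideanLin (x - o)) -
        (S.A j).toEuclideanLin h := by
    simp only [map_add, map_sub]; abel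
  have e2 : ystar - (S.A j).toEuclideanLin (x - h) - S.b j =
      (ystar - (S.A j).toEuclideanLin o - S.b j - (S.A j).toEuclideanLin (x - o)) +
        (S.A j).toEuclideanLin h := by
    simp only [map_sub]; abel
  rw [e1, e2, norm_sub_sq_real, norm_add_sq_real, inner_sub_left,
    real_inner_comm ((S.A j).toEuclideanLin (x - o))]
  ring

/-- A row of a stochastic matrix has a positive entry `p_{ij₀}`. The matrix `A_{j₀}` is injective on
a finite-dimensional space, hence bounded below, and the other terms are nonnegative. -/
lemma IsAdmissible.exists_pos_mul_sq_le_inner_curvature (hS : S.IsAdmissible) (i : Fin K) :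
    ∃ c > 0, ∀ z, c * ‖z‖ ^ 2 ≤ inner ℝ z (S.curvature i z) := by
  have hp := Matrix.mem_rowStochastic_iff_sum.mp hS.stochastic
  obtain ⟨j₀, hj₀⟩ : ∃ j, S.P i j ≠ 0 := by
    by_contra! hall
    have := hp.2 i
    simp [hall] at this
  have hker : LinearMap.ker (S.A j₀).toEuclideanLin = ⊥ := by
    refine LinearMap.ker_eq_bot'.mpr fun v hv => ?_
    have h1 : (S.A j₀).mulVec v.ofLp = 0 := by
      simpa [Matrix.ofLp_toLpLin, Matrix.toLin'_apply] using congrArg WithLp.ofLp hv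
    ext l
    simp [hS.mulVec_eq_zero j₀ h1]
  obtain ⟨c, hc, hanti⟩ := LinearMap.exists_antilipschitzWith _ hker
  have hc' : (0 : ℝ) < c := hc
  refine ⟨S.P i j₀ * ((c : ℝ)⁻¹) ^ 2,
    mul_pos (lt_of_le_of_ne (hp.1 i j₀) hj₀.symm) (by positivity), fun z => ?_⟩
  rw [inner_curvature]
  have h1 : ‖z‖ ≤ c * ‖(S.A j₀).toEuclideanLin z‖ := by
    simpa [dist_eq_norm] using hanti.le_mul_dist z 0
  have h2 : (c : ℝ)⁻¹ * ‖z‖ ≤ ‖(S.A j₀).toEuclideanLin z‖ := by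
    rwa [inv_mul_le_iff₀ hc']
  calc S.P i j₀ * ((c : ℝ)⁻¹) ^ 2 * ‖z‖ ^ 2 = S.P i j₀ * ((c : ℝ)⁻¹ * ‖z‖) ^ 2 := by ring
    _ ≤ S.P i j₀ * ‖(S.A j₀).toEuclideanLin z‖ ^ 2 := by
        have := hp.1 i j₀
        gcongr
    _ = S.P i j₀ * inner ℝ ((S.A j₀).toEuclideanLin z) ((S.A j₀).toEuclideanLin z) := by
        rw [real_inner_self_eq_norm_sq]
    _ ≤ _ := Finset.single_le_sum (f := fun j => S.P i j *
          inner ℝ ((S.A j).toEuclideanLin z) ((S.A j).toEuclideanLin z))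
          (fun j _ => mul_nonneg (hp.1 i j) real_inner_self_nonneg) (Finset.mem_univ j₀)

end JumpAffineSystem

/-- The coordinatewise inverse `(1/v_1, …, 1/v_n)`. -/
def coordInv {n : ℕ} (v : EuclideanSpace ℝ (Fin n)) : EuclideanSpace ℝ (Fin n) :=
  WithLp.toLp 2 (fun l => 1 / v l)

namespace MSPSAParams

variable {K m n : ℕ}

/-! ### Evolution of the memory of one state -/

/-- The index of the perturbation that the policy uses at its next observation of state `i`. -/
def pairIndex (M : MSPSAMemory K n) (i : Fin K) : ℕ :=
  if M.flag i then M.cnt i else M.cnt i + 1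

/-- The number of completed updates of the estimate for state `i`. -/
def updates (M : MSPSAMemory K n) (i : Fin K) : ℕ :=
  if M.flag i then M.cnt i - 1 else M.cnt i

section Path

variable (par : MSPSAParams K n) (S : JumpAffineSystem K m n) (C : Set (EuclideanSpace ℝ (Fin n)))
  (ystar : EuclideanSpace ℝ (Fin m)) (s : ℕ → Fin K) (w : ℕ → EuclideanSpace ℝ (Fin m))
  (δ : Fin K → ℕ → EuclideanSpace ℝ (Fin n)) (i : Fin K) (t : ℕ)

/-- The loss `‖y_{t+1} - y*‖²` when the policy applies its input for state `i` at stage `t + 1`. -/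
def obsLoss : ℝ :=
  ‖S.output (s (t + 1)) (par.inputOf δ (par.memory S C ystar s w δ t) i) (w (t + 1)) - ystar‖ ^ 2

variable {s i t}

lemma memory_succ_of_ne (h : s t ≠ i) :
    (par.memory S C ystar s w δ (t + 1)).est i = (par.memory S C ystar s w δ t).est i ∧
    (par.memory S C ystar s w δ (t + 1)).cnt i = (par.memory S C ystar s w δ t).cnt i ∧
    (par.memory S C ystar s w δ (t + 1)).flag i = (par.memory S C ystar s w δ t).flag i ∧
    (par.memory S C ystar s w δ (t + 1)).dplus i = (par.memory S C ystar s w δ t).dplus i := by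
  rw [memory, step]
  split_ifs <;> simp [Function.update_of_ne h.symm]

lemma memory_succ_of_flag_false (h : s t = i)
    (hf : (par.memory S C ystar s w δ t).flag i = false) :
    (par.memory S C ystar s w δ (t + 1)).est i = (par.memory S C ystar s w δ t).est i ∧
    (par.memory S C ystar s w δ (t + 1)).cnt i = (par.memory S C ystar s w δ t).cnt i + 1 ∧
    (par.memory S C ystar s w δ (t + 1)).flag i = true ∧
    (par.memory S C ystar s w δ (t + 1)).dplus i = par.obsLoss S C ystar s w δ i t := by
  subst h
  rw [memory, step]
  simp [hf, obsLoss]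

lemma memory_succ_of_flag_true (h : s t = i)
    (hf : (par.memory S C ystar s w δ t).flag i = true) :
    (par.memory S C ystar s w δ (t + 1)).est i =
      euclideanProj C ((par.memory S C ystar s w δ t).est i -
        (par.stepSize i ((par.memory S C ystar s w δ t).cnt i) *
          (((par.memory S C ystar s w δ t).dplus i - par.obsLoss S C ystar s w δ i t) /
            par.pertGain i ((par.memory S C ystar s w δ t).cnt i))) •
            coordInv (δ i ((par.memory S C ystar s w δ t).cnt i))) ∧
    (par.memory S C ystar s w δ (t + 1)).cnt i = (par.memory S C ystar s w δ t).cnt i ∧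
    (par.memory S C ystar s w δ (t + 1)).flag i = false ∧
    (par.memory S C ystar s w δ (t + 1)).dplus i = (par.memory S C ystar s w δ t).dplus i := by
  subst h
  rw [memory, step]
  simp [hf, obsLoss, coordInv]

variable (s i t)

/-- With zero offset the gains at index `0` take the value `0` of a division by zero. This excludes
that index from every update. -/
lemma one_le_cnt_of_flag (hf : (par.memory S C ystar s w δ t).flag i = true) :
    1 ≤ (par.memory S C ystar s w δ t).cnt i := by
  induction t with
  | zero => simp [memory, initMemory] at hf
  | succ t ih =>
    by_cases h : s t = i
    · cases hft : (par.memory S C ystar s w δ t).flag i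
      · rw [(par.memory_succ_of_flag_false S C ystar w δ h hft).2.1]
        omega
      · rw [(par.memory_succ_of_flag_true S C ystar w δ h hft).2.1]
        exact ih hft
    · obtain ⟨-, h1, h2, -⟩ := par.memory_succ_of_ne S C ystar w δ h
      rw [h1]
      exact ih (h2 ▸ hf)

lemma est_mem (hC : IsCompact C) (hinit : ∀ i, par.xinit i ∈ C) :
    (par.memory S C ystar s w δ t).est i ∈ C := by
  induction t with
  | zero => exact hinit i
  | succ t ih =>
    by_cases h : s t = i
    · cases hft : (par.memory S C ystar s w δ t).flag i
      · rwa [(par.memory_succ_of_flag_false S C ystar w δ h hft).1]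
      · rw [(par.memory_succ_of_flag_true S C ystar w δ h hft).1]
        exact (euclideanProj_spec hC ⟨_, ih⟩ _).1
    · rwa [(par.memory_succ_of_ne S C ystar w δ h).1]

/-- Sums over the updates of state `i`. -/
lemma sum_updates (f : ℕ → ℝ) (T : ℕ) :
    ∑ t ∈ Finset.range T, (if s t = i ∧ (par.memory S C ystar s w δ t).flag i = true then
      f ((par.memory S C ystar s w δ t).cnt i) else 0) =
    ∑ k ∈ Finset.range (updates (par.memory S C ystar s w δ T) i), f (k + 1) := by
  induction T with
  | zero => simp [updates, memory, initMemory]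
  | succ t ih =>
    rw [Finset.sum_range_succ, ih]
    by_cases h : s t = i
    · cases hft : (par.memory S C ystar s w δ t).flag i
      · obtain ⟨-, h1, h2, -⟩ := par.memory_succ_of_flag_false S C ystar w δ h hft
        simp [updates, h1, h2, hft]
      · obtain ⟨-, h1, h2, -⟩ := par.memory_succ_of_flag_true S C ystar w δ h hft
        have := par.one_le_cnt_of_flag S C ystar s w δ i t hft
        obtain ⟨k, hk⟩ := Nat.exists_eq_add_of_le' this
        simp [updates, h1, h2, hft, h, hk, Finset.sum_range_succ]
    · obtain ⟨-, h1, h2, -⟩ := par.memory_succ_of_ne S C ystar w δ h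
      simp [updates, h1, h2, h]

/-- Sums over the observations of state `i`: each perturbation is used at most twice. -/
lemma sum_observations_le (f : ℕ → ENNReal) (T : ℕ) :
    ∑ t ∈ Finset.range T, (if s t = i then f (pairIndex (par.memory S C ystar s w δ t) i) else 0) ≤
    2 * ∑' k, f (k + 1) := by
  -- An exact count: the second observations of pairs are numbered by `updates`, the first ones by
  -- `cnt`.
  have key : ∑ t ∈ Finset.range T,
        (if s t = i then f (pairIndex (par.memory S C ystar s w δ t) i) else 0) =
      ∑ k ∈ Finset.range (updates (par.memory S C ystar s w δ T) i), f (k + 1) +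
      ∑ k ∈ Finset.range ((par.memory S C ystar s w δ T).cnt i), f (k + 1) := by
    induction T with
    | zero => simp [updates, memory, initMemory]
    | succ t ih =>
      rw [Finset.sum_range_succ, ih]
      by_cases h : s t = i
      · cases hft : (par.memory S C ystar s w δ t).flag i
        · obtain ⟨-, h1, h2, -⟩ := par.memory_succ_of_flag_false S C ystar w δ h hft
          simp [updates, pairIndex, h1, h2, hft, h, Finset.sum_range_succ, add_assoc]
        · obtain ⟨-, h1, h2, -⟩ := par.memory_succ_of_flag_true S C ystar w δ h hft
          have := par.one_le_cnt_of_flag S C ystar s w δ i t hft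
          obtain ⟨k, hk⟩ := Nat.exists_eq_add_of_le' this
          simp only [updates, pairIndex, h1, h2, hft, h, hk, Finset.sum_range_succ, if_true,
            Nat.add_sub_cancel, Bool.false_eq_true, if_false]
          ring
      · obtain ⟨-, h1, h2, -⟩ := par.memory_succ_of_ne S C ystar w δ h
        simp [updates, h1, h2, h]
  rw [key, two_mul]
  exact add_le_add (ENNReal.sum_le_tsum _) (ENNReal.sum_le_tsum _)

/-- A visit need not complete an update, but `cnt + updates` grows by exactly one at each visit, and
`cnt ≤ updates + 1`. -/
lemma tendsto_updates (hinf : ∃ᶠ t in atTop, s t = i) :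
    Tendsto (fun T => updates (par.memory S C ystar s w δ T) i) atTop atTop := by
  have hmono : Monotone (fun T => (par.memory S C ystar s w δ T).cnt i +
      updates (par.memory S C ystar s w δ T) i) := by
    refine monotone_nat_of_le_succ fun t => ?_
    by_cases h : s t = i
    · cases hft : (par.memory S C ystar s w δ t).flag i
      · obtain ⟨-, h1, h2, -⟩ := par.memory_succ_of_flag_false S C ystar w δ h hft
        simp [updates, h1, h2, hft]
      · obtain ⟨-, h1, h2, -⟩ := par.memory_succ_of_flag_true S C ystar w δ h hft
        simp [updates, h1, h2, hft]
    · obtain ⟨-, h1, h2, -⟩ := par.memory_succ_of_ne S C ystar w δ h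
      simp [updates, h1, h2]
  have hcu : ∀ T, (par.memory S C ystar s w δ T).cnt i ≤
      updates (par.memory S C ystar s w δ T) i + 1 := by
    intro T
    unfold updates
    split_ifs <;> omega
  have hstep : ∀ t, s t = i → (par.memory S C ystar s w δ t).cnt i +
      updates (par.memory S C ystar s w δ t) i + 1 ≤ (par.memory S C ystar s w δ (t + 1)).cnt i +
      updates (par.memory S C ystar s w δ (t + 1)) i := by
    intro t h
    cases hft : (par.memory S C ystar s w δ t).flag i
    · obtain ⟨-, h1, h2, -⟩ := par.memory_succ_of_flag_false S C ystar w δ h hft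
      simp only [updates, h1, h2, hft, Bool.false_eq_true, if_true, if_false]
      omega
    · obtain ⟨-, h1, h2, -⟩ := par.memory_succ_of_flag_true S C ystar w δ h hft
      have := par.one_le_cnt_of_flag S C ystar s w δ i t hft
      simp only [updates, h1, h2, hft, Bool.false_eq_true, if_true, if_false]
      omega
  have hunb : ∀ b, ∃ T, b ≤ (par.memory S C ystar s w δ T).cnt i +
      updates (par.memory S C ystar s w δ T) i := by
    intro b
    induction b with
    | zero => exact ⟨0, Nat.zero_le _⟩
    | succ b ih =>
      obtain ⟨T, hT⟩ := ih
      obtain ⟨t, ht, hst⟩ := frequently_atTop.mp hinf T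
      exact ⟨t + 1, by have := hmono ht; have := hstep t hst; simp only at *; omega⟩
  have hlim := tendsto_atTop_atTop_of_monotone hmono hunb
  refine tendsto_atTop.mpr fun b => ?_
  filter_upwards [hlim.eventually_ge_atTop (2 * b + 1)] with T hT
  have := hcu T
  omega

end Path

end MSPSAParams

namespace MSPSAParams

variable {K m n : ℕ}

/-! ### Pathwise convergence of the estimates -/

section Path

variable (par : MSPSAParams K n) (S : JumpAffineSystem K m n) (C : Set (EuclideanSpace ℝ (Fin n)))
  (ystar : EuclideanSpace ℝ (Fin m)) (s : ℕ → Fin K) (w : ℕ → EuclideanSpace ℝ (Fin m))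
  (δ : Fin K → ℕ → EuclideanSpace ℝ (Fin n)) (i : Fin K) (t : ℕ)

/-- The ratio `a_k / c_k` of step size and perturbation gain. -/
def gainRatio (k : ℕ) : ℝ := par.stepSize i k / par.pertGain i k

/-- The coefficient of the observation error at stage `t + 1` in the recursion of the squared
distance to the optimal input. -/
def noiseCoeff : ℝ :=
  (if (par.memory S C ystar s w δ t).flag i then -1 else 1) *
    par.gainRatio i (pairIndex (par.memory S C ystar s w δ t) i) *
    inner ℝ ((par.memory S C ystar s w δ t).est i - S.optInput ystar i)
      (coordInv (δ i (pairIndex (par.memory S C ystar s w δ t) i)))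

/-- The contribution of the observation error at stage `t + 1`. -/
def noiseIncr : ℝ :=
  if s t = i then par.noiseCoeff S C ystar s w δ i t * (par.obsLoss S C ystar s w δ i t -
    S.stageCost ystar i (par.inputOf δ (par.memory S C ystar s w δ t) i)) else 0

/-- The contribution of the randomness of the perturbation direction at stage `t + 1`. -/
def directionIncr : ℝ :=
  if s t = i ∧ (par.memory S C ystar s w δ t).flag i = true then
    par.stepSize i ((par.memory S C ystar s w δ t).cnt i) *
      (inner ℝ ((par.memory S C ystar s w δ t).est i - S.optInput ystar i)
          (coordInv (δ i ((par.memory S C ystar s w δ t).cnt i))) *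
        inner ℝ (δ i ((par.memory S C ystar s w δ t).cnt i))
          (S.curvature i ((par.memory S C ystar s w δ t).est i - S.optInput ystar i)) -
        inner ℝ ((par.memory S C ystar s w δ t).est i - S.optInput ystar i)
          (S.curvature i ((par.memory S C ystar s w δ t).est i - S.optInput ystar i))) else 0

/-- The contribution of the observation at stage `t + 1` to the squared step length. -/
def squareIncr : ℝ :=
  if s t = i then par.gainRatio i (pairIndex (par.memory S C ystar s w δ t) i) ^ 2 *
    ‖coordInv (δ i (pairIndex (par.memory S C ystar s w δ t) i))‖ ^ 2 *
    par.obsLoss S C ystar s w δ i t ^ 2 else 0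

/-- The observation error of the first half of an incomplete pair of observations. -/
def pendingNoise : ℝ :=
  if (par.memory S C ystar s w δ t).flag i then
    par.gainRatio i ((par.memory S C ystar s w δ t).cnt i) *
    inner ℝ ((par.memory S C ystar s w δ t).est i - S.optInput ystar i)
      (coordInv (δ i ((par.memory S C ystar s w δ t).cnt i))) *
    ((par.memory S C ystar s w δ t).dplus i -
      S.stageCost ystar i ((par.memory S C ystar s w δ t).est i +
        par.pertGain i ((par.memory S C ystar s w δ t).cnt i) •
          δ i ((par.memory S C ystar s w δ t).cnt i))) else 0

/-- The squared length of the update at stage `t + 1`. -/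
def stepSq : ℝ :=
  if s t = i ∧ (par.memory S C ystar s w δ t).flag i = true then
    par.gainRatio i ((par.memory S C ystar s w δ t).cnt i) ^ 2 *
    ‖coordInv (δ i ((par.memory S C ystar s w δ t).cnt i))‖ ^ 2 *
    ((par.memory S C ystar s w δ t).dplus i - par.obsLoss S C ystar s w δ i t) ^ 2 else 0

/-- Rests on `(d⁺ - d⁻)² ≤ 2 (d⁺)² + 2 (d⁻)²`. The `d⁺` part is paid at the first visit of a pair
but needed only at the second; the extra term on the left holds this credit while a pair is open and
lets the induction run. -/
lemma sum_stepSq_le (T : ℕ) :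
    ∑ t ∈ Finset.range T, par.stepSq S C ystar s w δ i t +
      (if (par.memory S C ystar s w δ T).flag i = true then
        2 * (par.gainRatio i ((par.memory S C ystar s w δ T).cnt i) ^ 2 *
        ‖coordInv (δ i ((par.memory S C ystar s w δ T).cnt i))‖ ^ 2 *
        (par.memory S C ystar s w δ T).dplus i ^ 2) else 0) ≤
    2 * ∑ t ∈ Finset.range T, par.squareIncr S C ystar s w δ i t := by
  induction T with
  | zero => simp [memory, initMemory]
  | succ t ih =>
    rw [Finset.sum_range_succ, Finset.sum_range_succ]
    by_cases h : s t = i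
    · cases hft : (par.memory S C ystar s w δ t).flag i
      · obtain ⟨-, h1, h2, h3⟩ := par.memory_succ_of_flag_false S C ystar w δ h hft
        simp only [stepSq, squareIncr, pairIndex, h, h1, h2, h3, hft, Bool.false_eq_true, if_true,
          if_false, and_false, add_zero] at ih ⊢
        linarith
      · obtain ⟨-, h1, h2, h3⟩ := par.memory_succ_of_flag_true S C ystar w δ h hft
        simp only [stepSq, squareIncr, pairIndex, h, h2, hft, Bool.false_eq_true, if_true,
          if_false, and_true, add_zero] at ih ⊢
        have h4 : ((par.memory S C ystar s w δ t).dplus i - par.obsLoss S C ystar s w δ i t) ^ 2 ≤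
            2 * (par.memory S C ystar s w δ t).dplus i ^ 2 +
              2 * par.obsLoss S C ystar s w δ i t ^ 2 := by
          nlinarith [sq_nonneg ((par.memory S C ystar s w δ t).dplus i +
            par.obsLoss S C ystar s w δ i t)]
        have h5 := mul_le_mul_of_nonneg_left h4 (by positivity :
          0 ≤ par.gainRatio i ((par.memory S C ystar s w δ t).cnt i) ^ 2 *
            ‖coordInv (δ i ((par.memory S C ystar s w δ t).cnt i))‖ ^ 2)
        linarith
    · obtain ⟨-, h1, h2, h3⟩ := par.memory_succ_of_ne S C ystar w δ h
      simpa [stepSq, squareIncr, h, h1, h2, h3] using ih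

lemma stepSq_nonneg : 0 ≤ par.stepSq S C ystar s w δ i t := by
  unfold stepSq
  split_ifs <;> positivity

lemma pertGain_pos (hγ' : 0 < par.γ' i) {k : ℕ} (hk : 1 ≤ k) : 0 < par.pertGain i k := by
  have : (1 : ℝ) ≤ k := by exact_mod_cast hk
  unfold pertGain
  positivity

lemma stepSize_pos (hγ : 0 < par.γ i) {k : ℕ} (hk : 1 ≤ k) : 0 < par.stepSize i k := by
  have : (1 : ℝ) ≤ k := by exact_mod_cast hk
  unfold stepSize
  positivity

variable {S C ystar}

/-- The squared distance to the optimal input satisfies a perturbed descent inequality. -/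
lemma sq_dist_succ_le (hS : S.IsAdmissible) (hC : IsCompact C) (hconv : Convex ℝ C)
    (hopt : S.optInput ystar i ∈ C) (hγ : 0 < par.γ i) (hγ' : 0 < par.γ' i)
    {c : ℝ} (hc : ∀ z, c * ‖z‖ ^ 2 ≤ inner ℝ z (S.curvature i z)) :
    ‖(par.memory S C ystar s w δ (t + 1)).est i - S.optInput ystar i‖ ^ 2 -
      2 * par.pendingNoise S C ystar s w δ i (t + 1) ≤
    ‖(par.memory S C ystar s w δ t).est i - S.optInput ystar i‖ ^ 2 -
      2 * par.pendingNoise S C ystar s w δ i t -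
      (if s t = i ∧ (par.memory S C ystar s w δ t).flag i = true then
        8 * c * par.stepSize i ((par.memory S C ystar s w δ t).cnt i) else 0) *
        ‖(par.memory S C ystar s w δ t).est i - S.optInput ystar i‖ ^ 2 +
      (-2 * par.noiseIncr S C ystar s w δ i t - 8 * par.directionIncr S C ystar s w δ i t +
        par.stepSq S C ystar s w δ i t) := by
  by_cases h : s t = i
  · cases hft : (par.memory S C ystar s w δ t).flag i
    · obtain ⟨h0, h1, h2, h3⟩ := par.memory_succ_of_flag_false S C ystar w δ h hft
      -- First half of a pair: the estimate stays and the observation error moves into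
      -- `pendingNoise`, so both sides are equal.
      simp [stepSq, noiseIncr, directionIncr, pendingNoise, noiseCoeff, pairIndex, inputOf, h, h0,
        h1, h2, h3, hft]
    · obtain ⟨h0, h1, h2, h3⟩ := par.memory_succ_of_flag_true S C ystar w δ h hft
      have hk := par.one_le_cnt_of_flag S C ystar s w δ i t hft
      simp only [stepSq, noiseIncr, directionIncr, pendingNoise, noiseCoeff, pairIndex, inputOf, h,
        h2, hft, Bool.false_eq_true, if_true, if_false, and_true]
      set k := (par.memory S C ystar s w δ t).cnt i
      set v := (par.memory S C ystar s w δ t).est i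
      set d := (par.memory S C ystar s w δ t).dplus i
      set y := par.obsLoss S C ystar s w δ i t
      have hck := par.pertGain_pos i hγ' hk
      have hak := par.stepSize_pos i hγ hk
      -- The exact central difference contributes a factor `4`, the expanded square a factor `2`;
      -- together they give the `8` of the drift and of the direction term.
      have hL := hS.stageCost_add_sub_stageCost_sub ystar i v (par.pertGain i k • δ i k)
      rw [real_inner_smul_left] at hL
      have hproj := norm_euclideanProj_sub_le_of_mem hC hconv
        (v - (par.stepSize i k * ((d - y) / par.pertGain i k)) • coordInv (δ i k)) hopt
      rw [← h0] at hproj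
      have hsq := pow_le_pow_left₀ (norm_nonneg _) hproj 2
      have e : v - (par.stepSize i k * ((d - y) / par.pertGain i k)) • coordInv (δ i k) -
          S.optInput ystar i = (v - S.optInput ystar i) -
          (par.stepSize i k * ((d - y) / par.pertGain i k)) • coordInv (δ i k) := by abel
      rw [e, norm_sub_sq_real (v - S.optInput ystar i), real_inner_smul_right, norm_smul, mul_pow, Real.norm_eq_abs,
        sq_abs] at hsq
      have hratio : par.stepSize i k = par.gainRatio i k * par.pertGain i k := by
        rw [gainRatio, div_mul_cancel₀ _ hck.ne']
      have e2 : par.stepSize i k * ((d - y) / par.pertGain i k) =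
          par.gainRatio i k * (d - y) := by
        rw [gainRatio]; ring
      rw [e2] at hsq
      have hcv := mul_le_mul_of_nonneg_left (hc (v - S.optInput ystar i)) hak.le
      have e3 : S.stageCost ystar i (v + par.pertGain i k • δ i k) =
        S.stageCost ystar i (v - par.pertGain i k • δ i k) + 4 * (par.pertGain i k *
          inner ℝ (δ i k) (S.curvature i (v - S.optInput ystar i))) := by linarith
      rw [e3]
      set ip := inner ℝ (v - S.optInput ystar i) (coordInv (δ i k))
      set dc := inner ℝ (δ i k) (S.curvature i (v - S.optInput ystar i))
      -- The identity `a_k = (a_k / c_k) c_k`, stated on the product in which it occurs, makes what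
      -- remains linear.
      have e4 : par.stepSize i k * (ip * dc) = par.gainRatio i k * par.pertGain i k * (ip * dc) := by
        rw [hratio]
      linarith
  · obtain ⟨h0, h1, h2, h3⟩ := par.memory_succ_of_ne S C ystar w δ h
    simp [stepSq, noiseIncr, directionIncr, pendingNoise, h, h0, h1, h2, h3]

/-- The pending error changes only at visits to `i`, where it becomes zero or the noise increment of
that visit, and these increments tend to zero. -/
lemma tendsto_pendingNoise (hinf : ∃ᶠ t in atTop, s t = i)
    (hnoise : Tendsto (fun t => par.noiseIncr S C ystar s w δ i t) atTop (𝓝 0)) :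
    Tendsto (fun t => par.pendingNoise S C ystar s w δ i t) atTop (𝓝 0) := by
  have hvisit : ∀ t, s t = i → par.pendingNoise S C ystar s w δ i (t + 1) = 0 ∨
      par.pendingNoise S C ystar s w δ i (t + 1) = par.noiseIncr S C ystar s w δ i t := by
    intro t h
    cases hft : (par.memory S C ystar s w δ t).flag i
    · right
      obtain ⟨h0, h1, h2, h3⟩ := par.memory_succ_of_flag_false S C ystar w δ h hft
      simp [noiseIncr, pendingNoise, noiseCoeff, pairIndex, inputOf, h, h0, h1, h2, h3, hft]
    · left
      obtain ⟨h0, h1, h2, h3⟩ := par.memory_succ_of_flag_true S C ystar w δ h hft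
      simp [pendingNoise, h2]
  rw [Metric.tendsto_atTop] at hnoise ⊢
  intro ε hε
  obtain ⟨T₀, hT₀⟩ := hnoise ε hε
  -- Up to the first visit at or after `T₀` the pending error may still be an old, large one; the
  -- bound starts right after the visit `T₁`.
  obtain ⟨T₁, hT₁, hs⟩ := frequently_atTop.mp hinf T₀
  have hv : ∀ t ≥ T₀, s t = i → dist (par.pendingNoise S C ystar s w δ i (t + 1)) 0 < ε := by
    intro t ht h
    rcases hvisit t h with h' | h' <;> rw [h']
    · simpa using hε
    · exact hT₀ t ht
  refine ⟨T₁ + 1, fun t ht => ?_⟩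
  induction t, ht using Nat.le_induction with
  | base => exact hv T₁ hT₁ hs
  | succ t ht ih =>
    by_cases h : s t = i
    · exact hv t (by omega) h
    · obtain ⟨h0, h1, h2, h3⟩ := par.memory_succ_of_ne S C ystar w δ h
      simpa [pendingNoise, h0, h1, h2, h3] using ih

lemma tendsto_sum_stepSize (hγ : 0 < par.γ i) :
    Tendsto (fun T => ∑ k ∈ Finset.range T, par.stepSize i (k + 1)) atTop atTop := by
  have h1 : Tendsto (fun T => ∑ k ∈ Finset.range T, (1 : ℝ) / (k + 1 : ℝ)) atTop atTop :=
    Real.tendsto_sum_range_one_div_nat_succ_atTop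
  -- Comparison with the harmonic series, from `N + (k + 1) ≤ (N + 1)(k + 1)`.
  have h2 : 0 < par.γ i / (par.N i + 1 : ℝ) := by positivity
  refine tendsto_atTop_mono (fun T => ?_) (h1.const_mul_atTop h2)
  rw [Finset.mul_sum]
  refine Finset.sum_le_sum fun k _ => ?_
  rw [stepSize, div_mul_div_comm, mul_one]
  refine div_le_div_of_nonneg_left hγ.le (by positivity) ?_
  push_cast
  nlinarith [(by positivity : (0 : ℝ) ≤ par.N i * k)]

/-- On a path that visits `i` infinitely often and along which the noise series converge, the
estimates for `i` converge to the optimal input. -/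
theorem tendsto_sq_dist_est (hS : S.IsAdmissible) (hC : IsCompact C) (hconv : Convex ℝ C)
    (hopt : S.optInput ystar i ∈ C) (hγ : 0 < par.γ i) (hγ' : 0 < par.γ' i)
    (hinf : ∃ᶠ t in atTop, s t = i)
    (hnoise : ∃ l, Tendsto (fun T => ∑ t ∈ Finset.range T, par.noiseIncr S C ystar s w δ i t)
      atTop (𝓝 l))
    (hdir : ∃ l, Tendsto (fun T => ∑ t ∈ Finset.range T, par.directionIncr S C ystar s w δ i t)
      atTop (𝓝 l))
    (hsq : ∃ B, ∀ T, ∑ t ∈ Finset.range T, par.squareIncr S C ystar s w δ i t ≤ B) :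
    Tendsto (fun t => ‖(par.memory S C ystar s w δ t).est i - S.optInput ystar i‖ ^ 2)
      atTop (𝓝 0) := by
  obtain ⟨c, hc, hcurv⟩ := hS.exists_pos_mul_sq_le_inner_curvature i
  obtain ⟨l₁, hl₁⟩ := hnoise
  obtain ⟨l₂, hl₂⟩ := hdir
  obtain ⟨B, hB⟩ := hsq
  have hsum : Summable (par.stepSq S C ystar s w δ i) := by
    refine summable_of_sum_range_le (c := 2 * B)
      (fun t => par.stepSq_nonneg S C ystar s w δ i t) fun T => ?_
    have h1 := par.sum_stepSq_le S C ystar s w δ i T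
    have h2 := hB T
    have h3 : 0 ≤ (if (par.memory S C ystar s w δ T).flag i = true then
        2 * (par.gainRatio i ((par.memory S C ystar s w δ T).cnt i) ^ 2 *
        ‖coordInv (δ i ((par.memory S C ystar s w δ T).cnt i))‖ ^ 2 *
        (par.memory S C ystar s w δ T).dplus i ^ 2) else 0) := by
      split_ifs <;> positivity
    linarith
  have hn0 : Tendsto (fun t => par.noiseIncr S C ystar s w δ i t) atTop (𝓝 0) := by
    have := (hl₁.comp (tendsto_add_atTop_nat 1)).sub hl₁
    rw [sub_self] at this
    exact this.congr fun t => by simp [Finset.sum_range_succ]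
  refine tendsto_zero_of_perturbed_descent
    (p := fun t => 2 * par.pendingNoise S C ystar s w δ i t)
    (u := fun t => -2 * par.noiseIncr S C ystar s w δ i t -
      8 * par.directionIncr S C ystar s w δ i t + par.stepSq S C ystar s w δ i t)
    (l := -2 * l₁ - 8 * l₂ + ∑' t, par.stepSq S C ystar s w δ i t)
    (fun t => sq_nonneg _) (fun t => ?_) ?_
    (fun t => par.sq_dist_succ_le s w δ i t hS hC hconv hopt hγ hγ' hcurv) ?_ ?_
  · split_ifs with h
    · have := par.stepSize_pos i hγ (par.one_le_cnt_of_flag S C ystar s w δ i t h.2)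
      positivity
    · exact le_rfl
  · simpa using (par.tendsto_pendingNoise s w δ i hinf hn0).const_mul 2
  · refine (((hl₁.const_mul (-2)).sub (hl₂.const_mul 8)).add
      hsum.hasSum.tendsto_sum_nat).congr fun T => ?_
    rw [Finset.sum_add_distrib, Finset.sum_sub_distrib, Finset.mul_sum, Finset.mul_sum]
  -- In real time the gain is `8 c a_k` at updates and zero otherwise; its partial sums are those of
  -- `8 c a_k` over completed updates.
  · have h1 := ((par.tendsto_sum_stepSize i hγ).comp
      (par.tendsto_updates S C ystar s w δ i hinf)).const_mul_atTop (by positivity : 0 < 8 * c)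
    refine h1.congr fun T => ?_
    rw [par.sum_updates S C ystar s w δ i (fun k => 8 * c * par.stepSize i k) T, Function.comp,
      Finset.mul_sum]

end Path

end MSPSAParams

/-! ### The conditional law of the next state and noise -/

lemma measure_eq_sum_inter_preimage_singleton {Ω ι : Type*} [MeasurableSpace Ω] [Fintype ι]
    [MeasurableSpace ι] [MeasurableSingletonClass ι] (μ : Measure Ω) {f : Ω → ι}
    (hf : Measurable f) (E : Set Ω) : μ E = ∑ a, μ (E ∩ f ⁻¹' {a}) := by
  have h := sum_measure_preimage_singleton (μ := μ.restrict E) Finset.univ (f := f)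
    fun y _ => hf (measurableSet_singleton y)
  simp only [Finset.coe_univ, Set.preimage_univ, Measure.restrict_apply_univ] at h
  rw [← h]
  refine Finset.sum_congr rfl fun a _ => ?_
  rw [Measure.restrict_apply (hf (measurableSet_singleton a)), Set.inter_comm]

namespace JumpAffineSystem

variable {K m n : ℕ}

/-- The conditional law of `(s_{t+1}, w_{t+1})` given the past when `s_t = i`. -/
def stepLaw (S : JumpAffineSystem K m n) (i : Fin K) :
    Measure (Fin K × EuclideanSpace ℝ (Fin m)) :=
  ∑ j, ENNReal.ofReal (S.P i j) • (S.f j).map (Prod.mk j)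

lemma stepLaw_apply (S : JumpAffineSystem K m n) (i : Fin K)
    {B : Set (Fin K × EuclideanSpace ℝ (Fin m))} (hB : MeasurableSet B) :
    S.stepLaw i B = ∑ j, ENNReal.ofReal (S.P i j) * S.f j (Prod.mk j ⁻¹' B) := by
  simp only [stepLaw, Measure.coe_finsetSum, Finset.sum_apply, Measure.smul_apply, smul_eq_mul]
  refine Finset.sum_congr rfl fun j _ => ?_
  rw [Measure.map_apply measurable_prodMk_left hB]

lemma lintegral_stepLaw (S : JumpAffineSystem K m n) (i : Fin K)
    {g : Fin K × EuclideanSpace ℝ (Fin m) → ENNReal} (hg : Measurable g) :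
    ∫⁻ y, g y ∂(S.stepLaw i) = ∑ j, ENNReal.ofReal (S.P i j) * ∫⁻ v, g (j, v) ∂(S.f j) := by
  rw [stepLaw, lintegral_finsetSum_measure]
  refine Finset.sum_congr rfl fun j _ => ?_
  rw [lintegral_smul_measure, lintegral_map hg measurable_prodMk_left, smul_eq_mul]

lemma IsAdmissible.isProbabilityMeasure_stepLaw {S : JumpAffineSystem K m n}
    (hS : S.IsAdmissible) (i : Fin K) : IsProbabilityMeasure (S.stepLaw i) := by
  have hp := Matrix.mem_rowStochastic_iff_sum.mp hS.stochastic
  have := hS.isProb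
  constructor
  rw [stepLaw_apply S i MeasurableSet.univ]
  simp only [Set.preimage_univ, measure_univ, mul_one]
  rw [← ENNReal.ofReal_sum_of_nonneg fun j _ => hp.1 i j, hp.2 i, ENNReal.ofReal_one]

lemma IsAdmissible.integral_stepLaw {S : JumpAffineSystem K m n} (hS : S.IsAdmissible) (i : Fin K)
    {g : Fin K × EuclideanSpace ℝ (Fin m) → ℝ} (hg : Measurable g)
    (hint : ∀ j, Integrable (fun v => g (j, v)) (S.f j)) :
    ∫ y, g y ∂(S.stepLaw i) = ∑ j, S.P i j * ∫ v, g (j, v) ∂(S.f j) := by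
  have hp := Matrix.mem_rowStochastic_iff_sum.mp hS.stochastic
  have hi : ∀ j, Integrable g ((S.f j).map (Prod.mk j)) := fun j =>
    (integrable_map_measure hg.aestronglyMeasurable measurable_prodMk_left.aemeasurable).mpr
      (hint j)
  rw [stepLaw, integral_finsetSum_measure fun j _ => (hi j).smul_measure ENNReal.ofReal_ne_top]
  refine Finset.sum_congr rfl fun j _ => ?_
  rw [integral_smul_measure, ENNReal.toReal_ofReal (hp.1 i j),
    integral_map measurable_prodMk_left.aemeasurable hg.aestronglyMeasurable, smul_eq_mul]

variable {S : JumpAffineSystem K m n} {Ω : Type*} [MeasurableSpace Ω] {μ : Measure Ω}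
  {s : ℕ → Ω → Fin K} {w : ℕ → Ω → EuclideanSpace ℝ (Fin m)}

namespace IsRealization

/-- The realization axiom controls boxes of noise values only. Both sides are finite measures in
`A`, so agreement on boxes extends to all measurable sets of past noises. -/
lemma measure_path_inter_noise [IsProbabilityMeasure μ] (hS : S.IsAdmissible) (hreal : S.IsRealization μ s w) (T : ℕ)
    (a : ℕ → Fin K) {A : Set (Fin T → EuclideanSpace ℝ (Fin m))} (hA : MeasurableSet A)
    {B : Set (EuclideanSpace ℝ (Fin m))} (hB : MeasurableSet B) :
    μ ({ω | ∀ t ≤ T + 1, s t ω = a t} ∩ w (T + 1) ⁻¹' B ∩ (fun ω (r : Fin T) => w (r + 1) ω) ⁻¹' A) =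
      ENNReal.ofReal (S.P (a T) (a (T + 1))) * S.f (a (T + 1)) B *
      μ ({ω | ∀ t ≤ T, s t ω = a t} ∩ (fun ω (r : Fin T) => w (r + 1) ω) ⁻¹' A) := by
  have hprob := hS.isProb
  have hW : Measurable (fun ω (r : Fin T) => w (r + 1) ω) :=
    measurable_pi_lambda _ fun r => hreal.measurable_noise _
  have hbox : ∀ A ∈ Set.pi Set.univ '' Set.pi Set.univ
      (fun _ : Fin T => {A : Set (EuclideanSpace ℝ (Fin m)) | MeasurableSet A}),
      μ ({ω | ∀ t ≤ T + 1, s t ω = a t} ∩ w (T + 1) ⁻¹' B ∩ (fun ω (r : Fin T) => w (r + 1) ω) ⁻¹' A) =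
      ENNReal.ofReal (S.P (a T) (a (T + 1))) * S.f (a (T + 1)) B *
      μ ({ω | ∀ t ≤ T, s t ω = a t} ∩ (fun ω (r : Fin T) => w (r + 1) ω) ⁻¹' A) := by
    rintro _ ⟨D, hD, rfl⟩
    replace hD : ∀ r, MeasurableSet (D r) := fun r => hD r (Set.mem_univ r)
    -- Coordinate `r` of the past is the noise at time `r + 1`, hence the shift. Time `T + 1`
    -- receives `B`; the value at time `0` plays no role.
    let D' : ℕ → Set (EuclideanSpace ℝ (Fin m)) := fun t =>
      if h : t - 1 < T then D ⟨t - 1, h⟩ else B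
    have hD' : ∀ t, MeasurableSet (D' t) := by
      intro t
      simp only [D']
      split_ifs
      exacts [hD _, hB]
    have hDr : ∀ r : Fin T, D' (r + 1) = D r := fun r => by simp [D']
    have hDB : D' (T + 1) = B := by simp [D']
    have hW' : ∀ ω, (fun r : Fin T => w (r + 1) ω) ∈ Set.pi Set.univ D ↔
        ∀ t ∈ Finset.Icc 1 T, w t ω ∈ D' t := by
      intro ω
      simp only [Set.mem_pi, Set.mem_univ, true_imp_iff, Finset.mem_Icc]
      constructor
      · rintro h t ⟨h1, h2⟩
        have := h ⟨t - 1, by omega⟩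
        rw [← hDr] at this
        simpa [Nat.sub_add_cancel h1] using this
      · intro h r
        rw [← hDr]
        exact h _ ⟨by omega, r.2⟩
    have e1 : {ω | ∀ t ≤ T + 1, s t ω = a t} ∩ w (T + 1) ⁻¹' B ∩
        (fun ω (r : Fin T) => w (r + 1) ω) ⁻¹' Set.pi Set.univ D =
        {ω | (∀ t ≤ T + 1, s t ω = a t) ∧ ∀ t ∈ Finset.Icc 1 (T + 1), w t ω ∈ D' t} := by
      ext ω
      simp only [Set.mem_inter_iff, Set.mem_ofPred_eq, Set.mem_preimage, and_assoc, hW' ω]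
      refine and_congr_right fun _ => ?_
      rw [← Finset.insert_Icc_right_eq_Icc_add_one (by omega : 1 ≤ T + 1), Finset.forall_mem_insert,
        hDB]
    have e2 : {ω | ∀ t ≤ T, s t ω = a t} ∩
        (fun ω (r : Fin T) => w (r + 1) ω) ⁻¹' Set.pi Set.univ D =
        {ω | (∀ t ≤ T, s t ω = a t) ∧ ∀ t ∈ Finset.Icc 1 T, w t ω ∈ D' t} := by
      ext ω
      simp only [Set.mem_inter_iff, Set.mem_ofPred_eq, Set.mem_preimage, hW' ω]
    rw [e1, e2, hreal.noise _ a D' hD', hreal.noise _ a D' hD', hreal.markov,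
      Finset.prod_Icc_succ_top (by omega), hDB]
    ring
  have heq : (μ.restrict ({ω | ∀ t ≤ T + 1, s t ω = a t} ∩ w (T + 1) ⁻¹' B)).map
      (fun ω (r : Fin T) => w (r + 1) ω) =
      (ENNReal.ofReal (S.P (a T) (a (T + 1))) * S.f (a (T + 1)) B) •
        (μ.restrict {ω | ∀ t ≤ T, s t ω = a t}).map (fun ω (r : Fin T) => w (r + 1) ω) := by
    have key : ∀ A ∈ Set.pi Set.univ '' Set.pi Set.univ
      (fun _ : Fin T => {A : Set (EuclideanSpace ℝ (Fin m)) | MeasurableSet A}),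
      (μ.restrict ({ω | ∀ t ≤ T + 1, s t ω = a t} ∩ w (T + 1) ⁻¹' B)).map
      (fun ω (r : Fin T) => w (r + 1) ω) A =
      ((ENNReal.ofReal (S.P (a T) (a (T + 1))) * S.f (a (T + 1)) B) •
        (μ.restrict {ω | ∀ t ≤ T, s t ω = a t}).map (fun ω (r : Fin T) => w (r + 1) ω)) A := by
      intro A hA
      have hA' : MeasurableSet A := by
        obtain ⟨D, hD, rfl⟩ := hA
        exact MeasurableSet.univ_pi fun r => hD r (Set.mem_univ r)
      rw [Measure.smul_apply, Measure.map_apply hW hA', Measure.map_apply hW hA',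
        Measure.restrict_apply (hW hA'), Measure.restrict_apply (hW hA'), Set.inter_comm,
        hbox A hA, Set.inter_comm, smul_eq_mul]
    refine ext_of_generate_finite _ generateFrom_pi.symm isPiSystem_pi key (key _ ?_)
    -- The whole space is itself a box, so the total masses agree.
    exact ⟨fun _ => Set.univ, fun _ _ => by simp, by simp⟩
  have := congrArg (fun ρ => ρ A) heq
  rwa [Measure.smul_apply, Measure.map_apply hW hA, Measure.map_apply hW hA,
    Measure.restrict_apply (hW hA), Measure.restrict_apply (hW hA), Set.inter_comm,
    Set.inter_comm _ {ω | ∀ t ≤ T, s t ω = a t}, smul_eq_mul] at this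

lemma measure_path_inter_step [IsProbabilityMeasure μ] (hS : S.IsAdmissible) (hreal : S.IsRealization μ s w) (T : ℕ)
    (a : ℕ → Fin K) {A : Set (Fin T → EuclideanSpace ℝ (Fin m))} (hA : MeasurableSet A)
    {B : Set (Fin K × EuclideanSpace ℝ (Fin m))} (hB : MeasurableSet B) :
    μ ({ω | ∀ t ≤ T, s t ω = a t} ∩ (fun ω (r : Fin T) => w (r + 1) ω) ⁻¹' A ∩
        (fun ω => (s (T + 1) ω, w (T + 1) ω)) ⁻¹' B) =
      μ ({ω | ∀ t ≤ T, s t ω = a t} ∩ (fun ω (r : Fin T) => w (r + 1) ω) ⁻¹' A) * S.stepLaw (a T) B := by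
  rw [measure_eq_sum_inter_preimage_singleton μ (hreal.measurable_state (T + 1)),
    stepLaw_apply S _ hB, Finset.mul_sum]
  refine Finset.sum_congr rfl fun j _ => ?_
  -- The event is split by the value `j` of the next state; prescribing `j` at `T + 1` leaves the
  -- path up to `T` unchanged.
  have h := measure_path_inter_noise hS hreal T (Function.update a (T + 1) j) hA
    (measurable_prodMk_left (x := j) hB)
  have ha : ∀ t ≤ T, Function.update a (T + 1) j t = a t := fun t ht =>
    Function.update_of_ne (by omega) _ _
  have e1 : {ω | ∀ t ≤ T, s t ω = Function.update a (T + 1) j t} =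
      {ω | ∀ t ≤ T, s t ω = a t} := by
    ext ω
    exact forall₂_congr fun t ht => by rw [ha t ht]
  have e2 : {ω | ∀ t ≤ T, s t ω = a t} ∩ (fun ω (r : Fin T) => w (r + 1) ω) ⁻¹' A ∩
        (fun ω => (s (T + 1) ω, w (T + 1) ω)) ⁻¹' B ∩ s (T + 1) ⁻¹' {j} =
      {ω | ∀ t ≤ T + 1, s t ω = Function.update a (T + 1) j t} ∩
        w (T + 1) ⁻¹' (Prod.mk j ⁻¹' B) ∩ (fun ω (r : Fin T) => w (r + 1) ω) ⁻¹' A := by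
    ext ω
    have : (∀ t ≤ T + 1, s t ω = Function.update a (T + 1) j t) ↔
        (∀ t ≤ T, s t ω = a t) ∧ s (T + 1) ω = j := by
      constructor
      · intro h
        exact ⟨fun t ht => by rw [h t (by omega), ha t ht], by simpa using h (T + 1) le_rfl⟩
      · rintro ⟨h1, h2⟩ t ht
        rcases Nat.le_succ_iff.mp ht with ht | rfl
        · rw [h1 t ht, ha t ht]
        · simpa using h2
    simp only [Set.mem_inter_iff, Set.mem_ofPred_eq, Set.mem_preimage, Set.mem_singleton_iff, this]
    constructor
    · rintro ⟨⟨⟨h1, h2⟩, h3⟩, h4⟩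
      exact ⟨⟨⟨h1, h4⟩, h4 ▸ h3⟩, h2⟩
    · rintro ⟨⟨⟨h1, h4⟩, h3⟩, h2⟩
      exact ⟨⟨⟨h1, h2⟩, h4 ▸ h3⟩, h4⟩
  rw [e2, h, e1, Function.update_self, ha T le_rfl]
  ring

/-- Given the states up to time `T` and the noises up to time `T`, the pair `(s_{T+1}, w_{T+1})`
has law `stepLaw (s_T)`. -/
lemma measure_history_inter_step [IsProbabilityMeasure μ] (hS : S.IsAdmissible) (hreal : S.IsRealization μ s w) (T : ℕ)
    (i : Fin K) {A : Set ((Fin (T + 1) → Fin K) × (Fin T → EuclideanSpace ℝ (Fin m)))}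
    (hA : MeasurableSet A) {B : Set (Fin K × EuclideanSpace ℝ (Fin m))} (hB : MeasurableSet B) :
    μ ((fun ω => ((fun r : Fin (T + 1) => s r ω), (fun r : Fin T => w (r + 1) ω))) ⁻¹' A ∩
        s T ⁻¹' {i} ∩ (fun ω => (s (T + 1) ω, w (T + 1) ω)) ⁻¹' B) =
      μ ((fun ω => ((fun r : Fin (T + 1) => s r ω), (fun r : Fin T => w (r + 1) ω))) ⁻¹' A ∩
        s T ⁻¹' {i}) * S.stepLaw i B := by
  have hσ : Measurable (fun ω (r : Fin (T + 1)) => s r ω) :=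
    measurable_pi_lambda _ fun r => hreal.measurable_state _
  rw [measure_eq_sum_inter_preimage_singleton μ hσ, measure_eq_sum_inter_preimage_singleton μ hσ
    (_ ∩ s T ⁻¹' {i}), Finset.sum_mul]
  refine Finset.sum_congr rfl fun α _ => ?_
  -- The history is split over its finitely many state paths `α`. Those not ending in `i` contribute
  -- zero to both sides.
  by_cases hα : α (Fin.last T) = i
  · let a : ℕ → Fin K := fun t =>
      if h : t ≤ T then α ⟨t, Nat.lt_succ_of_le h⟩ else i
    have haT : a T = i := by simp only [a, le_refl, dif_pos]; exact hα
    have hpath : ∀ ω, (fun r : Fin (T + 1) => s r ω) = α ↔ ∀ t ≤ T, s t ω = a t := by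
      intro ω
      rw [funext_iff]
      constructor
      · intro h t ht
        simpa [a, ht] using h ⟨t, Nat.lt_succ_of_le ht⟩
      · intro h r
        have hr : (r : ℕ) ≤ T := Nat.le_of_lt_succ r.2
        simpa [a, hr] using h r hr
    have h := measure_path_inter_step hS hreal T a (A := Prod.mk α ⁻¹' A)
      (measurable_prodMk_left hA) hB
    rw [haT] at h
    convert h using 2
    · ext ω
      simp only [Set.mem_inter_iff, Set.mem_ofPred_eq, Set.mem_preimage, Set.mem_singleton_iff]
      rw [← hpath]
      constructor
      · rintro ⟨⟨⟨h1, h2⟩, h3⟩, h4⟩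
        exact ⟨⟨h4, h4 ▸ h1⟩, h3⟩
      · rintro ⟨⟨h4, h1⟩, h3⟩
        refine ⟨⟨⟨h4 ▸ h1, ?_⟩, h3⟩, h4⟩
        rw [← hα, ← h4]
        simp
    · congr 1
      ext ω
      simp only [Set.mem_inter_iff, Set.mem_ofPred_eq, Set.mem_preimage, Set.mem_singleton_iff]
      rw [← hpath]
      constructor
      · rintro ⟨⟨h1, h2⟩, h4⟩
        exact ⟨h4, h4 ▸ h1⟩
      · rintro ⟨h4, h1⟩
        refine ⟨⟨h4 ▸ h1, ?_⟩, h4⟩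
        rw [← hα, ← h4]
        simp
  · have hempty : s T ⁻¹' {i} ∩ (fun ω (r : Fin (T + 1)) => s r ω) ⁻¹' {α} = ∅ := by
      ext ω
      simp only [Set.mem_inter_iff, Set.mem_preimage, Set.mem_singleton_iff, Set.mem_empty_iff_false,
        iff_false, not_and]
      rintro h1 rfl
      exact hα (by simpa using h1)
    have h1 : ∀ X Y : Set Ω, X ∩ s T ⁻¹' {i} ∩ Y ∩ (fun ω (r : Fin (T + 1)) => s r ω) ⁻¹' {α} =
        ∅ := fun X Y => by
      refine Set.subset_empty_iff.mp (hempty ▸ ?_)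
      rintro ω ⟨⟨⟨-, h2⟩, -⟩, h4⟩
      exact ⟨h2, h4⟩
    have h2 := h1 ((fun ω => ((fun r : Fin (T + 1) => s r ω),
      (fun r : Fin T => w (r + 1) ω))) ⁻¹' A) Set.univ
    rw [Set.inter_univ] at h2
    rw [h1, h2, measure_empty, zero_mul]

end IsRealization

end JumpAffineSystem

/-! ### Conditioning on the history together with all perturbations -/

namespace ArePerturbations

open JumpAffineSystem

variable {K m n : ℕ} {Ω : Type*}

/-- The history up to time `T`, together with all perturbations. -/
def historyMap (s : ℕ → Ω → Fin K) (w : ℕ → Ω → EuclideanSpace ℝ (Fin m))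
    (Δ : Fin K → ℕ → Ω → EuclideanSpace ℝ (Fin n)) (T : ℕ) (ω : Ω) :
    ((Fin (T + 1) → Fin K) × (Fin T → EuclideanSpace ℝ (Fin m))) ×
      (Fin K × ℕ → EuclideanSpace ℝ (Fin n)) :=
  (((fun r => s r ω), (fun r => w (r + 1) ω)), fun q => Δ q.1 q.2 ω)

/-- The σ-algebra generated by the history up to time `T` and all perturbations. -/
@[reducible]
def history (s : ℕ → Ω → Fin K) (w : ℕ → Ω → EuclideanSpace ℝ (Fin m))
    (Δ : Fin K → ℕ → Ω → EuclideanSpace ℝ (Fin n)) (T : ℕ) : MeasurableSpace Ω :=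
  MeasurableSpace.comap (historyMap s w Δ T) inferInstance

section History

variable (s : ℕ → Ω → Fin K) (w : ℕ → Ω → EuclideanSpace ℝ (Fin m))
  (Δ : Fin K → ℕ → Ω → EuclideanSpace ℝ (Fin n)) (T : ℕ)

lemma measurable_historyMap : Measurable[history s w Δ T] (historyMap s w Δ T) :=
  comap_measurable _

lemma measurable_state_history {t : ℕ} (ht : t ≤ T) : Measurable[history s w Δ T] (s t) :=
  ((measurable_pi_apply (⟨t, by omega⟩ : Fin (T + 1))).comp
    (measurable_fst.comp measurable_fst)).comp (measurable_historyMap s w Δ T)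

lemma measurable_noise_history {t : ℕ} (ht : t < T) :
    Measurable[history s w Δ T] (w (t + 1)) :=
  ((measurable_pi_apply (⟨t, ht⟩ : Fin T)).comp
    (measurable_snd.comp measurable_fst)).comp (measurable_historyMap s w Δ T)

lemma measurable_perturbation_history (i : Fin K) (k : ℕ) :
    Measurable[history s w Δ T] (Δ i k) :=
  ((measurable_pi_apply (i, k)).comp measurable_snd).comp (measurable_historyMap s w Δ T)

lemma history_le_of_measurable {m' : MeasurableSpace Ω} (hs : ∀ t ≤ T, Measurable[m'] (s t))
    (hw : ∀ t < T, Measurable[m'] (w (t + 1))) (hΔ : ∀ i k, Measurable[m'] (Δ i k)) :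
    history s w Δ T ≤ m' := by
  refine measurable_iff_comap_le.mp ?_
  have h1 : Measurable[m'] (fun ω (r : Fin (T + 1)) => s r ω) :=
    measurable_pi_lambda _ fun r => hs r (Nat.le_of_lt_succ r.2)
  have h2 : Measurable[m'] (fun ω (r : Fin T) => w (r + 1) ω) :=
    measurable_pi_lambda _ fun r => hw r r.2
  have h3 : Measurable[m'] (fun ω (q : Fin K × ℕ) => Δ q.1 q.2 ω) :=
    measurable_pi_lambda _ fun q => hΔ q.1 q.2
  exact (h1.prodMk h2).prodMk h3

lemma history_mono : Monotone (history s w Δ) := fun T T' h =>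
  history_le_of_measurable s w Δ T
    (fun _ ht => measurable_state_history s w Δ T' (ht.trans h))
    (fun _ ht => measurable_noise_history s w Δ T' (ht.trans_le h))
    (fun i k => measurable_perturbation_history s w Δ T' i k)

end History

variable [MeasurableSpace Ω] {S : JumpAffineSystem K m n} {μ : Measure Ω}
  {s : ℕ → Ω → Fin K} {w : ℕ → Ω → EuclideanSpace ℝ (Fin m)}
  {Δ : Fin K → ℕ → Ω → EuclideanSpace ℝ (Fin n)} {ν : Measure ℝ}

lemma history_le (hreal : S.IsRealization μ s w) (hΔ : ArePerturbations μ ν s w Δ) (T : ℕ) :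
    history s w Δ T ≤ ‹MeasurableSpace Ω› :=
  history_le_of_measurable s w Δ T (fun _ _ => hreal.measurable_state _)
    (fun _ _ => hreal.measurable_noise _) hΔ.measurable

/-- On `{s_T = i}`, the pair `(s_{T+1}, w_{T+1})` has law `stepLaw i` independently of the history
and of the perturbations. -/
lemma restrict_history_inter_step [IsProbabilityMeasure μ] (hS : S.IsAdmissible) (hreal : S.IsRealization μ s w)
    (hΔ : ArePerturbations μ ν s w Δ) (T : ℕ) (i : Fin K) (E : Set Ω)
    (hE : MeasurableSet[history s w Δ T] E) (B : Set (Fin K × EuclideanSpace ℝ (Fin m)))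
    (hB : MeasurableSet B) :
    μ.restrict (s T ⁻¹' {i}) (E ∩ (fun ω => (s (T + 1) ω, w (T + 1) ω)) ⁻¹' B) =
      μ.restrict (s T ⁻¹' {i}) E * S.stepLaw i B := by
  obtain ⟨A, hA, rfl⟩ := hE
  have hi : MeasurableSet (s T ⁻¹' {i}) := hreal.measurable_state T (measurableSet_singleton i)
  rw [Measure.restrict_apply' hi, Measure.restrict_apply' hi]
  set sys : Ω → ℕ → Fin K × EuclideanSpace ℝ (Fin m) := fun ω t => (s t ω, w t ω) with hsys
  set D : Ω → Fin K × ℕ → EuclideanSpace ℝ (Fin n) := fun ω q => Δ q.1 q.2 ω with hD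
  have hsysm : Measurable sys := measurable_pi_lambda _ fun t =>
    (hreal.measurable_state t).prodMk (hreal.measurable_noise t)
  have hDm : Measurable D := measurable_pi_lambda _ fun q => hΔ.measurable q.1 q.2
  have hprod : μ.map (fun ω => (D ω, sys ω)) = (μ.map D).prod (μ.map sys) :=
    (indepFun_iff_map_prod_eq_prod_map_map hDm.aemeasurable hsysm.aemeasurable).mp hΔ.indep_system
  have : IsProbabilityMeasure (μ.map sys) := Measure.isProbabilityMeasure_map hsysm.aemeasurable
  let h : (Fin K × ℕ → EuclideanSpace ℝ (Fin n)) × (ℕ → Fin K × EuclideanSpace ℝ (Fin m)) →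
      ((Fin (T + 1) → Fin K) × (Fin T → EuclideanSpace ℝ (Fin m))) ×
      (Fin K × ℕ → EuclideanSpace ℝ (Fin n)) :=
    fun p => (((fun r => (p.2 r).1), (fun r => (p.2 (r + 1)).2)), p.1)
  have hh : Measurable h := by fun_prop
  have hiF : MeasurableSet {p : (Fin K × ℕ → EuclideanSpace ℝ (Fin n)) ×
      (ℕ → Fin K × EuclideanSpace ℝ (Fin m)) | (p.2 T).1 = i} := by
    have : Measurable (fun p : (Fin K × ℕ → EuclideanSpace ℝ (Fin n)) ×
      (ℕ → Fin K × EuclideanSpace ℝ (Fin m)) => (p.2 T).1) := by fun_prop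
    exact this (measurableSet_singleton i)
  have hBF : MeasurableSet {p : (Fin K × ℕ → EuclideanSpace ℝ (Fin n)) ×
      (ℕ → Fin K × EuclideanSpace ℝ (Fin m)) | p.2 (T + 1) ∈ B} := by
    have : Measurable (fun p : (Fin K × ℕ → EuclideanSpace ℝ (Fin n)) ×
      (ℕ → Fin K × EuclideanSpace ℝ (Fin m)) => p.2 (T + 1)) := by fun_prop
    exact this hB
  have hF1 := ((hh hA).inter hiF).inter hBF
  have hF2 := (hh hA).inter hiF
  have e1 : historyMap s w Δ T ⁻¹' A ∩ (fun ω => (s (T + 1) ω, w (T + 1) ω)) ⁻¹' B ∩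
      s T ⁻¹' {i} = (fun ω => (D ω, sys ω)) ⁻¹' (h ⁻¹' A ∩ {p | (p.2 T).1 = i} ∩
        {p | p.2 (T + 1) ∈ B}) := by
    ext ω
    simp only [Set.mem_inter_iff, Set.mem_preimage, Set.mem_singleton_iff, Set.mem_ofPred_eq]
    tauto
  have e2 : historyMap s w Δ T ⁻¹' A ∩ s T ⁻¹' {i} =
      (fun ω => (D ω, sys ω)) ⁻¹' (h ⁻¹' A ∩ {p | (p.2 T).1 = i}) := rfl
  rw [e1, e2, ← Measure.map_apply (hDm.prodMk hsysm) hF1, ← Measure.map_apply (hDm.prodMk hsysm) hF2,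
    hprod, Measure.prod_apply hF1, Measure.prod_apply hF2,
    ← lintegral_mul_const _ (measurable_measure_prodMk_left hF2)]
  -- By independence the perturbations may be frozen at `d`; a statement about states and noises
  -- alone remains.
  refine lintegral_congr fun d => ?_
  rw [Measure.map_apply hsysm (measurable_prodMk_left hF1),
    Measure.map_apply hsysm (measurable_prodMk_left hF2)]
  exact IsRealization.measure_history_inter_step hS hreal T i
    (A := (fun y => (y, d)) ⁻¹' A) (measurable_prodMk_right hA) hB

end ArePerturbations

/-! ### Moments of the perturbations -/

namespace IsPerturbationLaw

variable {ν : Measure ℝ} {ξ₁ ξ₂ : ℝ}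

/-- The moment condition reads `1/0` as `∞`, so it excludes an atom at zero; the convention `1/0 =
0` of real division is then harmless. -/
lemma ae_ne_zero (hν : IsPerturbationLaw ν ξ₁ ξ₂) : ∀ᵐ x ∂ν, x ≠ 0 := by
  have h := ae_lt_top (μ := ν) (f := fun x : ℝ => (ENNReal.ofReal (x ^ 2))⁻¹) (by fun_prop)
    (hν.inv_sq.trans_lt ENNReal.ofReal_lt_top).ne
  filter_upwards [h] with x hx h0
  simp [h0] at hx

lemma lintegral_inv_sq_le (hν : IsPerturbationLaw ν ξ₁ ξ₂) :
    ∫⁻ x, ENNReal.ofReal ((1 / x) ^ 2) ∂ν ≤ ENNReal.ofReal ξ₂ := by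
  refine le_trans (lintegral_mono_ae ?_) hν.inv_sq
  filter_upwards [hν.ae_ne_zero] with x hx
  rw [← ENNReal.ofReal_inv_of_pos (by positivity), one_div, inv_pow]

lemma memLp_inv (hν : IsPerturbationLaw ν ξ₁ ξ₂) : MemLp (fun x : ℝ => 1 / x) 2 ν := by
  have hm : Measurable (fun x : ℝ => 1 / x) := by fun_prop
  rw [memLp_two_iff_integrable_sq hm.aestronglyMeasurable]
  refine ⟨(hm.pow_const 2).aestronglyMeasurable, ?_⟩
  rw [hasFiniteIntegral_iff_ofReal (ae_of_all _ fun ω => sq_nonneg _)]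
  exact hν.lintegral_inv_sq_le.trans_lt ENNReal.ofReal_lt_top

lemma memLp_id (hν : IsPerturbationLaw ν ξ₁ ξ₂) : MemLp (fun x : ℝ => x) 2 ν := by
  have := hν.isProb
  exact MemLp.of_bound measurable_id.aestronglyMeasurable ξ₁ hν.bounded

lemma integral_id_eq_zero (hν : IsPerturbationLaw ν ξ₁ ξ₂) : ∫ x, x ∂ν = 0 := by
  have h : ∫ x, x ∂(ν.map (fun x => -x)) = ∫ x, -x ∂ν :=
    integral_map (f := fun x : ℝ => x) measurable_neg.aemeasurable
      measurable_id.aestronglyMeasurable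
  rw [hν.symm, integral_neg] at h
  linarith

lemma integral_inv_mul_self (hν : IsPerturbationLaw ν ξ₁ ξ₂) : ∫ x, 1 / x * x ∂ν = 1 := by
  have hprob := hν.isProb
  have h : ∫ x, 1 / x * x ∂ν = ∫ _, (1 : ℝ) ∂ν := by
    refine integral_congr_ae ?_
    filter_upwards [hν.ae_ne_zero] with x hx
    field_simp
  rw [h, integral_const]
  simp

end IsPerturbationLaw

lemma measurable_coordInv {n : ℕ} : Measurable (coordInv (n := n)) := by
  have h : Measurable fun v : EuclideanSpace ℝ (Fin n) => fun l => 1 / v l :=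
    measurable_pi_lambda _ fun l => by fun_prop
  exact (PiLp.continuous_toLp 2 _).measurable.comp h

namespace ArePerturbations

variable {K m n : ℕ} {Ω : Type*} [MeasurableSpace Ω] {μ : Measure Ω}
  {s : ℕ → Ω → Fin K} {w : ℕ → Ω → EuclideanSpace ℝ (Fin m)}
  {Δ : Fin K → ℕ → Ω → EuclideanSpace ℝ (Fin n)} {ν : Measure ℝ} {ξ₁ ξ₂ : ℝ}

lemma measurable_coord (hΔ : ArePerturbations μ ν s w Δ) (i : Fin K) (k : ℕ) (l : Fin n) :
    Measurable (fun ω => Δ i k ω l) := by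
  have := hΔ.measurable i k
  fun_prop

lemma ae_norm_sq_le (hν : IsPerturbationLaw ν ξ₁ ξ₂) (hΔ : ArePerturbations μ ν s w Δ) :
    ∀ᵐ ω ∂μ, ∀ i k, ‖Δ i k ω‖ ^ 2 ≤ n * ξ₁ ^ 2 := by
  have h : ∀ i k l, ∀ᵐ ω ∂μ, |Δ i k ω l| ≤ ξ₁ := by
    intro i k l
    have := hν.bounded
    rw [← hΔ.law i k l] at this
    exact ae_of_ae_map (hΔ.measurable_coord i k l).aemeasurable this
  have h' : ∀ᵐ ω ∂μ, ∀ i k l, |Δ i k ω l| ≤ ξ₁ :=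
    ae_all_iff.mpr fun i => ae_all_iff.mpr fun k => ae_all_iff.mpr fun l => h i k l
  filter_upwards [h'] with ω hω i k
  rw [EuclideanSpace.norm_sq_eq]
  calc ∑ l, ‖Δ i k ω l‖ ^ 2 ≤ ∑ _l : Fin n, ξ₁ ^ 2 :=
        Finset.sum_le_sum fun l _ => pow_le_pow_left₀ (norm_nonneg _) (hω i k l) 2
    _ = n * ξ₁ ^ 2 := by simp

lemma lintegral_norm_coordInv_sq_le (hν : IsPerturbationLaw ν ξ₁ ξ₂)
    (hΔ : ArePerturbations μ ν s w Δ) (i : Fin K) (k : ℕ) :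
    ∫⁻ ω, ENNReal.ofReal (‖coordInv (Δ i k ω)‖ ^ 2) ∂μ ≤ n * ENNReal.ofReal ξ₂ := by
  have e : ∀ ω, ENNReal.ofReal (‖coordInv (Δ i k ω)‖ ^ 2) =
      ∑ l, ENNReal.ofReal ((1 / Δ i k ω l) ^ 2) := by
    intro ω
    rw [EuclideanSpace.norm_sq_eq, ENNReal.ofReal_sum_of_nonneg fun _ _ => sq_nonneg _]
    refine Finset.sum_congr rfl fun l _ => ?_
    rw [Real.norm_eq_abs, sq_abs]
    rfl
  have hm : ∀ l, Measurable (fun ω => Δ i k ω l) := hΔ.measurable_coord i k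
  simp_rw [e]
  have hm2 : ∀ l, Measurable fun ω => ENNReal.ofReal ((1 / Δ i k ω l) ^ 2) := fun l =>
    ((measurable_const.div (hm l)).pow_const 2).ennreal_ofReal
  rw [lintegral_finsetSum _ fun l _ => hm2 l]
  calc ∑ l, ∫⁻ ω, ENNReal.ofReal ((1 / Δ i k ω l) ^ 2) ∂μ ≤ ∑ _l : Fin n, ENNReal.ofReal ξ₂ := by
        refine Finset.sum_le_sum fun l _ => ?_
        have hf : Measurable fun x : ℝ => ENNReal.ofReal ((1 / x) ^ 2) := by fun_prop
        have := lintegral_map (μ := μ) hf (hm l)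
        rw [hΔ.law i k l] at this
        exact this ▸ hν.lintegral_inv_sq_le
    _ = n * ENNReal.ofReal ξ₂ := by
        rw [Finset.sum_const, Finset.card_univ, Fintype.card_fin, nsmul_eq_mul]

lemma memLp_coord (hν : IsPerturbationLaw ν ξ₁ ξ₂) (hΔ : ArePerturbations μ ν s w Δ)
    (i : Fin K) (k : ℕ) (l : Fin n) : MemLp (fun ω => Δ i k ω l) 2 μ := by
  have h := hν.memLp_id
  rw [← hΔ.law i k l] at h
  exact h.comp_of_map (hΔ.measurable_coord i k l).aemeasurable

lemma memLp_inv_coord (hν : IsPerturbationLaw ν ξ₁ ξ₂) (hΔ : ArePerturbations μ ν s w Δ)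
    (i : Fin K) (k : ℕ) (l : Fin n) : MemLp (fun ω => 1 / Δ i k ω l) 2 μ := by
  have h := hν.memLp_inv
  rw [← hΔ.law i k l] at h
  exact h.comp_of_map (hΔ.measurable_coord i k l).aemeasurable

/-- On the diagonal the product is `1` almost surely. Off the diagonal independence factors the
integral, and symmetry makes the mean of `Δ_{l'}` vanish. -/
lemma integral_inv_mul_coord [IsProbabilityMeasure μ] (hν : IsPerturbationLaw ν ξ₁ ξ₂)
    (hΔ : ArePerturbations μ ν s w Δ) (i : Fin K) (k : ℕ) (l l' : Fin n) :
    ∫ ω, 1 / Δ i k ω l * Δ i k ω l' ∂μ = if l = l' then 1 else 0 := by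
  have hm := hΔ.measurable_coord i k
  split_ifs with h
  · subst h
    rw [← integral_map (f := fun x : ℝ => 1 / x * x) (hm l).aemeasurable
      (by fun_prop : Measurable fun x : ℝ => 1 / x * x).aestronglyMeasurable, hΔ.law i k l]
    exact hν.integral_inv_mul_self
  · have hind : IndepFun (fun ω => Δ i k ω l) (fun ω => Δ i k ω l') μ :=
      hΔ.indep.indepFun (i := (i, k, l)) (j := (i, k, l')) (by simpa using h)
    have hind' := hind.comp (φ := fun x : ℝ => 1 / x) (ψ := fun x : ℝ => x) (by fun_prop)
      measurable_id
    have h0 : ∫ ω, Δ i k ω l' ∂μ = 0 := by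
      rw [← integral_map (f := fun x : ℝ => x) (hm l').aemeasurable
        measurable_id.aestronglyMeasurable, hΔ.law i k l']
      exact hν.integral_id_eq_zero
    have := hind'.integral_mul_eq_mul_integral
      (measurable_const.div (hm l)).aestronglyMeasurable (hm l').aestronglyMeasurable
    simp only [Function.comp_def, Pi.mul_def] at this
    rw [this, h0, mul_zero]

lemma inner_coordInv_mul_inner (u v d : EuclideanSpace ℝ (Fin n)) :
    inner ℝ u (coordInv d) * inner ℝ d v =
      ∑ l, ∑ l', u l * v l' * (1 / d l * d l') := by
  simp only [PiLp.inner_apply, RCLike.inner_apply, conj_trivial, coordInv]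
  rw [Finset.sum_mul_sum]
  refine Finset.sum_congr rfl fun l _ => Finset.sum_congr rfl fun l' _ => ?_
  ring

/-- The perturbation direction estimator `⟨Δ, v⟩ Δ⁻¹` is integrable and unbiased. -/
lemma integrable_inner_coordInv_mul_inner (hν : IsPerturbationLaw ν ξ₁ ξ₂)
    (hΔ : ArePerturbations μ ν s w Δ) (i : Fin K) (k : ℕ) (u v : EuclideanSpace ℝ (Fin n)) :
    Integrable (fun ω => inner ℝ u (coordInv (Δ i k ω)) * inner ℝ (Δ i k ω) v) μ := by
  simp_rw [inner_coordInv_mul_inner]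
  refine integrable_finsetSum _ fun l _ => integrable_finsetSum _ fun l' _ => ?_
  exact ((hΔ.memLp_inv_coord hν i k l).integrable_mul (hΔ.memLp_coord hν i k l')).const_mul _

/-- This is what makes simultaneous perturbation work: in the coordinate expansion only the diagonal
terms survive. -/
lemma integral_inner_coordInv_mul_inner [IsProbabilityMeasure μ] (hν : IsPerturbationLaw ν ξ₁ ξ₂)
    (hΔ : ArePerturbations μ ν s w Δ) (i : Fin K) (k : ℕ) (u v : EuclideanSpace ℝ (Fin n)) :
    ∫ ω, inner ℝ u (coordInv (Δ i k ω)) * inner ℝ (Δ i k ω) v ∂μ = inner ℝ u v := by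
  have hi : ∀ l l', Integrable (fun ω => u l * v l' * (1 / Δ i k ω l * Δ i k ω l')) μ :=
    fun l l' =>
      ((hΔ.memLp_inv_coord hν i k l).integrable_mul (hΔ.memLp_coord hν i k l')).const_mul _
  simp_rw [inner_coordInv_mul_inner]
  rw [integral_finsetSum _ fun l _ => integrable_finsetSum _ fun l' _ => hi l l']
  simp only [PiLp.inner_apply, RCLike.inner_apply, conj_trivial]
  refine Finset.sum_congr rfl fun l _ => ?_
  rw [integral_finsetSum _ fun l' _ => hi l l']
  simp_rw [integral_const_mul, hΔ.integral_inv_mul_coord hν i k l]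
  simp [mul_comm]

/-- The σ-algebra generated by the perturbations for state `i` with index at most `k`. -/
@[reducible]
def pertHistory {Ω : Type*} (Δ : Fin K → ℕ → Ω → EuclideanSpace ℝ (Fin n)) (i : Fin K) (k : ℕ) :
    MeasurableSpace Ω :=
  MeasurableSpace.comap (fun ω (q : {q // q ∈ Finset.range (k + 1)}) => Δ i q ω) inferInstance

lemma measurable_pertHistory {Ω : Type*} (Δ : Fin K → ℕ → Ω → EuclideanSpace ℝ (Fin n))
    (i : Fin K) {j k : ℕ} (h : j ≤ k) : Measurable[pertHistory Δ i k] (Δ i j) := by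
  have hmem : j ∈ Finset.range (k + 1) := Finset.mem_range.mpr (Nat.lt_succ_of_le h)
  have h1 : Measurable fun f : {q // q ∈ Finset.range (k + 1)} → EuclideanSpace ℝ (Fin n) =>
      f ⟨j, hmem⟩ := measurable_pi_apply _
  have h2 : Measurable[pertHistory Δ i k] fun ω (q : {q // q ∈ Finset.range (k + 1)}) =>
      Δ i q ω := comap_measurable _
  exact h1.comp h2

lemma pertHistory_le_of_measurable {Ω : Type*} {m' : MeasurableSpace Ω}
    (Δ : Fin K → ℕ → Ω → EuclideanSpace ℝ (Fin n)) (i : Fin K) (k : ℕ)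
    (h : ∀ j ≤ k, Measurable[m'] (Δ i j)) : pertHistory Δ i k ≤ m' := by
  refine measurable_iff_comap_le.mp ?_
  exact measurable_pi_lambda _ fun q => h q (Nat.le_of_lt_succ (Finset.mem_range.mp q.2))

lemma pertHistory_mono {Ω : Type*} (Δ : Fin K → ℕ → Ω → EuclideanSpace ℝ (Fin n)) (i : Fin K) :
    Monotone (pertHistory Δ i) := fun _ _ h =>
  pertHistory_le_of_measurable Δ i _ fun _ hj => measurable_pertHistory Δ i (hj.trans h)

/-- A perturbation is independent of those with smaller index. -/
lemma measure_pertHistory_inter (hΔ : ArePerturbations μ ν s w Δ) (i : Fin K) (k : ℕ) (E : Set Ω)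
    (hE : MeasurableSet[pertHistory Δ i k] E) (B : Set (EuclideanSpace ℝ (Fin n)))
    (hB : MeasurableSet B) :
    μ (E ∩ Δ i (k + 1) ⁻¹' B) = μ E * μ.map (Δ i (k + 1)) B := by
  rw [Measure.map_apply (hΔ.measurable _ _) hB]
  -- Earlier and new perturbations occupy disjoint blocks of coordinates, and disjoint blocks of an
  -- independent family are independent.
  set I : Finset (Fin K × ℕ × Fin n) := {i} ×ˢ (Finset.range (k + 1) ×ˢ Finset.univ) with hI
  set J : Finset (Fin K × ℕ × Fin n) := {i} ×ˢ ({k + 1} ×ˢ Finset.univ) with hJ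
  have hIJ : Disjoint I J := by
    rw [Finset.disjoint_left]
    rintro ⟨a, b, c⟩ h1 h2
    simp only [hI, hJ, Finset.mem_product, Finset.mem_singleton, Finset.mem_range,
      Finset.mem_univ, and_true] at h1 h2
    omega
  have hind := hΔ.indep.indepFun_finset I J hIJ fun q => hΔ.measurable_coord q.1 q.2.1 q.2.2
  let φ : (I → ℝ) → {q // q ∈ Finset.range (k + 1)} → EuclideanSpace ℝ (Fin n) := fun f q =>
    WithLp.toLp 2 fun l => f ⟨(i, q, l), by
      simpa only [hI, Finset.mem_product, Finset.mem_singleton, Finset.mem_univ, and_true,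
        true_and] using q.2⟩
  let ψ : (J → ℝ) → EuclideanSpace ℝ (Fin n) := fun f =>
    WithLp.toLp 2 fun l => f ⟨(i, k + 1, l), by simp [hJ]⟩
  have hφ : Measurable φ := measurable_pi_lambda _ fun q =>
    (PiLp.continuous_toLp 2 _).measurable.comp (measurable_pi_lambda _ fun l =>
      measurable_pi_apply _)
  have hψ : Measurable ψ := (PiLp.continuous_toLp 2 _).measurable.comp
    (measurable_pi_lambda _ fun l => measurable_pi_apply _)
  have h2 := hind.comp hφ hψ
  obtain ⟨A, hA, rfl⟩ := hE
  exact h2.measure_inter_preimage_eq_mul A B hA hB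

end ArePerturbations

/-! ### Measurability of the memory -/

/-- Needed because the perturbation in use is selected by a random counter. -/
lemma Measurable.apply_countable {Ω ι β : Type*} [MeasurableSpace Ω] [MeasurableSpace β]
    [Countable ι] [MeasurableSpace ι] [MeasurableSingletonClass ι] {f : ι → Ω → β} {N : Ω → ι}
    (hf : ∀ i, Measurable (f i)) (hN : Measurable N) : Measurable fun ω => f (N ω) ω := by
  have h : Measurable fun p : ι × Ω => f p.1 p.2 := measurable_from_prod_countable_right hf
  exact h.comp (hN.prodMk measurable_id)

namespace JumpAffineSystem

variable {K m n : ℕ} (S : JumpAffineSystem K m n)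

lemma measurable_output : Measurable fun p : (Fin K × EuclideanSpace ℝ (Fin m)) ×
    EuclideanSpace ℝ (Fin n) => S.output p.1.1 p.2 p.1.2 := by
  refine Measurable.apply_countable (f := fun j (p : (Fin K × EuclideanSpace ℝ (Fin m)) ×
    EuclideanSpace ℝ (Fin n)) => S.output j p.2 p.1.2) (fun j => ?_) (by fun_prop)
  have h : Continuous (S.A j).toEuclideanLin := LinearMap.continuous_of_finiteDimensional _
  have := h.measurable
  unfold output
  fun_prop

end JumpAffineSystem

namespace MSPSAParams

variable {K m n : ℕ} {Ω : Type*} [MeasurableSpace Ω]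
  (par : MSPSAParams K n) (S : JumpAffineSystem K m n) {C : Set (EuclideanSpace ℝ (Fin n))}
  (ystar : EuclideanSpace ℝ (Fin m)) {s : ℕ → Ω → Fin K}
  {w : ℕ → Ω → EuclideanSpace ℝ (Fin m)} {Δ : Fin K → ℕ → Ω → EuclideanSpace ℝ (Fin n)}

lemma measurable_inputOf {M : Ω → MSPSAMemory K n} {i : Fin K} (hΔ : ∀ k, Measurable (Δ i k))
    (hest : Measurable fun ω => (M ω).est i) (hcnt : Measurable fun ω => (M ω).cnt i)
    (hflag : Measurable fun ω => (M ω).flag i) :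
    Measurable fun ω => par.inputOf (fun i k => Δ i k ω) (M ω) i := by
  unfold inputOf
  have h1 : Measurable fun ω => par.pertGain i ((M ω).cnt i) • Δ i ((M ω).cnt i) ω :=
    Measurable.apply_countable (f := fun k ω => par.pertGain i k • Δ i k ω)
      (fun k => by have := hΔ k; fun_prop) hcnt
  have h2 : Measurable fun ω => par.pertGain i ((M ω).cnt i + 1) • Δ i ((M ω).cnt i + 1) ω :=
    Measurable.apply_countable (f := fun k ω => par.pertGain i (k + 1) • Δ i (k + 1) ω)
      (fun k => by have := hΔ (k + 1); fun_prop) hcnt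
  exact Measurable.ite (hflag (measurableSet_singleton true)) (hest.sub h1) (hest.add h2)

lemma measurable_obsLoss {i : Fin K} {t : ℕ} (hs : Measurable (s (t + 1)))
    (hw : Measurable (w (t + 1))) (hin : Measurable fun ω => par.inputOf (fun i k => Δ i k ω)
      (par.memory S C ystar (fun t => s t ω) (fun t => w t ω) (fun i k => Δ i k ω) t) i) :
    Measurable fun ω => par.obsLoss S C ystar (fun t => s t ω) (fun t => w t ω)
      (fun i k => Δ i k ω) i t :=
  (((S.measurable_output.comp ((hs.prodMk hw).prodMk hin)).sub_const ystar).norm).pow_const 2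

/-- The memory at stage `T` is measurable in the history up to `T`. -/
lemma measurable_memory (hC : IsCompact C) (hconv : Convex ℝ C) (hne : C.Nonempty) (T : ℕ)
    (hs : ∀ t ≤ T, Measurable (s t)) (hw : ∀ t < T, Measurable (w (t + 1)))
    (hΔ : ∀ i k, Measurable (Δ i k)) (i : Fin K) :
    (Measurable fun ω => (par.memory S C ystar (fun t => s t ω) (fun t => w t ω)
      (fun i k => Δ i k ω) T).est i) ∧
    (Measurable fun ω => (par.memory S C ystar (fun t => s t ω) (fun t => w t ω)
      (fun i k => Δ i k ω) T).cnt i) ∧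
    (Measurable fun ω => (par.memory S C ystar (fun t => s t ω) (fun t => w t ω)
      (fun i k => Δ i k ω) T).flag i) ∧
    (Measurable fun ω => (par.memory S C ystar (fun t => s t ω) (fun t => w t ω)
      (fun i k => Δ i k ω) T).dplus i) := by
  induction T with
  | zero => exact ⟨measurable_const, measurable_const, measurable_const, measurable_const⟩
  | succ T ih =>
    obtain ⟨hest, hcnt, hflag, hdp⟩ := ih (fun t ht => hs t (by omega)) fun t ht => hw t (by omega)
    have hobs := par.measurable_obsLoss S ystar (C := C) (hs (T + 1) le_rfl)
      (hw T (by omega)) (par.measurable_inputOf (hΔ i) hest hcnt hflag)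
    set M := fun ω => par.memory S C ystar (fun t => s t ω) (fun t => w t ω)
      (fun i k => Δ i k ω) T with hM
    set M' := fun ω => par.memory S C ystar (fun t => s t ω) (fun t => w t ω)
      (fun i k => Δ i k ω) (T + 1) with hM'
    have hvis : MeasurableSet {ω | s T ω = i} := hs T (by omega) (measurableSet_singleton i)
    have hfl : MeasurableSet {ω | (M ω).flag i = true} := hflag (measurableSet_singleton true)
    have hstep : Measurable fun ω => par.stepSize i ((M ω).cnt i) :=
      (measurable_from_top (f := par.stepSize i)).comp hcnt
    have hgain : Measurable fun ω => par.pertGain i ((M ω).cnt i) :=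
      (measurable_from_top (f := par.pertGain i)).comp hcnt
    have hinv : Measurable fun ω => coordInv (Δ i ((M ω).cnt i) ω) :=
      measurable_coordInv.comp (Measurable.apply_countable (hΔ i) hcnt)
    have hproj := (continuous_euclideanProj hC hconv hne).measurable.comp
      (hest.sub ((hstep.mul ((hdp.sub hobs).div hgain)).smul hinv))
    have e : ∀ ω, (M' ω).est i = (if s T ω = i then (if (M ω).flag i = true then
          euclideanProj C ((M ω).est i - (par.stepSize i ((M ω).cnt i) * (((M ω).dplus i -
            par.obsLoss S C ystar (fun t => s t ω) (fun t => w t ω) (fun i k => Δ i k ω) i T) /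
            par.pertGain i ((M ω).cnt i))) • coordInv (Δ i ((M ω).cnt i) ω))
          else (M ω).est i) else (M ω).est i) ∧
        (M' ω).cnt i = (if s T ω = i then (if (M ω).flag i = true then (M ω).cnt i
          else (M ω).cnt i + 1) else (M ω).cnt i) ∧
        (M' ω).flag i = (if s T ω = i then (if (M ω).flag i = true then false else true)
          else (M ω).flag i) ∧
        (M' ω).dplus i = (if s T ω = i then (if (M ω).flag i = true then (M ω).dplus i
          else par.obsLoss S C ystar (fun t => s t ω) (fun t => w t ω) (fun i k => Δ i k ω) i T)
          else (M ω).dplus i) := by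
      intro ω
      by_cases h : s T ω = i
      · cases hf : (M ω).flag i
        · obtain ⟨h0, h1, h2, h3⟩ := par.memory_succ_of_flag_false S C ystar (fun t => w t ω)
            (fun i k => Δ i k ω) (s := fun t => s t ω) h hf
          simp only [if_pos h, Bool.false_eq_true, if_false]
          exact ⟨h0, h1, h2, h3⟩
        · obtain ⟨h0, h1, h2, h3⟩ := par.memory_succ_of_flag_true S C ystar (fun t => w t ω)
            (fun i k => Δ i k ω) (s := fun t => s t ω) h hf
          simp only [if_pos h, if_true]
          exact ⟨h0, h1, h2, h3⟩
      · simp only [if_neg h]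
        exact par.memory_succ_of_ne S C ystar (fun t => w t ω) (fun i k => Δ i k ω)
          (s := fun t => s t ω) h
    refine ⟨?_, ?_, ?_, ?_⟩
    · rw [funext fun ω => (e ω).1]
      exact Measurable.ite hvis (Measurable.ite hfl hproj hest) hest
    · rw [funext fun ω => (e ω).2.1]
      exact Measurable.ite hvis (Measurable.ite hfl hcnt (hcnt.add_const 1)) hcnt
    · rw [funext fun ω => (e ω).2.2.1]
      exact Measurable.ite hvis (Measurable.ite hfl measurable_const measurable_const) hflag
    · rw [funext fun ω => (e ω).2.2.2]
      exact Measurable.ite hvis (Measurable.ite hfl hdp hobs) hdp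

end MSPSAParams

namespace MSPSAParams

variable {K m n : ℕ}

/-! ### Summability of the gains -/

section Gains

variable (par : MSPSAParams K n) (i : Fin K)

lemma pertGain_le (hγ' : 0 < par.γ' i) {k : ℕ} (hk : 1 ≤ k) : par.pertGain i k ≤ par.γ' i := by
  have h1 : (1 : ℝ) ≤ k := by exact_mod_cast hk
  have h2 : (1 : ℝ) ≤ (par.N' i : ℝ) + k := by
    have : (0 : ℝ) ≤ par.N' i := Nat.cast_nonneg _
    linarith
  exact div_le_self hγ'.le (Real.one_le_rpow h2 (by norm_num))

lemma tendsto_pertGain : Tendsto (par.pertGain i) atTop (𝓝 0) := by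
  have h1 : Tendsto (fun k : ℕ => ((par.N' i : ℝ) + k) ^ (1 / 4 : ℝ)) atTop atTop :=
    (tendsto_rpow_atTop (by norm_num)).comp
      (tendsto_atTop_add_const_left _ _ tendsto_natCast_atTop_atTop)
  exact h1.const_div_atTop _

/-- The terms are of order `k^(-2) · k^(1/2) = k^(-3/2)`. -/
lemma summable_gainRatio_sq (hγ' : 0 < par.γ' i) :
    Summable fun k => par.gainRatio i (k + 1) ^ 2 := by
  have hs : Summable fun k : ℕ => 1 / (((k + 1 : ℕ) : ℝ)) ^ (3 / 2 : ℝ) :=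
    (summable_nat_add_iff 1).mpr (Real.summable_one_div_nat_rpow.mpr (by norm_num))
  refine Summable.of_nonneg_of_le (fun k => sq_nonneg _) (fun k => ?_)
    -- The offsets are absorbed for `x ≥ 1` by `N' + x ≤ (N' + 1) x` and `N + x ≥ x`.
    (hs.mul_left (par.γ i ^ 2 / par.γ' i ^ 2 * (par.N' i + 1 : ℝ) ^ (1 / 2 : ℝ)))
  set x : ℝ := ((k + 1 : ℕ) : ℝ) with hx
  have hx1 : 1 ≤ x := by simp [hx]
  have hx0 : 0 < x := by linarith
  have hN : (0 : ℝ) ≤ par.N i := Nat.cast_nonneg _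
  have hN' : (0 : ℝ) ≤ par.N' i := Nat.cast_nonneg _
  have e1 : par.gainRatio i (k + 1) ^ 2 =
      par.γ i ^ 2 / par.γ' i ^ 2 * ((par.N' i + x) ^ (1 / 2 : ℝ) / (par.N i + x) ^ 2) := by
    have h4 : (par.N' i + x) ^ (1 / 2 : ℝ) = ((par.N' i + x) ^ (1 / 4 : ℝ)) ^ 2 := by
      rw [← Real.rpow_natCast, ← Real.rpow_mul (by positivity)]
      norm_num
    rw [gainRatio, stepSize, pertGain, ← hx, h4]
    have : 0 < (par.N' i + x) ^ (1 / 4 : ℝ) := by positivity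
    field_simp
  have h2 : (par.N' i + x) ^ (1 / 2 : ℝ) ≤ (par.N' i + 1 : ℝ) ^ (1 / 2 : ℝ) * x ^ (1 / 2 : ℝ) := by
    rw [← Real.mul_rpow (by positivity) hx0.le]
    exact Real.rpow_le_rpow (by positivity) (by nlinarith) (by norm_num)
  have h3 : x ^ 2 ≤ (par.N i + x) ^ 2 := pow_le_pow_left₀ hx0.le (by linarith) 2
  have h5 : x ^ (1 / 2 : ℝ) / x ^ 2 = 1 / x ^ (3 / 2 : ℝ) := by
    rw [div_eq_div_iff (by positivity) (by positivity), one_mul, ← Real.rpow_add hx0]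
    norm_num
  rw [e1, mul_assoc, ← h5]
  refine mul_le_mul_of_nonneg_left ?_ (by positivity)
  rw [← mul_div_assoc]
  exact div_le_div₀ (by positivity) h2 (by positivity) h3

lemma tsum_gainRatio_sq_ne_top (hγ' : 0 < par.γ' i) :
    ∑' k, ENNReal.ofReal (par.gainRatio i (k + 1) ^ 2) ≠ ⊤ :=
  (par.summable_gainRatio_sq i hγ').tsum_ofReal_ne_top

lemma tsum_stepSize_sq_ne_top (hγ' : 0 < par.γ' i) :
    ∑' k, ENNReal.ofReal (par.stepSize i (k + 1) ^ 2) ≠ ⊤ := by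
  have hs := (par.summable_gainRatio_sq i hγ').mul_right (par.γ' i ^ 2)
  refine (Summable.of_nonneg_of_le (fun k => sq_nonneg _) (fun k => ?_) hs).tsum_ofReal_ne_top
  have hc := par.pertGain_pos i hγ' (k := k + 1) (by omega)
  have hc' := par.pertGain_le i hγ' (k := k + 1) (by omega)
  have e : par.stepSize i (k + 1) = par.gainRatio i (k + 1) * par.pertGain i (k + 1) := by
    rw [gainRatio, div_mul_cancel₀ _ hc.ne']
  rw [e, mul_pow]
  gcongr

end Gains

/-! ### The direction series along a fixed state and noise path -/

section Direction

variable (par : MSPSAParams K n) (S : JumpAffineSystem K m n) {C : Set (EuclideanSpace ℝ (Fin n))}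
  (ystar : EuclideanSpace ℝ (Fin m)) (s : ℕ → Fin K) (w : ℕ → EuclideanSpace ℝ (Fin m))

/-- Counters and flags are driven by the state path alone. For a frozen path the index in use is
therefore deterministic and can be read off from the run with zero perturbations. -/
lemma memory_counters_congr (C : Set (EuclideanSpace ℝ (Fin n)))
    (w' : ℕ → EuclideanSpace ℝ (Fin m)) (δ δ' : Fin K → ℕ → EuclideanSpace ℝ (Fin n)) (i : Fin K)
    (t : ℕ) :
    (par.memory S C ystar s w δ t).cnt i = (par.memory S C ystar s w' δ' t).cnt i ∧
    (par.memory S C ystar s w δ t).flag i = (par.memory S C ystar s w' δ' t).flag i := by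
  induction t with
  | zero => exact ⟨rfl, rfl⟩
  | succ t ih =>
    obtain ⟨ih1, ih2⟩ := ih
    by_cases h : s t = i
    · cases hf : (par.memory S C ystar s w δ t).flag i
      · obtain ⟨-, h1, h2, -⟩ := par.memory_succ_of_flag_false S C ystar w δ h hf
        obtain ⟨-, h1', h2', -⟩ := par.memory_succ_of_flag_false S C ystar w' δ' h (ih2 ▸ hf)
        rw [h1, h2, h1', h2', ih1]
        exact ⟨rfl, rfl⟩
      · obtain ⟨-, h1, h2, -⟩ := par.memory_succ_of_flag_true S C ystar w δ h hf
        obtain ⟨-, h1', h2', -⟩ := par.memory_succ_of_flag_true S C ystar w' δ' h (ih2 ▸ hf)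
        rw [h1, h2, h1', h2', ih1]
        exact ⟨rfl, rfl⟩
    · obtain ⟨-, h1, h2, -⟩ := par.memory_succ_of_ne S C ystar w δ h
      obtain ⟨-, h1', h2', -⟩ := par.memory_succ_of_ne S C ystar w' δ' h
      rw [h1, h2, h1', h2']
      exact ⟨ih1, ih2⟩

lemma updates_mono (C : Set (EuclideanSpace ℝ (Fin n)))
    (δ : Fin K → ℕ → EuclideanSpace ℝ (Fin n)) (i : Fin K) :
    Monotone fun t => updates (par.memory S C ystar s w δ t) i := by
  refine monotone_nat_of_le_succ fun t => ?_
  by_cases h : s t = i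
  · cases hft : (par.memory S C ystar s w δ t).flag i
    · obtain ⟨-, h1, h2, -⟩ := par.memory_succ_of_flag_false S C ystar w δ h hft
      simp [updates, h1, h2, hft]
    · obtain ⟨-, h1, h2, -⟩ := par.memory_succ_of_flag_true S C ystar w δ h hft
      simp [updates, h1, h2, hft]
  · obtain ⟨-, h1, h2, -⟩ := par.memory_succ_of_ne S C ystar w δ h
    simp [updates, h1, h2]

lemma measurable_loss_add_smul {Ω : Type*} [MeasurableSpace Ω] (j : Fin K)
    (u : EuclideanSpace ℝ (Fin m)) (c : ℝ) {v D : Ω → EuclideanSpace ℝ (Fin n)}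
    (hv : Measurable v) (hD : Measurable D) :
    Measurable fun ω => ‖S.output j (v ω + c • D ω) u - ystar‖ ^ 2 := by
  have h : Measurable fun ω => v ω + c • D ω := by fun_prop
  have h2 := S.measurable_output.comp ((measurable_const (a := (j, u))).prodMk h)
  exact (h2.sub_const ystar).norm.pow_const 2

lemma measurable_update {Ω : Type*} [MeasurableSpace Ω] (hC : IsCompact C) (hconv : Convex ℝ C)
    (hne : C.Nonempty) (j : Fin K) (u : EuclideanSpace ℝ (Fin m)) (a c : ℝ)
    {v D : Ω → EuclideanSpace ℝ (Fin n)} {d : Ω → ℝ}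
    (hv : Measurable v) (hD : Measurable D) (hd : Measurable d) :
    Measurable fun ω => euclideanProj C (v ω - (a * ((d ω -
      ‖S.output j (v ω - c • D ω) u - ystar‖ ^ 2) / c)) • coordInv (D ω)) := by
  have h := measurable_loss_add_smul S ystar j u (-c) hv hD
  simp only [neg_smul, ← sub_eq_add_neg] at h
  have hinv := measurable_coordInv.comp hD
  exact (continuous_euclideanProj hC hconv hne).measurable.comp
    (hv.sub ((((hd.sub h).div_const c).const_mul a).smul hinv))

/-- For a fixed path, the estimate depends only on the perturbations of completed updates. -/
lemma measurable_est_pertHistory {Ω : Type*} (hC : IsCompact C) (hconv : Convex ℝ C)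
    (hne : C.Nonempty) (Δ : Fin K → ℕ → Ω → EuclideanSpace ℝ (Fin n)) (i : Fin K) (t : ℕ) :
    (Measurable[ArePerturbations.pertHistory Δ i (updates (par.memory S C ystar s w 0 t) i)]
      fun ω => (par.memory S C ystar s w (fun i k => Δ i k ω) t).est i) ∧
    (Measurable[ArePerturbations.pertHistory Δ i ((par.memory S C ystar s w 0 t).cnt i)]
      fun ω => (par.memory S C ystar s w (fun i k => Δ i k ω) t).dplus i) := by
  induction t with
  | zero => exact ⟨measurable_const, measurable_const⟩
  | succ t ih =>
    obtain ⟨hv, hd⟩ := ih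
    have hcong := fun ω => par.memory_counters_congr S ystar s w C w (fun i k => Δ i k ω) 0 i t
    by_cases h : s t = i
    · cases hf : (par.memory S C ystar s w 0 t).flag i
      · obtain ⟨-, h1, h2, -⟩ := par.memory_succ_of_flag_false S C ystar w 0 h hf
        have hstep := fun ω => par.memory_succ_of_flag_false S C ystar w (fun i k => Δ i k ω) h
          ((hcong ω).2.trans hf)
        have hu : updates (par.memory S C ystar s w 0 (t + 1)) i =
            updates (par.memory S C ystar s w 0 t) i := by simp [updates, h1, h2, hf]
        have hu' : updates (par.memory S C ystar s w 0 t) i ≤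
            (par.memory S C ystar s w 0 t).cnt i + 1 := by simp [updates, hf]
        rw [hu, h1, funext fun ω => (hstep ω).1]
        -- The stored loss of an open pair already involves the perturbation of that pair, which is
        -- why its σ-algebra is indexed by `cnt` and not by `updates`.
        refine ⟨hv, ?_⟩
        have e : (fun ω => (par.memory S C ystar s w (fun i k => Δ i k ω) (t + 1)).dplus i) =
            fun ω => ‖S.output (s (t + 1)) ((par.memory S C ystar s w (fun i k => Δ i k ω) t).est i +
              par.pertGain i ((par.memory S C ystar s w 0 t).cnt i + 1) •
                Δ i ((par.memory S C ystar s w 0 t).cnt i + 1) ω) (w (t + 1)) - ystar‖ ^ 2 := by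
          funext ω
          rw [(hstep ω).2.2.2, obsLoss, inputOf, (hcong ω).2, hf, (hcong ω).1]
          simp
        rw [e]
        exact @measurable_loss_add_smul K m n S ystar Ω (ArePerturbations.pertHistory Δ i _) _ _ _ _ _
          (hv.mono (ArePerturbations.pertHistory_mono Δ i hu') le_rfl)
          (ArePerturbations.measurable_pertHistory Δ i le_rfl)
      · obtain ⟨-, h1, h2, -⟩ := par.memory_succ_of_flag_true S C ystar w 0 h hf
        have hstep := fun ω => par.memory_succ_of_flag_true S C ystar w (fun i k => Δ i k ω) h
          ((hcong ω).2.trans hf)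
        have hu : updates (par.memory S C ystar s w 0 (t + 1)) i =
            (par.memory S C ystar s w 0 t).cnt i := by simp [updates, h1, h2]
        have hu' : updates (par.memory S C ystar s w 0 t) i ≤
            (par.memory S C ystar s w 0 t).cnt i := by simp [updates, hf]
        rw [hu, h1, funext fun ω => (hstep ω).2.2.2]
        refine ⟨?_, hd⟩
        have e : (fun ω => (par.memory S C ystar s w (fun i k => Δ i k ω) (t + 1)).est i) =
            fun ω => euclideanProj C ((par.memory S C ystar s w (fun i k => Δ i k ω) t).est i -
              (par.stepSize i ((par.memory S C ystar s w 0 t).cnt i) *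
                (((par.memory S C ystar s w (fun i k => Δ i k ω) t).dplus i -
                ‖S.output (s (t + 1)) ((par.memory S C ystar s w (fun i k => Δ i k ω) t).est i -
                  par.pertGain i ((par.memory S C ystar s w 0 t).cnt i) •
                  Δ i ((par.memory S C ystar s w 0 t).cnt i) ω) (w (t + 1)) - ystar‖ ^ 2) /
                par.pertGain i ((par.memory S C ystar s w 0 t).cnt i))) •
                coordInv (Δ i ((par.memory S C ystar s w 0 t).cnt i) ω)) := by
          funext ω
          rw [(hstep ω).1, obsLoss, inputOf, (hcong ω).2, hf, (hcong ω).1]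
          simp
        rw [e]
        exact @measurable_update K m n S C ystar Ω (ArePerturbations.pertHistory Δ i _) hC hconv hne
          _ _ _ _ _ _ _ (hv.mono (ArePerturbations.pertHistory_mono Δ i hu') le_rfl)
          (ArePerturbations.measurable_pertHistory Δ i le_rfl) hd
    · obtain ⟨-, h1, h2, -⟩ := par.memory_succ_of_ne S C ystar w 0 h
      have hstep := fun ω => par.memory_succ_of_ne S C ystar w (fun i k => Δ i k ω) h
      have hu : updates (par.memory S C ystar s w 0 (t + 1)) i =
          updates (par.memory S C ystar s w 0 t) i := by simp [updates, h1, h2]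
      rw [hu, h1, funext fun ω => (hstep ω).1, funext fun ω => (hstep ω).2.2.2]
      exact ⟨hv, hd⟩

lemma exists_bound_curvature (hC : IsCompact C) (i : Fin K) :
    ∃ D, ∀ v ∈ C, ‖v - S.optInput ystar i‖ ≤ D ∧ ‖S.curvature i (v - S.optInput ystar i)‖ ≤ D := by
  have hc : Continuous (S.curvature i) := LinearMap.continuous_of_finiteDimensional _
  obtain ⟨D₁, h₁⟩ := hC.exists_bound_of_continuousOn (f := fun v => v - S.optInput ystar i)
    (by fun_prop)
  obtain ⟨D₂, h₂⟩ := hC.exists_bound_of_continuousOn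
    (f := fun v => S.curvature i (v - S.optInput ystar i)) (by fun_prop)
  exact ⟨max D₁ D₂, fun v hv => ⟨(h₁ v hv).trans (le_max_left _ _),
    (h₂ v hv).trans (le_max_right _ _)⟩⟩

variable {Ω : Type*} [MeasurableSpace Ω] {μ : Measure Ω} [IsProbabilityMeasure μ]
  {sr : ℕ → Ω → Fin K} {wr : ℕ → Ω → EuclideanSpace ℝ (Fin m)}
  {Δ : Fin K → ℕ → Ω → EuclideanSpace ℝ (Fin n)} {ν : Measure ℝ} {ξ₁ ξ₂ : ℝ}

/-- The vectors `z`, `g` and the perturbation are bounded, so after `(xy - r)² ≤ 2x²y² + 2r²` the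
only unbounded factor is `‖Δ⁻¹‖²`, whose mean is controlled by `ξ₂`. -/
lemma lintegral_direction_sq_le (hν : IsPerturbationLaw ν ξ₁ ξ₂)
    (hΔ : ArePerturbations μ ν sr wr Δ) (i : Fin K) (k : ℕ) (a D : ℝ)
    {z g : Ω → EuclideanSpace ℝ (Fin n)} (hz : ∀ ω, ‖z ω‖ ≤ D) (hg : ∀ ω, ‖g ω‖ ≤ D) :
    ∫⁻ ω, ENNReal.ofReal ((a * (inner ℝ (z ω) (coordInv (Δ i k ω)) * inner ℝ (Δ i k ω) (g ω) -
      inner ℝ (z ω) (g ω))) ^ 2) ∂μ ≤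
    ENNReal.ofReal (a ^ 2) * (ENNReal.ofReal (2 * D ^ 4 * (n * ξ₁ ^ 2)) *
      (n * ENNReal.ofReal ξ₂) + ENNReal.ofReal (2 * D ^ 4)) := by
  have hm : Measurable fun ω => ENNReal.ofReal (‖coordInv (Δ i k ω)‖ ^ 2) :=
    ((measurable_coordInv.comp (hΔ.measurable i k)).norm.pow_const 2).ennreal_ofReal
  calc _ ≤ ∫⁻ ω, ENNReal.ofReal (a ^ 2) * (ENNReal.ofReal (2 * D ^ 4 * (n * ξ₁ ^ 2)) *
        ENNReal.ofReal (‖coordInv (Δ i k ω)‖ ^ 2) + ENNReal.ofReal (2 * D ^ 4)) ∂μ := by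
        refine lintegral_mono_ae ?_
        filter_upwards [hΔ.ae_norm_sq_le hν] with ω hω
        rw [← ENNReal.ofReal_mul (by positivity), ← ENNReal.ofReal_add (by positivity)
          (by positivity), ← ENNReal.ofReal_mul (by positivity)]
        refine ENNReal.ofReal_le_ofReal ?_
        rw [mul_pow]
        refine mul_le_mul_of_nonneg_left ?_ (sq_nonneg a)
        set x := inner ℝ (z ω) (coordInv (Δ i k ω)) with hx
        set y := inner ℝ (Δ i k ω) (g ω) with hy
        set r := inner ℝ (z ω) (g ω) with hr
        have hz2 : ‖z ω‖ ^ 2 ≤ D ^ 2 := pow_le_pow_left₀ (norm_nonneg _) (hz ω) 2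
        have hg2 : ‖g ω‖ ^ 2 ≤ D ^ 2 := pow_le_pow_left₀ (norm_nonneg _) (hg ω) 2
        have hx2 : x ^ 2 ≤ D ^ 2 * ‖coordInv (Δ i k ω)‖ ^ 2 := by
          have := pow_le_pow_left₀ (abs_nonneg _) (abs_real_inner_le_norm (z ω)
            (coordInv (Δ i k ω))) 2
          rw [sq_abs, mul_pow] at this
          exact this.trans (mul_le_mul_of_nonneg_right hz2 (sq_nonneg _))
        have hy2 : y ^ 2 ≤ n * ξ₁ ^ 2 * D ^ 2 := by
          have := pow_le_pow_left₀ (abs_nonneg _) (abs_real_inner_le_norm (Δ i k ω) (g ω)) 2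
          rw [sq_abs, mul_pow] at this
          exact this.trans (mul_le_mul (hω i k) hg2 (sq_nonneg _) (by positivity))
        have hr2 : r ^ 2 ≤ D ^ 2 * D ^ 2 := by
          have := pow_le_pow_left₀ (abs_nonneg _) (abs_real_inner_le_norm (z ω) (g ω)) 2
          rw [sq_abs, mul_pow] at this
          exact this.trans (mul_le_mul hz2 hg2 (sq_nonneg _) (by positivity))
        have hxy := mul_le_mul hx2 hy2 (sq_nonneg _) (by positivity)
        nlinarith [sq_nonneg (x * y + r)]
    _ = ENNReal.ofReal (a ^ 2) * (ENNReal.ofReal (2 * D ^ 4 * (n * ξ₁ ^ 2)) *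
        ∫⁻ ω, ENNReal.ofReal (‖coordInv (Δ i k ω)‖ ^ 2) ∂μ + ENNReal.ofReal (2 * D ^ 4)) := by
        rw [lintegral_const_mul _ ((hm.const_mul _).add_const _),
          lintegral_add_right _ measurable_const, lintegral_const_mul _ hm]
        simp
    _ ≤ _ := by
        gcongr
        exact hΔ.lintegral_norm_coordInv_sq_le hν i k

/-- Along any fixed state and noise path, the direction series converges for almost all
perturbations. -/
theorem ae_exists_tendsto_sum_directionIncr (hC : IsCompact C) (hconv : Convex ℝ C)
    (hinit : ∀ i, par.xinit i ∈ C) (hν : IsPerturbationLaw ν ξ₁ ξ₂)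
    (hΔ : ArePerturbations μ ν sr wr Δ) (i : Fin K) (hγ' : 0 < par.γ' i) :
    ∀ᵐ ω ∂μ, ∃ l, Tendsto (fun T => ∑ t ∈ Finset.range T,
      par.directionIncr S C ystar s w (fun i k => Δ i k ω) i t) atTop (𝓝 l) := by
  have hne : C.Nonempty := ⟨_, hinit i⟩
  obtain ⟨D, hD⟩ := exists_bound_curvature S ystar hC i
  have hcurv : Measurable (S.curvature i) :=
    (LinearMap.continuous_of_finiteDimensional _).measurable
  have hcong := fun ω t => par.memory_counters_congr S ystar s w C w (fun i k => Δ i k ω) 0 i t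
  have hest := fun ω t => par.est_mem S C ystar s w (fun i k => Δ i k ω) i t hC hinit
  have hmeas := fun t => (par.measurable_est_pertHistory S ystar s w hC hconv hne Δ i t).1
  have hle := fun k => ArePerturbations.pertHistory_le_of_measurable Δ i k
    fun j _ => hΔ.measurable i j
  set v := fun ω t => (par.memory S C ystar s w (fun i k => Δ i k ω) t).est i with hv
  set M := fun t => par.memory S C ystar s w 0 t with hM
  -- Time `t` sees the perturbations up to the number of updates completed by then. This number is
  -- deterministic because the path is frozen.
  let ℱ : Filtration ℕ ‹MeasurableSpace Ω› :=
    { seq := fun t => ArePerturbations.pertHistory Δ i (updates (M t) i)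
      mono' := fun _ _ h => ArePerturbations.pertHistory_mono Δ i
        (par.updates_mono S ystar s w C 0 i h)
      le' := fun t => hle _ }
  let φ : ℝ → EuclideanSpace ℝ (Fin n) × EuclideanSpace ℝ (Fin n) → ℝ := fun a p =>
    a * (inner ℝ (p.1 - S.optInput ystar i) (coordInv p.2) *
      inner ℝ p.2 (S.curvature i (p.1 - S.optInput ystar i)) -
      inner ℝ (p.1 - S.optInput ystar i) (S.curvature i (p.1 - S.optInput ystar i)))
  have hφ : ∀ a, Measurable (φ a) := by
    intro a
    have h1 : Measurable fun p : EuclideanSpace ℝ (Fin n) × EuclideanSpace ℝ (Fin n) =>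
      p.1 - S.optInput ystar i := by fun_prop
    have h2 := hcurv.comp h1
    have h3 : Measurable fun p : EuclideanSpace ℝ (Fin n) × EuclideanSpace ℝ (Fin n) =>
      coordInv p.2 := measurable_coordInv.comp measurable_snd
    exact (((h1.inner h3).mul (measurable_snd.inner h2)).sub (h1.inner h2)).const_mul a
  have hξ : ∀ t ω, par.directionIncr S C ystar s w (fun i k => Δ i k ω) i t =
      if s t = i ∧ (M t).flag i = true then
        φ (par.stepSize i ((M t).cnt i)) (v ω t, Δ i ((M t).cnt i) ω) else 0 := by
    intro t ω
    rw [directionIncr, (hcong ω t).1, (hcong ω t).2]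
  have hone : ∀ t, (M t).flag i = true → ∃ k, (M t).cnt i = k + 1 ∧ updates (M t) i = k := by
    intro t hf
    obtain ⟨k, hk⟩ := Nat.exists_eq_add_of_le' (par.one_le_cnt_of_flag S C ystar s w 0 i t hf)
    have hk2 : (M t).cnt i = k + 1 := hk
    exact ⟨k, hk2, by rw [updates, if_pos hf, hk2, Nat.add_sub_cancel]⟩
  have hupd : ∀ t, s t = i → (M t).flag i = true → updates (M (t + 1)) i = (M t).cnt i := by
    intro t h hf
    obtain ⟨-, h1, h2, -⟩ := par.memory_succ_of_flag_true S C ystar w 0 h hf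
    simp only [updates, hM, h1, h2, Bool.false_eq_true, if_false]
  refine ae_exists_tendsto_sum_of_martingale_differences (ℱ := ℱ)
    (ξ := fun t ω => par.directionIncr S C ystar s w (fun i k => Δ i k ω) i t) ?_ ?_ ?_
  · intro t
    rw [funext (hξ t)]
    by_cases h : s t = i ∧ (M t).flag i = true
    · simp only [h, and_self, if_true]
      have hu : updates (M t) i ≤ (M t).cnt i := by
        obtain ⟨k, hk, hk'⟩ := hone t h.2
        omega
      have h1 : Measurable[ArePerturbations.pertHistory Δ i ((M t).cnt i)] fun ω => v ω t :=
        (hmeas t).mono (ArePerturbations.pertHistory_mono Δ i hu) le_rfl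
      have h2 := (hφ (par.stepSize i ((M t).cnt i))).comp
        (h1.prodMk (ArePerturbations.measurable_pertHistory Δ i (le_refl ((M t).cnt i))))
      show Measurable[ArePerturbations.pertHistory Δ i (updates (M (t + 1)) i)] _
      rw [hupd t h.1 h.2]
      exact h2
    · simp only [h, if_false]
      exact measurable_const
  · intro t hint A hA
    rw [funext (hξ t)] at hint ⊢
    by_cases h : s t = i ∧ (M t).flag i = true
    · simp only [h, and_self, if_true] at hint ⊢
      -- The update following `k` completed ones uses perturbation `k + 1`, which is independent of
      -- those up to `k`.
      obtain ⟨k, hk, hk'⟩ := hone t h.2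
      rw [hk] at hint ⊢
      have hA' : MeasurableSet[ArePerturbations.pertHistory Δ i k] A := hk' ▸ hA
      have hmk : Measurable[ArePerturbations.pertHistory Δ i k] fun ω => v ω t := hk' ▸ hmeas t
      have hΔm := hΔ.measurable i (k + 1)
      have := Measure.isProbabilityMeasure_map (μ := μ) hΔm.aemeasurable
      refine setIntegral_comp_prodMk_eq_zero_of_indep (κ := μ.map (Δ i (k + 1))) (hle k) hΔm
        (hΔ.measure_pertHistory_inter i k) hmk (hφ (par.stepSize i (k + 1))) hint (fun u => ?_) hA'
      have hφu : Measurable fun y => φ (par.stepSize i (k + 1)) (u, y) :=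
        (hφ _).comp measurable_prodMk_left
      rw [integral_map hΔm.aemeasurable hφu.aestronglyMeasurable]
      simp only [φ]
      rw [integral_const_mul, integral_sub (hΔ.integrable_inner_coordInv_mul_inner hν i _ _ _)
        (integrable_const _), hΔ.integral_inner_coordInv_mul_inner hν]
      simp
    · simp [h]
  · set c := ENNReal.ofReal (2 * D ^ 4 * (n * ξ₁ ^ 2)) * (n * ENNReal.ofReal ξ₂) +
      ENNReal.ofReal (2 * D ^ 4) with hc
    have hctop : c ≠ ⊤ := ENNReal.add_ne_top.mpr ⟨ENNReal.mul_ne_top ENNReal.ofReal_ne_top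
      (ENNReal.mul_ne_top (ENNReal.natCast_ne_top _) ENNReal.ofReal_ne_top), ENNReal.ofReal_ne_top⟩
    have hbound : ∀ t, ∫⁻ ω, ENNReal.ofReal
        (par.directionIncr S C ystar s w (fun i k => Δ i k ω) i t ^ 2) ∂μ ≤
        if s t = i then (fun k => ENNReal.ofReal (par.stepSize i k ^ 2) * c)
          (pairIndex (M t) i) else 0 := by
      intro t
      simp_rw [hξ t]
      by_cases h : s t = i ∧ (M t).flag i = true
      · simp only [h, and_self, if_true, pairIndex]
        exact lintegral_direction_sq_le hν hΔ i _ _ D (fun ω => (hD _ (hest ω t)).1)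
          fun ω => (hD _ (hest ω t)).2
      · simp [h]
    -- Summation over time becomes summation over perturbation indices, each counted at most twice,
    -- and reduces to `∑ a_k² < ∞`.
    refine ne_top_of_le_ne_top ?_ ((ENNReal.tsum_le_tsum hbound).trans
      (ENNReal.tsum_le_of_sum_range_le fun T => par.sum_observations_le S C ystar s w 0 i
        (fun k => ENNReal.ofReal (par.stepSize i k ^ 2) * c) T))
    rw [ENNReal.tsum_mul_right]
    exact ENNReal.mul_ne_top (by norm_num)
      (ENNReal.mul_ne_top (par.tsum_stepSize_sq_ne_top i hγ') hctop)

end Direction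

end MSPSAParams

/-! ### Moments of the observed loss -/

namespace JumpAffineSystem

variable {K m n : ℕ} {S : JumpAffineSystem K m n}

lemma IsAdmissible.continuous_stageCost (hS : S.IsAdmissible) (ystar : EuclideanSpace ℝ (Fin m))
    (i : Fin K) : Continuous (S.stageCost ystar i) := by
  have h : ∀ j, Continuous (S.A j).toEuclideanLin := fun j =>
    LinearMap.continuous_of_finiteDimensional _
  rw [funext (hS.stageCost_eq ystar i)]
  exact continuous_finsetSum _ fun j _ => by have := h j; fun_prop

lemma measurable_loss (S : JumpAffineSystem K m n) (ystar : EuclideanSpace ℝ (Fin m)) :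
    Measurable fun p : (Fin K × EuclideanSpace ℝ (Fin m)) × EuclideanSpace ℝ (Fin n) =>
      ‖S.output p.1.1 p.2 p.1.2 - ystar‖ ^ 2 :=
  (S.measurable_output.sub_const ystar).norm.pow_const 2

lemma IsAdmissible.integrable_loss (hS : S.IsAdmissible) (ystar : EuclideanSpace ℝ (Fin m))
    (j : Fin K) (x : EuclideanSpace ℝ (Fin n)) :
    Integrable (fun u => ‖S.output j x u - ystar‖ ^ 2) (S.f j) := by
  have := hS.isProb j
  have h2 : MemLp (fun u : EuclideanSpace ℝ (Fin m) => u) 2 (S.f j) :=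
    (hS.fourth_moment j).mono_exponent (by norm_num)
  have h3 : MemLp (fun u => S.output j x u - ystar) 2 (S.f j) :=
    ((memLp_const ((S.A j).toEuclideanLin x + S.b j)).add h2).sub (memLp_const ystar)
  exact h3.integrable_norm_pow (by norm_num)

/-- The stage cost is the conditional mean of the observed loss; this makes the observation error a
martingale difference. -/
lemma IsAdmissible.integral_loss_sub_stageCost (hS : S.IsAdmissible)
    (ystar : EuclideanSpace ℝ (Fin m)) (i : Fin K) (x : EuclideanSpace ℝ (Fin n)) :
    ∫ y, (‖S.output y.1 x y.2 - ystar‖ ^ 2 - S.stageCost ystar i x) ∂(S.stepLaw i) = 0 := by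
  have hprob := hS.isProb
  have hp := Matrix.mem_rowStochastic_iff_sum.mp hS.stochastic
  have hm : Measurable fun y : Fin K × EuclideanSpace ℝ (Fin m) =>
      ‖S.output y.1 x y.2 - ystar‖ ^ 2 - S.stageCost ystar i x :=
    ((S.measurable_loss ystar).comp measurable_prodMk_right).sub_const _
  rw [hS.integral_stepLaw i hm fun j => (hS.integrable_loss ystar j x).sub (integrable_const _)]
  have e : ∀ j, ∫ u, (‖S.output j x u - ystar‖ ^ 2 - S.stageCost ystar i x) ∂(S.f j) =
      ∫ u, ‖ystar - S.output j x u‖ ^ 2 ∂(S.f j) - S.stageCost ystar i x := by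
    intro j
    rw [integral_sub (hS.integrable_loss ystar j x) (integrable_const _)]
    simp [norm_sub_rev]
  simp_rw [e, mul_sub]
  rw [Finset.sum_sub_distrib, ← Finset.sum_mul, hp.2 i, one_mul]
  exact sub_self _

/-- The squared loss is a fourth power of an affine function of the noise; here the fourth moments
are used in full. The constants come from `(B + r)⁴ ≤ (2B² + 2r²)² ≤ 8B⁴ + 8r⁴`. -/
lemma IsAdmissible.exists_lintegral_loss_sq_le (hS : S.IsAdmissible)
    (ystar : EuclideanSpace ℝ (Fin m)) (i : Fin K) (R : ℝ) :
    ∃ c : ENNReal, c ≠ ⊤ ∧ ∀ x : EuclideanSpace ℝ (Fin n), ‖x‖ ≤ R →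
      ∫⁻ y, ENNReal.ofReal ((‖S.output y.1 x y.2 - ystar‖ ^ 2) ^ 2) ∂(S.stepLaw i) ≤ c := by
  have hprob := hS.isProb
  have hB : ∀ j, ∃ B, ∀ x ∈ Metric.closedBall (0 : EuclideanSpace ℝ (Fin n)) R,
      ‖(S.A j).toEuclideanLin x + S.b j - ystar‖ ≤ B := fun j => by
    have h : Continuous (S.A j).toEuclideanLin := LinearMap.continuous_of_finiteDimensional _
    exact (isCompact_closedBall _ _).exists_bound_of_continuousOn (by fun_prop)
  choose B hB using hB
  have hint : ∀ j, Integrable (fun u : EuclideanSpace ℝ (Fin m) => 8 * B j ^ 4 + 8 * ‖u‖ ^ 4)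
      (S.f j) := fun j =>
    (integrable_const _).add (((hS.fourth_moment j).integrable_norm_pow (p := 4)
      (by norm_num)).const_mul 8)
  refine ⟨∑ j, ENNReal.ofReal (S.P i j) *
    ∫⁻ u, ENNReal.ofReal (8 * B j ^ 4 + 8 * ‖u‖ ^ 4) ∂(S.f j), ?_, fun x hx => ?_⟩
  · exact ENNReal.sum_ne_top.mpr fun j _ => ENNReal.mul_ne_top ENNReal.ofReal_ne_top
      (hint j).lintegral_lt_top.ne
  · have hm : Measurable fun y : Fin K × EuclideanSpace ℝ (Fin m) =>
        ENNReal.ofReal ((‖S.output y.1 x y.2 - ystar‖ ^ 2) ^ 2) :=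
      (((S.measurable_loss ystar).comp measurable_prodMk_right).pow_const 2).ennreal_ofReal
    rw [S.lintegral_stepLaw i hm]
    refine Finset.sum_le_sum fun j _ => mul_le_mul_right (lintegral_mono fun u => ?_) _
    refine ENNReal.ofReal_le_ofReal ?_
    have h1 : ‖S.output j x u - ystar‖ ≤ B j + ‖u‖ := by
      have e : S.output j x u - ystar = ((S.A j).toEuclideanLin x + S.b j - ystar) + u := by
        simp only [output]; abel
      rw [e]
      exact (norm_add_le _ _).trans (by gcongr; exact hB j x (by simpa using hx))
    have hB0 : 0 ≤ B j := (norm_nonneg _).trans (hB j x (by simpa using hx))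
    have h2 : (‖S.output j x u - ystar‖ ^ 2) ≤ 2 * B j ^ 2 + 2 * ‖u‖ ^ 2 := by
      have := pow_le_pow_left₀ (norm_nonneg _) h1 2
      nlinarith [sq_nonneg (B j - ‖u‖)]
    have h3 := pow_le_pow_left₀ (sq_nonneg _) h2 2
    nlinarith [sq_nonneg (B j ^ 2 - ‖u‖ ^ 2)]

lemma IsAdmissible.exists_lintegral_loss_sub_sq_le (hS : S.IsAdmissible)
    (ystar : EuclideanSpace ℝ (Fin m)) (i : Fin K) (R : ℝ) :
    ∃ c : ENNReal, c ≠ ⊤ ∧ ∀ x : EuclideanSpace ℝ (Fin n), ‖x‖ ≤ R →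
      ∫⁻ y, ENNReal.ofReal ((‖S.output y.1 x y.2 - ystar‖ ^ 2 - S.stageCost ystar i x) ^ 2)
        ∂(S.stepLaw i) ≤ c := by
  have hprob := hS.isProbabilityMeasure_stepLaw i
  obtain ⟨c, hc, hbound⟩ := hS.exists_lintegral_loss_sq_le ystar i R
  obtain ⟨B, hB⟩ := (isCompact_closedBall (0 : EuclideanSpace ℝ (Fin n)) R
    ).exists_bound_of_continuousOn (hS.continuous_stageCost ystar i).continuousOn
  refine ⟨2 * c + ENNReal.ofReal (2 * B ^ 2), ENNReal.add_ne_top.mpr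
    ⟨ENNReal.mul_ne_top (by norm_num) hc, ENNReal.ofReal_ne_top⟩, fun x hx => ?_⟩
  have hm : Measurable fun y : Fin K × EuclideanSpace ℝ (Fin m) =>
      ENNReal.ofReal ((‖S.output y.1 x y.2 - ystar‖ ^ 2) ^ 2) :=
    (((S.measurable_loss ystar).comp measurable_prodMk_right).pow_const 2).ennreal_ofReal
  calc _ ≤ ∫⁻ y, (2 * ENNReal.ofReal ((‖S.output y.1 x y.2 - ystar‖ ^ 2) ^ 2) +
        ENNReal.ofReal (2 * B ^ 2)) ∂(S.stepLaw i) := by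
        refine lintegral_mono fun y => ?_
        have h2 : 2 * ENNReal.ofReal ((‖S.output y.1 x y.2 - ystar‖ ^ 2) ^ 2) =
            ENNReal.ofReal (2 * (‖S.output y.1 x y.2 - ystar‖ ^ 2) ^ 2) := by
          rw [ENNReal.ofReal_mul (by norm_num), ENNReal.ofReal_ofNat]
        rw [h2, ← ENNReal.ofReal_add (by positivity) (by positivity)]
        refine ENNReal.ofReal_le_ofReal ?_
        have h1 : S.stageCost ystar i x ^ 2 ≤ B ^ 2 := by
          rw [← sq_abs]
          exact pow_le_pow_left₀ (abs_nonneg _) (hB x (by simpa using hx)) 2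
        nlinarith [sq_nonneg (‖S.output y.1 x y.2 - ystar‖ ^ 2 + S.stageCost ystar i x)]
    _ = 2 * ∫⁻ y, ENNReal.ofReal ((‖S.output y.1 x y.2 - ystar‖ ^ 2) ^ 2) ∂(S.stepLaw i) +
        ENNReal.ofReal (2 * B ^ 2) := by
        rw [lintegral_add_right _ measurable_const, lintegral_const_mul _ hm]
        simp
    _ ≤ _ := by
        gcongr
        exact hbound x hx

end JumpAffineSystem

namespace MSPSAParams

variable {K m n : ℕ}

/-! ### Measurability of the increments -/

section Measurability

variable {Ω : Type*} [MeasurableSpace Ω] (par : MSPSAParams K n) {S : JumpAffineSystem K m n}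
  {C : Set (EuclideanSpace ℝ (Fin n))} {ystar : EuclideanSpace ℝ (Fin m)} {s : ℕ → Ω → Fin K}
  {w : ℕ → Ω → EuclideanSpace ℝ (Fin m)} {Δ : Fin K → ℕ → Ω → EuclideanSpace ℝ (Fin n)}

/-- The policy's input, the noise coefficient and the squared step coefficient at stage `T + 1`
are measurable in the history up to `T`. -/
lemma measurable_policy (hC : IsCompact C) (hconv : Convex ℝ C) (hne : C.Nonempty) (T : ℕ)
    (hs : ∀ t ≤ T, Measurable (s t)) (hw : ∀ t < T, Measurable (w (t + 1)))
    (hΔ : ∀ i k, Measurable (Δ i k)) (i : Fin K) :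
    (Measurable fun ω => par.inputOf (fun i k => Δ i k ω) (par.memory S C ystar (fun t => s t ω)
      (fun t => w t ω) (fun i k => Δ i k ω) T) i) ∧
    (Measurable fun ω => par.noiseCoeff S C ystar (fun t => s t ω) (fun t => w t ω)
      (fun i k => Δ i k ω) i T) ∧
    (Measurable fun ω => par.gainRatio i (pairIndex (par.memory S C ystar (fun t => s t ω)
      (fun t => w t ω) (fun i k => Δ i k ω) T) i) ^ 2 * ‖coordInv (Δ i (pairIndex
      (par.memory S C ystar (fun t => s t ω) (fun t => w t ω) (fun i k => Δ i k ω) T) i) ω)‖ ^ 2)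
    := by
  obtain ⟨hest, hcnt, hflag, -⟩ := par.measurable_memory S ystar hC hconv hne T hs hw hΔ i
  have hfl := hflag (measurableSet_singleton true)
  have hk : Measurable fun ω => pairIndex (par.memory S C ystar (fun t => s t ω)
      (fun t => w t ω) (fun i k => Δ i k ω) T) i :=
    Measurable.ite hfl hcnt (hcnt.add_const 1)
  have hgain := (measurable_from_top (f := par.gainRatio i)).comp hk
  have hinv := measurable_coordInv.comp (Measurable.apply_countable (hΔ i) hk)
  refine ⟨par.measurable_inputOf (hΔ i) hest hcnt hflag, ?_, ?_⟩
  · exact ((Measurable.ite hfl measurable_const measurable_const).mul hgain).mul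
      ((hest.sub_const _).inner hinv)
  · exact (hgain.pow_const 2).mul (hinv.norm.pow_const 2)

lemma measurable_directionIncr (hC : IsCompact C) (hconv : Convex ℝ C) (hne : C.Nonempty) (T : ℕ)
    (hs : ∀ t ≤ T, Measurable (s t)) (hw : ∀ t < T, Measurable (w (t + 1)))
    (hΔ : ∀ i k, Measurable (Δ i k)) (i : Fin K) :
    Measurable fun ω => par.directionIncr S C ystar (fun t => s t ω) (fun t => w t ω)
      (fun i k => Δ i k ω) i T := by
  obtain ⟨hest, hcnt, hflag, -⟩ := par.measurable_memory S ystar hC hconv hne T hs hw hΔ i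
  have hset := (hs T le_rfl (measurableSet_singleton i)).inter
    (hflag (measurableSet_singleton true))
  have hcurv : Measurable (S.curvature i) :=
    (LinearMap.continuous_of_finiteDimensional _).measurable
  have hstep := (measurable_from_top (f := par.stepSize i)).comp hcnt
  have hΔk := Measurable.apply_countable (hΔ i) hcnt
  have hz := hest.sub_const (S.optInput ystar i)
  have hg := hcurv.comp hz
  exact Measurable.ite hset (hstep.mul (((hz.inner (measurable_coordInv.comp hΔk)).mul
    (hΔk.inner hg)).sub (hz.inner hg))) measurable_const

lemma measurable_noiseIncr (hS : S.IsAdmissible) (hC : IsCompact C) (hconv : Convex ℝ C)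
    (hne : C.Nonempty) (T : ℕ)
    (hs : ∀ t ≤ T + 1, Measurable (s t)) (hw : ∀ t < T + 1, Measurable (w (t + 1)))
    (hΔ : ∀ i k, Measurable (Δ i k)) (i : Fin K) :
    Measurable fun ω => par.noiseIncr S C ystar (fun t => s t ω) (fun t => w t ω)
      (fun i k => Δ i k ω) i T := by
  obtain ⟨hin, hcoef, -⟩ := par.measurable_policy (S := S) (ystar := ystar) hC hconv hne T
    (fun t ht => hs t (by omega)) (fun t ht => hw t (by omega)) hΔ i
  have hobs := par.measurable_obsLoss S ystar (hs (T + 1) le_rfl) (hw T (by omega)) hin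
  exact Measurable.ite (hs T (by omega) (measurableSet_singleton i)) (hcoef.mul
    (hobs.sub ((hS.continuous_stageCost ystar i).measurable.comp hin))) measurable_const

lemma measurable_squareIncr (hC : IsCompact C) (hconv : Convex ℝ C) (hne : C.Nonempty) (T : ℕ)
    (hs : ∀ t ≤ T + 1, Measurable (s t)) (hw : ∀ t < T + 1, Measurable (w (t + 1)))
    (hΔ : ∀ i k, Measurable (Δ i k)) (i : Fin K) :
    Measurable fun ω => par.squareIncr S C ystar (fun t => s t ω) (fun t => w t ω)
      (fun i k => Δ i k ω) i T := by
  obtain ⟨hin, -, hcoef⟩ := par.measurable_policy (S := S) (ystar := ystar) hC hconv hne T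
    (fun t ht => hs t (by omega)) (fun t ht => hw t (by omega)) hΔ i
  have hobs := par.measurable_obsLoss S ystar (hs (T + 1) le_rfl) (hw T (by omega)) hin
  exact Measurable.ite (hs T (by omega) (measurableSet_singleton i))
    (hcoef.mul (hobs.pow_const 2)) measurable_const

end Measurability

/-! ### The random series along the policy -/

section Series

variable (par : MSPSAParams K n) {S : JumpAffineSystem K m n} {C : Set (EuclideanSpace ℝ (Fin n))}
  {ystar : EuclideanSpace ℝ (Fin m)} {Ω : Type*} [MeasurableSpace Ω] {μ : Measure Ω}
  {s : ℕ → Ω → Fin K} {w : ℕ → Ω → EuclideanSpace ℝ (Fin m)}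
  {Δ : Fin K → ℕ → Ω → EuclideanSpace ℝ (Fin n)} {ν : Measure ℝ} {ξ₁ ξ₂ : ℝ}

/-- The policy's inputs are uniformly bounded almost surely. -/
lemma exists_ae_norm_inputOf_le (hC : IsCompact C) (hinit : ∀ i, par.xinit i ∈ C)
    (hν : IsPerturbationLaw ν ξ₁ ξ₂) (hΔ : ArePerturbations μ ν s w Δ) (i : Fin K)
    (hγ' : 0 < par.γ' i) :
    ∃ R, ∀ᵐ ω ∂μ, ∀ t, ‖par.inputOf (fun i k => Δ i k ω) (par.memory S C ystar (fun t => s t ω)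
      (fun t => w t ω) (fun i k => Δ i k ω) t) i‖ ≤ R := by
  obtain ⟨D, hD⟩ := hC.exists_bound_of_continuousOn (f := fun v => v) continuousOn_id
  refine ⟨D + par.γ' i * √(n * ξ₁ ^ 2), ?_⟩
  filter_upwards [hΔ.ae_norm_sq_le hν] with ω hω t
  have hest := hD _ (par.est_mem S C ystar (fun t => s t ω) (fun t => w t ω)
    (fun i k => Δ i k ω) i t hC hinit)
  have hpert : ∀ k, 1 ≤ k → ‖par.pertGain i k • Δ i k ω‖ ≤ par.γ' i * √(n * ξ₁ ^ 2) := by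
    intro k hk
    rw [norm_smul, Real.norm_eq_abs, abs_of_pos (par.pertGain_pos i hγ' hk)]
    exact mul_le_mul (par.pertGain_le i hγ' hk) (Real.le_sqrt_of_sq_le (hω i k)) (norm_nonneg _)
      hγ'.le
  rw [inputOf]
  split_ifs with hf
  · exact (norm_sub_le _ _).trans (add_le_add hest (hpert _ (par.one_le_cnt_of_flag S C ystar
      (fun t => s t ω) (fun t => w t ω) (fun i k => Δ i k ω) i t hf)))
  · exact (norm_add_le _ _).trans (add_le_add hest (hpert _ (by omega)))

/-- Weighted sums of functions of the observations with bounded conditional expectations have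
finite expectation. -/
lemma tsum_lintegral_weighted_ne_top [IsProbabilityMeasure μ] (hS : S.IsAdmissible) (hC : IsCompact C) (hconv : Convex ℝ C)
    (hinit : ∀ i, par.xinit i ∈ C) (hν : IsPerturbationLaw ν ξ₁ ξ₂)
    (hreal : S.IsRealization μ s w) (hΔ : ArePerturbations μ ν s w Δ) (i : Fin K)
    (hγ' : 0 < par.γ' i)
    {h : (Fin K × EuclideanSpace ℝ (Fin m)) × EuclideanSpace ℝ (Fin n) → ENNReal}
    (hh : Measurable h)
    (hbound : ∀ R, ∃ c : ENNReal, c ≠ ⊤ ∧ ∀ x : EuclideanSpace ℝ (Fin n), ‖x‖ ≤ R →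
      ∫⁻ y, h (y, x) ∂(S.stepLaw i) ≤ c) :
    ∑' t, ∫⁻ ω in s t ⁻¹' {i}, ENNReal.ofReal (par.gainRatio i (pairIndex (par.memory S C ystar
        (fun t => s t ω) (fun t => w t ω) (fun i k => Δ i k ω) t) i) ^ 2 *
        ‖coordInv (Δ i (pairIndex (par.memory S C ystar (fun t => s t ω) (fun t => w t ω)
        (fun i k => Δ i k ω) t) i) ω)‖ ^ 2) *
      h ((s (t + 1) ω, w (t + 1) ω), par.inputOf (fun i k => Δ i k ω) (par.memory S C ystar
        (fun t => s t ω) (fun t => w t ω) (fun i k => Δ i k ω) t) i) ∂μ ≠ ⊤ := by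
  have hne : C.Nonempty := ⟨_, hinit i⟩
  have hprob := hS.isProbabilityMeasure_stepLaw i
  obtain ⟨R, hR⟩ := par.exists_ae_norm_inputOf_le (S := S) (ystar := ystar) hC hinit hν hΔ i hγ'
  obtain ⟨c, hc, hcx⟩ := hbound R
  set k : ℕ → Ω → ℕ := fun t ω => pairIndex (par.memory S C ystar (fun t => s t ω)
    (fun t => w t ω) (fun i k => Δ i k ω) t) i with hk
  set x : ℕ → Ω → EuclideanSpace ℝ (Fin n) := fun t ω => par.inputOf (fun i k => Δ i k ω)
    (par.memory S C ystar (fun t => s t ω) (fun t => w t ω) (fun i k => Δ i k ω) t) i with hx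
  set q : ℕ → Ω → ℝ := fun t ω => par.gainRatio i (k t ω) ^ 2 *
    ‖coordInv (Δ i (k t ω) ω)‖ ^ 2 with hq
  have hvis : ∀ t, MeasurableSet (s t ⁻¹' {i}) := fun t =>
    hreal.measurable_state t (measurableSet_singleton i)
  have hqm : ∀ t, Measurable (q t) := fun t => (par.measurable_policy hC hconv hne t
    (fun t _ => hreal.measurable_state t) (fun t _ => hreal.measurable_noise (t + 1))
    hΔ.measurable i).2.2
  -- Given the history, the weight and the input are known, so integrating out the next state and
  -- noise costs at most the factor `c`.
  have hterm : ∀ t, ∫⁻ ω in s t ⁻¹' {i}, ENNReal.ofReal (q t ω) *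
      h ((s (t + 1) ω, w (t + 1) ω), x t ω) ∂μ ≤
      (∫⁻ ω, (if s t ω = i then ENNReal.ofReal (q t ω) else 0) ∂μ) * c := by
    intro t
    obtain ⟨hxm, -, hqm'⟩ := @measurable_policy K m n Ω (ArePerturbations.history s w Δ t) par S C
      ystar s w Δ hC hconv hne t (fun _ ht => ArePerturbations.measurable_state_history s w Δ t ht)
      (fun _ ht => ArePerturbations.measurable_noise_history s w Δ t ht)
      (ArePerturbations.measurable_perturbation_history s w Δ t) i
    have hf : Measurable fun p : (ℝ × EuclideanSpace ℝ (Fin n)) ×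
        (Fin K × EuclideanSpace ℝ (Fin m)) => ENNReal.ofReal p.1.1 * h (p.2, p.1.2) := by
      fun_prop
    have hY := (hreal.measurable_state (t + 1)).prodMk (hreal.measurable_noise (t + 1))
    have key := lintegral_comp_prodMk_of_indep (ρ := μ.restrict (s t ⁻¹' {i}))
      (κ := S.stepLaw i) (hΔ.history_le hreal t) hY
      (hΔ.restrict_history_inter_step hS hreal t i) (hqm'.prodMk hxm) hf
    refine key.trans_le ?_
    calc ∫⁻ ω in s t ⁻¹' {i}, ∫⁻ y, ENNReal.ofReal (q t ω) * h (y, x t ω) ∂(S.stepLaw i) ∂μ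
        ≤ ∫⁻ ω in s t ⁻¹' {i}, ENNReal.ofReal (q t ω) * c ∂μ := by
          refine lintegral_mono_ae (ae_restrict_of_ae ?_)
          filter_upwards [hR] with ω hω
          have hhx : Measurable fun y => h (y, x t ω) := hh.comp measurable_prodMk_right
          rw [lintegral_const_mul _ hhx]
          exact mul_le_mul_right (hcx _ (hω t)) _
      _ = _ := by
          rw [lintegral_mul_const _ (hqm t).ennreal_ofReal, ← lintegral_indicator (hvis t)]
          congr 1
          refine lintegral_congr fun ω => ?_
          by_cases hi : s t ω = i
          · rw [Set.indicator_of_mem (by exact hi), if_pos hi]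
          · rw [Set.indicator_of_notMem (by exact hi), if_neg hi]
  -- The weights still carry a random index. Pathwise their sum over time is at most twice a series
  -- over the fixed indices `k`, whose expectation is bounded by `∑ (a_k/c_k)² · n ξ₂`.
  refine ne_top_of_le_ne_top ?_ (ENNReal.tsum_le_tsum hterm)
  have hite : ∀ t, Measurable fun ω => if s t ω = i then ENNReal.ofReal (q t ω) else 0 :=
    fun t => Measurable.ite (hvis t) (hqm t).ennreal_ofReal measurable_const
  rw [ENNReal.tsum_mul_right, ← lintegral_tsum fun t => (hite t).aemeasurable]
  refine ENNReal.mul_ne_top (ne_top_of_le_ne_top ?_ (lintegral_mono fun ω =>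
    ENNReal.tsum_le_of_sum_range_le fun T => par.sum_observations_le S C ystar (fun t => s t ω)
      (fun t => w t ω) (fun i k => Δ i k ω) i
      (fun k => ENNReal.ofReal (par.gainRatio i k ^ 2 * ‖coordInv (Δ i k ω)‖ ^ 2)) T)) hc
  have hm : ∀ k, Measurable fun ω => ENNReal.ofReal (‖coordInv (Δ i k ω)‖ ^ 2) := fun k =>
    ((measurable_coordInv.comp (hΔ.measurable i k)).norm.pow_const 2).ennreal_ofReal
  simp_rw [ENNReal.ofReal_mul (sq_nonneg _)]
  rw [lintegral_const_mul _ (Measurable.tsum fun k => (hm _).const_mul _),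
    lintegral_tsum fun k => ((hm _).const_mul _).aemeasurable]
  refine ENNReal.mul_ne_top (by norm_num) (ne_top_of_le_ne_top ?_ (ENNReal.tsum_le_tsum fun k =>
    (lintegral_const_mul _ (hm (k + 1))).trans_le
      (mul_le_mul_right (hΔ.lintegral_norm_coordInv_sq_le hν i (k + 1)) _)))
  rw [ENNReal.tsum_mul_right]
  exact ENNReal.mul_ne_top (par.tsum_gainRatio_sq_ne_top i hγ')
    (ENNReal.mul_ne_top (ENNReal.natCast_ne_top _) ENNReal.ofReal_ne_top)

/-- The total sum has finite expectation, hence is finite almost surely. -/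
lemma ae_exists_sum_squareIncr_le [IsProbabilityMeasure μ] (hS : S.IsAdmissible) (hC : IsCompact C) (hconv : Convex ℝ C)
    (hinit : ∀ i, par.xinit i ∈ C) (hν : IsPerturbationLaw ν ξ₁ ξ₂)
    (hreal : S.IsRealization μ s w) (hΔ : ArePerturbations μ ν s w Δ) (i : Fin K)
    (hγ' : 0 < par.γ' i) :
    ∀ᵐ ω ∂μ, ∃ B, ∀ T, ∑ t ∈ Finset.range T, par.squareIncr S C ystar (fun t => s t ω)
      (fun t => w t ω) (fun i k => Δ i k ω) i t ≤ B := by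
  have hne : C.Nonempty := ⟨_, hinit i⟩
  have hnn : ∀ ω t, 0 ≤ par.squareIncr S C ystar (fun t => s t ω)
      (fun t => w t ω) (fun i k => Δ i k ω) i t := by
    intro ω t
    unfold squareIncr
    split_ifs <;> positivity
  have hm : ∀ t, Measurable fun ω => ENNReal.ofReal (par.squareIncr S C ystar (fun t => s t ω)
      (fun t => w t ω) (fun i k => Δ i k ω) i t) := fun t =>
    (par.measurable_squareIncr hC hconv hne t (fun t _ => hreal.measurable_state t)
      (fun t _ => hreal.measurable_noise (t + 1)) hΔ.measurable i).ennreal_ofReal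
  have htop := par.tsum_lintegral_weighted_ne_top (ystar := ystar) hS hC hconv hinit hν hreal hΔ i
    hγ' (h := fun p => ENNReal.ofReal ((‖S.output p.1.1 p.2 p.1.2 - ystar‖ ^ 2) ^ 2))
    ((S.measurable_loss ystar).pow_const 2).ennreal_ofReal
    (hS.exists_lintegral_loss_sq_le ystar i)
  have hsum : ∫⁻ ω, ∑' t, ENNReal.ofReal (par.squareIncr S C ystar (fun t => s t ω)
      (fun t => w t ω) (fun i k => Δ i k ω) i t) ∂μ ≠ ⊤ := by
    rw [lintegral_tsum fun t => (hm t).aemeasurable]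
    refine ne_of_eq_of_ne (tsum_congr fun t => ?_) htop
    rw [← lintegral_indicator (hreal.measurable_state t (measurableSet_singleton i))]
    refine lintegral_congr fun ω => ?_
    by_cases h : s t ω = i
    · rw [Set.indicator_of_mem (by exact h), squareIncr, if_pos h,
        ENNReal.ofReal_mul (by positivity)]
      rfl
    · rw [Set.indicator_of_notMem (by exact h), squareIncr, if_neg h, ENNReal.ofReal_zero]
  filter_upwards [ae_lt_top (Measurable.tsum hm) hsum] with ω hω
  have hs : Summable fun t => par.squareIncr S C ystar (fun t => s t ω)
      (fun t => w t ω) (fun i k => Δ i k ω) i t := by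
    have := ENNReal.summable_toReal hω.ne
    simpa only [ENNReal.toReal_ofReal (hnn ω _)] using this
  exact ⟨_, fun T => hs.sum_le_tsum _ fun t _ => hnn ω t⟩

/-- The filtration reveals every perturbation from the start. Coefficient and input at stage `t + 1`
are then known at time `t`, while the next state and noise keep their conditional law. -/
theorem ae_exists_tendsto_sum_noiseIncr [IsProbabilityMeasure μ] (hS : S.IsAdmissible) (hC : IsCompact C)
    (hconv : Convex ℝ C) (hinit : ∀ i, par.xinit i ∈ C) (hν : IsPerturbationLaw ν ξ₁ ξ₂)
    (hreal : S.IsRealization μ s w) (hΔ : ArePerturbations μ ν s w Δ) (i : Fin K)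
    (hγ' : 0 < par.γ' i) :
    ∀ᵐ ω ∂μ, ∃ l, Tendsto (fun T => ∑ t ∈ Finset.range T, par.noiseIncr S C ystar (fun t => s t ω)
      (fun t => w t ω) (fun i k => Δ i k ω) i t) atTop (𝓝 l) := by
  have hne : C.Nonempty := ⟨_, hinit i⟩
  have hprob := hS.isProbabilityMeasure_stepLaw i
  have hvis : ∀ t, MeasurableSet (s t ⁻¹' {i}) := fun t =>
    hreal.measurable_state t (measurableSet_singleton i)
  have hLm := (hS.continuous_stageCost ystar i).measurable
  let ℱ : Filtration ℕ ‹MeasurableSpace Ω› :=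
    { seq := ArePerturbations.history s w Δ
      mono' := ArePerturbations.history_mono s w Δ
      le' := hΔ.history_le hreal }
  let φ : (ℝ × EuclideanSpace ℝ (Fin n)) × (Fin K × EuclideanSpace ℝ (Fin m)) → ℝ := fun p =>
    p.1.1 * (‖S.output p.2.1 p.1.2 p.2.2 - ystar‖ ^ 2 - S.stageCost ystar i p.1.2)
  have hφ : Measurable φ := by
    have h1 := (S.measurable_loss ystar).comp
      (measurable_snd.prodMk (measurable_snd.comp measurable_fst) : Measurable
        fun p : (ℝ × EuclideanSpace ℝ (Fin n)) × (Fin K × EuclideanSpace ℝ (Fin m)) =>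
          (p.2, p.1.2))
    exact (measurable_fst.comp measurable_fst).mul
      (h1.sub (hLm.comp (measurable_snd.comp measurable_fst)))
  refine ae_exists_tendsto_sum_of_martingale_differences (ℱ := ℱ)
    (ξ := fun t ω => par.noiseIncr S C ystar (fun t => s t ω) (fun t => w t ω)
      (fun i k => Δ i k ω) i t) (fun t => ?_) (fun t hint A hA => ?_) ?_
  · exact @measurable_noiseIncr K m n Ω (ArePerturbations.history s w Δ (t + 1)) par S C ystar s w Δ
      hS hC hconv hne t (fun _ ht => ArePerturbations.measurable_state_history s w Δ (t + 1) ht)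
      (fun _ ht => ArePerturbations.measurable_noise_history s w Δ (t + 1) ht)
      (ArePerturbations.measurable_perturbation_history s w Δ (t + 1)) i
  · obtain ⟨hxm, hcm, -⟩ := @measurable_policy K m n Ω (ArePerturbations.history s w Δ t) par S C
      ystar s w Δ hC hconv hne t (fun _ ht => ArePerturbations.measurable_state_history s w Δ t ht)
      (fun _ ht => ArePerturbations.measurable_noise_history s w Δ t ht)
      (ArePerturbations.measurable_perturbation_history s w Δ t) i
    set F : Ω → ℝ := fun ω => φ ((par.noiseCoeff S C ystar (fun t => s t ω) (fun t => w t ω)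
      (fun i k => Δ i k ω) i t, par.inputOf (fun i k => Δ i k ω) (par.memory S C ystar
      (fun t => s t ω) (fun t => w t ω) (fun i k => Δ i k ω) t) i),
      (s (t + 1) ω, w (t + 1) ω)) with hF
    have e : (fun ω => par.noiseIncr S C ystar (fun t => s t ω) (fun t => w t ω)
        (fun i k => Δ i k ω) i t) = (s t ⁻¹' {i}).indicator F := by
      funext ω
      by_cases h : s t ω = i
      · rw [Set.indicator_of_mem (by exact h), noiseIncr, if_pos h]
        rfl
      · rw [Set.indicator_of_notMem (by exact h), noiseIncr, if_neg h]
    have hY := (hreal.measurable_state (t + 1)).prodMk (hreal.measurable_noise (t + 1))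
    have hA' := hΔ.history_le hreal t _ hA
    rw [e] at hint ⊢
    rw [integrable_indicator_iff (hvis t)] at hint
    -- After restriction to the event that the state is `i`, the conditional law is the single
    -- measure `stepLaw i`.
    rw [setIntegral_indicator (hvis t), ← Measure.restrict_restrict hA']
    refine setIntegral_comp_prodMk_eq_zero_of_indep (ρ := μ.restrict (s t ⁻¹' {i}))
      (κ := S.stepLaw i) (hΔ.history_le hreal t) hY
      (hΔ.restrict_history_inter_step hS hreal t i) (hcm.prodMk hxm) hφ hint (fun u => ?_) hA
    simp only [φ]
    rw [integral_const_mul, hS.integral_loss_sub_stageCost, mul_zero]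
  · obtain ⟨D, hD⟩ := exists_bound_curvature S ystar hC i
    have htop := par.tsum_lintegral_weighted_ne_top (ystar := ystar) hS hC hconv hinit hν hreal hΔ
      i hγ' (h := fun p => ENNReal.ofReal ((‖S.output p.1.1 p.2 p.1.2 - ystar‖ ^ 2 -
        S.stageCost ystar i p.2) ^ 2))
      (((S.measurable_loss ystar).sub (hLm.comp measurable_snd)).pow_const 2).ennreal_ofReal
      (hS.exists_lintegral_loss_sub_sq_le ystar i)
    -- The sign of the coefficient squares to one and the estimate stays within `D` of the optimum,
    -- so Cauchy–Schwarz leaves `D²` times the weights already summed.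
    refine ne_top_of_le_ne_top (ENNReal.mul_ne_top (ENNReal.ofReal_ne_top (r := D ^ 2)) htop) ?_
    rw [← ENNReal.tsum_mul_left]
    refine ENNReal.tsum_le_tsum fun t => ?_
    rw [← lintegral_const_mul' _ _ ENNReal.ofReal_ne_top, ← lintegral_indicator (hvis t)]
    refine lintegral_mono fun ω => ?_
    by_cases h : s t ω = i
    · rw [Set.indicator_of_mem (by exact h), noiseIncr, if_pos h, ← ENNReal.ofReal_mul
        (by positivity), ← ENNReal.ofReal_mul (by positivity)]
      refine ENNReal.ofReal_le_ofReal ?_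
      rw [mul_pow, ← mul_assoc]
      refine mul_le_mul_of_nonneg_right ?_ (sq_nonneg _)
      have hz := (hD _ (par.est_mem S C ystar (fun t => s t ω) (fun t => w t ω)
        (fun i k => Δ i k ω) i t hC hinit)).1
      have hsign : (if (par.memory S C ystar (fun t => s t ω) (fun t => w t ω)
        (fun i k => Δ i k ω) t).flag i = true then (-1 : ℝ) else 1) ^ 2 = 1 := by
        split_ifs <;> norm_num
      rw [noiseCoeff, mul_pow, mul_pow, hsign, one_mul]
      set z := (par.memory S C ystar (fun t => s t ω) (fun t => w t ω)
        (fun i k => Δ i k ω) t).est i - S.optInput ystar i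
      set d := coordInv (Δ i (pairIndex (par.memory S C ystar (fun t => s t ω) (fun t => w t ω)
        (fun i k => Δ i k ω) t) i) ω)
      have h1 : inner ℝ z d ^ 2 ≤ D ^ 2 * ‖d‖ ^ 2 := by
        have := pow_le_pow_left₀ (abs_nonneg _) (abs_real_inner_le_norm z d) 2
        rw [sq_abs, mul_pow] at this
        exact this.trans (mul_le_mul_of_nonneg_right (pow_le_pow_left₀ (norm_nonneg _) hz 2)
          (sq_nonneg _))
      rw [mul_left_comm]
      exact mul_le_mul_of_nonneg_left h1 (sq_nonneg _)
    · rw [Set.indicator_of_notMem (by exact h), noiseIncr, if_neg h]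
      simp

/-- The direction series converges almost surely along the random path. -/
theorem ae_exists_tendsto_sum_directionIncr_path [IsProbabilityMeasure μ] (hC : IsCompact C)
    (hconv : Convex ℝ C) (hinit : ∀ i, par.xinit i ∈ C) (hν : IsPerturbationLaw ν ξ₁ ξ₂)
    (hreal : S.IsRealization μ s w) (hΔ : ArePerturbations μ ν s w Δ) (i : Fin K)
    (hγ' : 0 < par.γ' i) :
    ∀ᵐ ω ∂μ, ∃ l, Tendsto (fun T => ∑ t ∈ Finset.range T, par.directionIncr S C ystar
      (fun t => s t ω) (fun t => w t ω) (fun i k => Δ i k ω) i t) atTop (𝓝 l) := by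
  have hne : C.Nonempty := ⟨_, hinit i⟩
  set sys : Ω → ℕ → Fin K × EuclideanSpace ℝ (Fin m) := fun ω t => (s t ω, w t ω) with hsys
  set D : Ω → Fin K × ℕ → EuclideanSpace ℝ (Fin n) := fun ω q => Δ q.1 q.2 ω with hD
  have hsysm : Measurable sys := measurable_pi_lambda _ fun t =>
    (hreal.measurable_state t).prodMk (hreal.measurable_noise t)
  have hDm : Measurable D := measurable_pi_lambda _ fun q => hΔ.measurable q.1 q.2
  have hprod : μ.map (fun ω => (sys ω, D ω)) = (μ.map sys).prod (μ.map D) :=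
    (indepFun_iff_map_prod_eq_prod_map_map hsysm.aemeasurable hDm.aemeasurable).mp
      hΔ.indep_system.symm
  have := Measure.isProbabilityMeasure_map (μ := μ) hDm.aemeasurable
  let incr : ℕ → (ℕ → Fin K × EuclideanSpace ℝ (Fin m)) ×
      (Fin K × ℕ → EuclideanSpace ℝ (Fin n)) → ℝ := fun t p =>
    par.directionIncr S C ystar (fun t => (p.1 t).1) (fun t => (p.1 t).2)
      (fun i k => p.2 (i, k)) i t
  have hincr : ∀ t, Measurable (incr t) := fun t =>
    par.measurable_directionIncr (s := fun t (p : (ℕ → Fin K × EuclideanSpace ℝ (Fin m)) ×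
      (Fin K × ℕ → EuclideanSpace ℝ (Fin n))) => (p.1 t).1) (w := fun t p => (p.1 t).2)
      (Δ := fun i k p => p.2 (i, k)) hC hconv hne t (fun t _ => by fun_prop)
      (fun t _ => by fun_prop) (fun i k => by fun_prop) i
  -- Measurability of the convergence set is what allows the passage from every frozen path to
  -- almost every pair of path and perturbations.
  have hG : MeasurableSet {p | ∃ l, Tendsto (fun T => ∑ t ∈ Finset.range T, incr t p) atTop
      (𝓝 l)} :=
    measurableSet_exists_tendsto fun T => Finset.measurable_sum _ fun t _ => hincr t
  have hall : ∀ᵐ p ∂(μ.map fun ω => (sys ω, D ω)),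
      p ∈ {p | ∃ l, Tendsto (fun T => ∑ t ∈ Finset.range T, incr t p) atTop (𝓝 l)} := by
    rw [hprod, Measure.ae_prod_mem_iff_ae_ae_mem hG]
    refine ae_of_all _ fun y => ?_
    rw [ae_map_iff hDm.aemeasurable (measurable_prodMk_left hG)]
    exact par.ae_exists_tendsto_sum_directionIncr S ystar (fun t => (y t).1) (fun t => (y t).2)
      hC hconv hinit hν hΔ i hγ'
  exact ae_of_ae_map (hsysm.prodMk hDm).aemeasurable hall

end Series

end MSPSAParams

namespace MSPSAParams

variable {K m n : ℕ}

/-! ### Convergence of the policy -/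

section Convergence

variable (par : MSPSAParams K n) {S : JumpAffineSystem K m n} {C : Set (EuclideanSpace ℝ (Fin n))}
  {ystar : EuclideanSpace ℝ (Fin m)} {Ω : Type*} [MeasurableSpace Ω] {μ : Measure Ω}
  {s : ℕ → Ω → Fin K} {w : ℕ → Ω → EuclideanSpace ℝ (Fin m)}
  {Δ : Fin K → ℕ → Ω → EuclideanSpace ℝ (Fin n)} {ν : Measure ℝ} {ξ₁ ξ₂ : ℝ}

/-- On a path along which the estimates for `i` converge, so do the inputs for `i`. -/
lemma tendsto_sq_dist_inputOf (s : ℕ → Fin K) (w : ℕ → EuclideanSpace ℝ (Fin m))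
    (δ : Fin K → ℕ → EuclideanSpace ℝ (Fin n)) (i : Fin K) {B : ℝ}
    (hδ : ∀ k, ‖δ i k‖ ^ 2 ≤ B) (hinf : ∃ᶠ t in atTop, s t = i)
    (hest : Tendsto (fun t => ‖(par.memory S C ystar s w δ t).est i - S.optInput ystar i‖ ^ 2)
      atTop (𝓝 0)) :
    Tendsto (fun t => ‖par.inputOf δ (par.memory S C ystar s w δ t) i - S.optInput ystar i‖ ^ 2)
      atTop (𝓝 0) := by
  -- The index in use is at least the number of completed updates, so the perturbation gain dies out
  -- along the path.
  have hk : Tendsto (fun t => pairIndex (par.memory S C ystar s w δ t) i) atTop atTop := by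
    refine tendsto_atTop_mono (fun t => ?_) (par.tendsto_updates S C ystar s w δ i hinf)
    unfold updates pairIndex
    split_ifs <;> omega
  have hc : Tendsto (fun t => |par.pertGain i (pairIndex (par.memory S C ystar s w δ t) i)| * √B)
      atTop (𝓝 0) := by
    simpa using (((par.tendsto_pertGain i).comp hk).abs).mul_const √B
  have hn : Tendsto (fun t => ‖(par.memory S C ystar s w δ t).est i - S.optInput ystar i‖)
      atTop (𝓝 0) := by
    simpa [Real.sqrt_sq (norm_nonneg _)] using hest.sqrt
  have hsum := (hn.add hc).pow 2
  simp only [add_zero, ne_eq, OfNat.ofNat_ne_zero, not_false_eq_true, zero_pow] at hsum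
  refine squeeze_zero (fun t => sq_nonneg _) (fun t => ?_) hsum
  refine pow_le_pow_left₀ (norm_nonneg _) ?_ 2
  have hpert : ∀ k, ‖par.pertGain i k • δ i k‖ ≤ |par.pertGain i k| * √B := by
    intro k
    rw [norm_smul, Real.norm_eq_abs]
    exact mul_le_mul_of_nonneg_left (Real.le_sqrt_of_sq_le (hδ k)) (abs_nonneg _)
  unfold inputOf pairIndex
  split_ifs with hf
  · rw [sub_right_comm]
    exact (norm_sub_le _ _).trans (by gcongr; exact hpert _)
  · rw [add_sub_right_comm]
    exact (norm_add_le _ _).trans (by gcongr; exact hpert _)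

theorem ae_tendsto_sq_dist_nextInput [IsProbabilityMeasure μ] (hS : S.IsAdmissible)
    (hC : IsCompact C) (hconv : Convex ℝ C) (hopt : ∀ i, S.optInput ystar i ∈ C)
    (hγ : ∀ i, 0 < par.γ i) (hγ' : ∀ i, 0 < par.γ' i) (hinit : ∀ i, par.xinit i ∈ C)
    (hν : IsPerturbationLaw ν ξ₁ ξ₂) (hreal : S.IsRealization μ s w)
    (hΔ : ArePerturbations μ ν s w Δ) :
    ∀ᵐ ω ∂μ, Tendsto (fun T => ‖par.nextInput S C ystar (fun t => s t ω) (fun t => w t ω)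
      (fun i k => Δ i k ω) T - S.optInput ystar (s T ω)‖ ^ 2) atTop (𝓝 0) := by
  have h1 := ae_all_iff.mpr fun i =>
    par.ae_exists_tendsto_sum_noiseIncr (ystar := ystar) hS hC hconv hinit hν hreal hΔ i (hγ' i)
  have h2 := ae_all_iff.mpr fun i => par.ae_exists_tendsto_sum_directionIncr_path (S := S)
    (ystar := ystar) hC hconv hinit hν hreal hΔ i (hγ' i)
  have h3 := ae_all_iff.mpr fun i =>
    par.ae_exists_sum_squareIncr_le (ystar := ystar) hS hC hconv hinit hν hreal hΔ i (hγ' i)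
  filter_upwards [h1, h2, h3, hΔ.ae_norm_sq_le hν] with ω h1 h2 h3 h4
  have hi : ∀ i, ∀ ε > 0, ∀ᶠ T in atTop, s T ω = i →
      ‖par.nextInput S C ystar (fun t => s t ω) (fun t => w t ω) (fun i k => Δ i k ω) T -
        S.optInput ystar (s T ω)‖ ^ 2 < ε := by
    intro i ε hε
    by_cases hinf : ∃ᶠ t in atTop, s t ω = i
    · have hest := par.tendsto_sq_dist_est (fun t => s t ω) (fun t => w t ω) (fun i k => Δ i k ω) i
        hS hC hconv (hopt i) (hγ i) (hγ' i) hinf (h1 i) (h2 i) (h3 i)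
      have hin := par.tendsto_sq_dist_inputOf (fun t => s t ω) (fun t => w t ω)
        (fun i k => Δ i k ω) i (h4 i) hinf hest
      filter_upwards [hin.eventually (gt_mem_nhds hε)] with T hT hs
      rw [nextInput, hs]
      exact hT
    -- A state visited finitely often is eventually never current, so nothing is required of its
    -- estimates.
    · filter_upwards [not_frequently.mp hinf] with T hT hs
      exact absurd hs hT
  rw [Metric.tendsto_nhds]
  intro ε hε
  filter_upwards [eventually_all.mpr fun i => hi i ε hε] with T hT
  rw [Real.dist_0_eq_abs, abs_of_nonneg (sq_nonneg _)]
  exact hT _ rfl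

lemma measurable_nextInput (hreal : S.IsRealization μ s w) (hΔ : ArePerturbations μ ν s w Δ)
    (hC : IsCompact C) (hconv : Convex ℝ C) (hne : C.Nonempty) (T : ℕ) :
    Measurable fun ω => par.nextInput S C ystar (fun t => s t ω) (fun t => w t ω)
      (fun i k => Δ i k ω) T :=
  Measurable.apply_countable (f := fun i ω => par.inputOf (fun i k => Δ i k ω)
    (par.memory S C ystar (fun t => s t ω) (fun t => w t ω) (fun i k => Δ i k ω) T) i)
    (fun i => (par.measurable_policy hC hconv hne T (fun t _ => hreal.measurable_state t)
      (fun t _ => hreal.measurable_noise (t + 1)) hΔ.measurable i).1) (hreal.measurable_state T)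

lemma exists_ae_sq_dist_nextInput_le (hC : IsCompact C) (hγ' : ∀ i, 0 < par.γ' i)
    (hinit : ∀ i, par.xinit i ∈ C) (hν : IsPerturbationLaw ν ξ₁ ξ₂)
    (hΔ : ArePerturbations μ ν s w Δ) :
    ∃ B : ℝ, ∀ᵐ ω ∂μ, ∀ T, ‖par.nextInput S C ystar (fun t => s t ω) (fun t => w t ω)
      (fun i k => Δ i k ω) T - S.optInput ystar (s T ω)‖ ^ 2 ≤ B := by
  choose R hR using fun i => par.exists_ae_norm_inputOf_le (S := S) (ystar := ystar) hC hinit hν hΔ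
    i (hγ' i)
  obtain ⟨B, hB⟩ := Set.finite_range (fun i => (R i + ‖S.optInput ystar i‖) ^ 2) |>.bddAbove
  refine ⟨B, ?_⟩
  filter_upwards [ae_all_iff.mpr hR] with ω hω T
  refine le_trans ?_ (hB ⟨s T ω, rfl⟩)
  exact pow_le_pow_left₀ (norm_nonneg _) ((norm_sub_le _ _).trans
    (add_le_add (hω (s T ω) T) le_rfl)) 2

end Convergence

end MSPSAParams

end

/-! ### The main theorem -/

theorem mainTheorem2 {K m n : ℕ} (S : JumpAffineSystem K m n) (hS : S.IsAdmissible)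
    (ystar : EuclideanSpace ℝ (Fin m))
    (C : Set (EuclideanSpace ℝ (Fin n))) (hCcompact : IsCompact C) (hCconvex : Convex ℝ C)
    (hopt : ∀ i, S.optInput ystar i ∈ C)
    (par : MSPSAParams K n) (hγ : ∀ i, 0 < par.γ i) (hγ' : ∀ i, 0 < par.γ' i)
    (hinit : ∀ i, par.xinit i ∈ C)
    (ν : Measure ℝ) (ξ₁ ξ₂ : ℝ) (hξ₁ : 0 < ξ₁) (hξ₂ : 0 < ξ₂) (hν : IsPerturbationLaw ν ξ₁ ξ₂)
    {Ω : Type*} [MeasurableSpace Ω] (μ : Measure Ω) [IsProbabilityMeasure μ]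
    (s : ℕ → Ω → Fin K) (w : ℕ → Ω → EuclideanSpace ℝ (Fin m))
    (Δ : Fin K → ℕ → Ω → EuclideanSpace ℝ (Fin n))
    (hreal : S.IsRealization μ s w) (hΔ : ArePerturbations μ ν s w Δ)
    (x : ℕ → Ω → EuclideanSpace ℝ (Fin n))
    (hx : ∀ T ω, x (T + 1) ω =
      par.nextInput S C ystar (fun t => s t ω) (fun t => w t ω) (fun i k => Δ i k ω) T) :
    (∀ᵐ ω ∂μ, Tendsto (fun T : ℕ => ‖x (T + 1) ω - S.optInput ystar (s T ω)‖ ^ 2) atTop (𝓝 0)) ∧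
    (∀ T : ℕ, Integrable (fun ω => ‖x (T + 1) ω - S.optInput ystar (s T ω)‖ ^ 2) μ) ∧
    Tendsto (fun T : ℕ => ∫ ω, ‖x (T + 1) ω - S.optInput ystar (s T ω)‖ ^ 2 ∂μ) atTop (𝓝 0) := by
  simp only [hx]
  have hlim := par.ae_tendsto_sq_dist_nextInput hS hCcompact hCconvex hopt hγ hγ' hinit hν hreal hΔ
  obtain ⟨B, hB⟩ := par.exists_ae_sq_dist_nextInput_le (S := S) (ystar := ystar) hCcompact hγ'
    hinit hν hΔ
  have hmeas : ∀ T, AEStronglyMeasurable (fun ω => ‖par.nextInput S C ystar (fun t => s t ω)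
      (fun t => w t ω) (fun i k => Δ i k ω) T - S.optInput ystar (s T ω)‖ ^ 2) μ := by
    intro T
    -- A sample point provides a state, and its initial estimate shows that `C` is nonempty.
    obtain ⟨ω⟩ := nonempty_of_isProbabilityMeasure μ
    have h1 := par.measurable_nextInput (S := S) (ystar := ystar) hreal hΔ hCcompact hCconvex
      ⟨_, hinit (s 0 ω)⟩ T
    have h2 : Measurable fun ω => S.optInput ystar (s T ω) :=
      (measurable_of_finite (S.optInput ystar)).comp (hreal.measurable_state T)
    exact ((h1.sub h2).norm.pow_const 2).aestronglyMeasurable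
  have hbound : ∀ T, ∀ᵐ ω ∂μ, ‖‖par.nextInput S C ystar (fun t => s t ω)
      (fun t => w t ω) (fun i k => Δ i k ω) T - S.optInput ystar (s T ω)‖ ^ 2‖ ≤ B := by
    intro T
    filter_upwards [hB] with ω hω
    rw [Real.norm_eq_abs, abs_of_nonneg (sq_nonneg _)]
    exact hω T
  refine ⟨hlim, fun T => Integrable.of_bound (hmeas T) B (hbound T), ?_⟩
  -- The constant `B` is uniform in time, so almost sure convergence passes to the means.
  have h := tendsto_integral_of_dominated_convergence (fun _ => B) hmeas (integrable_const B)
    hbound hlim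
  simpa using h
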